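/- Let $A\subset\mathbb R^2$ be a disk of radius $\rho>0$ and area $|A|$. The nodes of the network form a homogeneous Poisson point process $\phi$ of density $\lambda$ on $A$. Each node $X_s$ is the source of a packet whose destination is uniform among all other nodes. Routing (random $1/2$-disk, transmission range $R_r$): a packet at node $X$ with destination $Z$, $\|X-Z\|>R_r$, is handed to a relay chosen uniformly among the other nodes in the half-disk $\{y:\|y-X\|\le R_r,\ \langle y-X,Z-X\rangle\ge 0\}$. Let $X_0,X_1,\dots$ be the nodes visited from the source $X_0$, let $\nu$ be the first index with $\|X_\nu-Z\|\le R_r$, let $h=\|X_0-Z\|$, and let $Y_{n+1}=\|X_n-Z\|-\|X_{n+1}-Z\|$ be the progress of a hop. Medium access (slotted ALOHA): in a slot, every node transmits independently with probability $q$. The hop $X_n\to X_{n+1}$ is successful (event $\Lambda_n$) if $X_n$ transmits and no other node within distance $R_I$ of $X_{n+1}$ (in particular not $X_{n+1}$ itself) transmits. Here $R_I=\sqrt{1+l}\,R_r$ with a constant $l\ge 0$. Each packet is observed at a uniformly random hop of its route. The spatial throughput is the mean total progress of all successfully transmitted packets in one slot, $$C(\lambda)=\mathbb E\Big[\sum_{X_s\in\phi}\frac1{\nu}\sum_{n=0}^{\nu-1}Y_{n+1}\mathbf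 1_{\Lambda_n}\Big],$$ where $\nu$, $Y_n$, $\Lambda_n$ refer to the packet of $X_s$. For a quantity $f$ attached to a packet, its mean over a typical packet is $\frac1{\lambda|A|}\mathbb E\big[\sum_{X_s\in\phi}f\big]$; let $\mathbb E[Y]$, $\mathbb P(\Lambda)$ and $\mathbb E[h/\nu]$ be these means for $f=\frac1\nu\sum_{n=0}^{\nu-1}Y_{n+1}$, $f=\frac1\nu\sum_{n=0}^{\nu-1}\mathbf 1_{\Lambda_n}$ and $f=h/\nu$. (Packets with $\nu=0$, or whose route never comes within range of the destination, contribute $0$.) There is a constant $K_0>0$ such that the following holds, as $\lambda\to\infty$, for all $\rho>0$, $l\ge0$, $R_r=R_r(\lambda)$ and $q=q(\lambda)\in[0,1]$ with $R_r\ge K_0\sqrt{\log\lambda/\lambda}$ for all large $\lambda$, $R_r=O(\sqrt{\log\lambda/\lambda})$ and $q=O(1/\log\lambda)$. 1. The average progress per hop satisfies $\mathbb E[Y]\sim\dfrac{4R_r}{3\pi}$. 2. The spatial throughput satisfies $$C\sim\lambda|A|\,\mathbb P(\Lambda)\,\mathbb E[h/\nu]\qquad\text{and}\qquad C\sim\frac{4|A|}{3\pi}\,\lambda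 q R_r\,e^{-\lambda q\pi R_I^2}\big(1-e^{-\lambda(1-q)\pi R_I^2}\big).$$ 3. $C=O(\sqrt{\lambda/\log\lambda})$, and $C=\Theta(\sqrt{\lambda/\log\lambda})$ if moreover $q=\Theta(1/\log\lambda)$. 4. For a throughput with $C=\Theta(f)$, the asymptotic multiplexing gain (AMG) with respect to the scaling $f$ is $\chi=\lim_{\lambda\to\infty}C(\lambda)/f(\lambda)$. If $q=1/(\lambda\pi R_I^2)$ for all large $\lambda$, then $f(\lambda)=\lambda qR_r$ satisfies $f=\Theta(\sqrt{\lambda/\log\lambda})$, $C=\Theta(f)$, and the AMG with respect to $f$ is $$\chi=\frac{4|A|e^{-1}}{3\pi}.$$ ($a\sim b$ means $a-b=o(b)$.) -/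

import Mathlib

open Filter Topology MeasureTheory ProbabilityTheory Asymptotics

noncomputable section

namespace Network

/-- The plane with its Euclidean distance. -/
abbrev Plane := EuclideanSpace ℝ (Fin 2)

/-- The circular network area of radius `ρ`. -/
def area (ρ : ℝ) : Set Plane := Metric.closedBall 0 ρ

/-- Expectation over the homogeneous Poisson point process of density `lam` on `area ρ`: the number
`n` of nodes is Poisson with mean `lam * |A|` and, given `n`, the positions are independent and
uniform on the area. `F n x` is a function of the node configuration `x`. -/
def networkExpect (ρ lam : ℝ) (F : (n : ℕ) → (Fin n → Plane) → ℝ) : ℝ :=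
  ∫ n, (∫ x, F n x ∂(Measure.pi fun _ : Fin n => (volume : Measure Plane)[|area ρ]))
    ∂(poissonMeasure (lam * volume.real (area ρ)).toNNReal)

section Configuration

variable {n : ℕ}

/-- Expectation over the destination of source `s`, uniform among all other nodes. -/
def destExpect (s : Fin n) (f : Fin n → ℝ) : ℝ :=
  (∑ d ∈ Finset.univ.erase s, f d) / ((n : ℝ) - 1)

/-- The closed half-disk of radius `R` centred at `a` and oriented towards `z`. -/
def halfDisk (R : ℝ) (a z : Plane) : Set Plane :=
  {y | dist y a ≤ R ∧ 0 ≤ inner ℝ (y - a) (z - a)}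

open scoped Classical in
/-- The possible next relays at node `i` of a packet with destination node `d`. -/
def relays (R : ℝ) (x : Fin n → Plane) (d i : Fin n) : Finset (Fin n) :=
  {j | j ≠ i ∧ x j ∈ halfDisk R (x i) (x d)}

open scoped Classical in
/-- Probability that a packet for `d` at node `i` is given the next relay `j`: the relay is uniform
among the nodes in the transmission half-disk of `i`. -/
def hopProb (R : ℝ) (x : Fin n → Plane) (d i j : Fin n) : ℝ :=
  if j ∈ relays R x d i then 1 / ((relays R x d i).card : ℝ) else 0

/-- `p 0, …, p m` are the nodes of a path from `s` which is within distance `R` of the destination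
`d` at the index `m`, and at no earlier index. -/
def IsRoute (R : ℝ) (x : Fin n → Plane) (s d : Fin n) (m : ℕ) (p : Fin (m + 1) → Fin n) : Prop :=
  p 0 = s ∧ (∀ k : Fin m, R < dist (x (p k.castSucc)) (x d)) ∧
    dist (x (p (Fin.last m))) (x d) ≤ R

open scoped Classical in
/-- Expectation over the random half-disk route from `s` to `d`. The first index `m` at which the
route is within distance `R` of the destination is random, and `f m p` is a function of it and of
the nodes `p` visited up to then. A route that never gets within range contributes `0`. -/
def routeExpect (R : ℝ) (x : Fin n → Plane) (s d : Fin n)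
    (f : (m : ℕ) → (Fin (m + 1) → Fin n) → ℝ) : ℝ :=
  ∑' m : ℕ, ∑ p : Fin (m + 1) → Fin n with IsRoute R x s d m p,
    (∏ k : Fin m, hopProb R x d (p k.castSucc) (p k.succ)) * f m p

/-- Expectation over the ALOHA decisions in a slot: the nodes independently transmit (`true`) with
probability `q`. -/
def alohaExpect (q : ℝ) (f : (Fin n → Bool) → ℝ) : ℝ :=
  ∑ ω : Fin n → Bool, (∏ k, if ω k then q else 1 - q) * f ω

/-- The transmission from `i` to `j` succeeds: `i` transmits, and no other node within the
interference range `RI` of `j` (in particular not `j` itself) transmits. -/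
def Success (RI : ℝ) (x : Fin n → Plane) (i j : Fin n) (ω : Fin n → Bool) : Prop :=
  ω i = true ∧ ∀ k, k ≠ i → dist (x k) (x j) ≤ RI → ω k = false

open scoped Classical in
/-- Indicator of a successful transmission from `i` to `j`. -/
def successInd (RI : ℝ) (x : Fin n → Plane) (i j : Fin n) (ω : Fin n → Bool) : ℝ :=
  if Success RI x i j ω then 1 else 0

/-- Progress, towards the destination `d`, of the hop from `i` to `j`: the decrement of the distance
to the destination. -/
def progress (x : Fin n → Plane) (d i j : Fin n) : ℝ :=
  dist (x i) (x d) - dist (x j) (x d)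

/-- Average of `g` over the `m` hops of a path. -/
def hopAverage {m : ℕ} (p : Fin (m + 1) → Fin n) (g : Fin n → Fin n → ℝ) : ℝ :=
  (∑ k : Fin m, g (p k.castSucc) (p k.succ)) / m

end Configuration

/-- Spatial throughput: the mean total progress, in one slot, of the successfully transmitted
packets. Each node is the source of one of the packets, and the packet is in the slot at a uniformly
random hop of its route. The expectation is over the nodes, the source-destination pairs, the
routes, the position on the route and the ALOHA decisions. -/
def spatialThroughput (ρ lam R RI q : ℝ) : ℝ :=
  networkExpect ρ lam fun _ x => ∑ s, destExpect s fun d => routeExpect R x s d fun _ p =>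
    hopAverage p fun i j => alohaExpect q fun ω => progress x d i j * successInd RI x i j ω

/-- Mean over a typical packet: the mean sum over all sources, divided by the mean number
`lam * |A|` of nodes. The functional `f` may depend on the nodes, the destination and the route. -/
def typicalExpect (ρ lam R : ℝ)
    (f : (n : ℕ) → (Fin n → Plane) → (s d : Fin n) → (m : ℕ) → (Fin (m + 1) → Fin n) → ℝ) : ℝ :=
  (networkExpect ρ lam fun n x => ∑ s, destExpect s fun d => routeExpect R x s d (f n x s d)) /
    (lam * volume.real (area ρ))

/-- Average progress per hop `E[Y]` of a typical packet. -/
def meanProgress (ρ lam R : ℝ) : ℝ :=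
  typicalExpect ρ lam R fun _ x _ d _ p => hopAverage p fun i j => progress x d i j

/-- The mean `E[h / ν]` for a typical packet, with `h` the distance from source to destination and
`ν` the number of hops until the route is within range of the destination. -/
def meanDistancePerHop (ρ lam R : ℝ) : ℝ :=
  typicalExpect ρ lam R fun _ x s d m _ => dist (x s) (x d) / m

/-- Probability `P(Λ)` that a hop of a typical packet is successful. -/
def successProb (ρ lam R RI q : ℝ) : ℝ :=
  typicalExpect ρ lam R fun _ x _ _ _ p =>
    hopAverage p fun i j => alohaExpect q fun ω => successInd RI x i j ω

/-- `χ` is the asymptotic multiplexing gain of the throughput `C` with respect to the scaling `f`. -/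
def IsAMG (C f : ℝ → ℝ) (χ : ℝ) : Prop :=
  C =Θ[atTop] f ∧ Tendsto (fun lam => C lam / f lam) atTop (𝓝 χ)

end Network

end

/-! A route in a fixed configuration of nodes is a Markov chain with steps of order `R`, and the
theorem is a law of large numbers along it. In a uniformly filled half-disk the mean displacement of
a relay is (2/3 R³)/(π/2 R²) = μR towards the destination, with μ = 4/(3π)
(`integral_halfDisk_inner`, `integral_halfDisk_one`). Curvature changes the distance only by
O(R²/distance). So, away from the destination, a hop shortens the distance by μR + o(R) in the mean.
There are of order 1/R hops, and each adds O(R²) to the second moment, so fluctuations vanish.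

The obstacle is that `R` may be as small as a fixed multiple of √(log λ/λ). Half-disks whose node
counts deviate from the mean by a small fraction then do occur. Two grids handle this. On a coarse
grid of side R/M₀ with a fixed tolerance, K₀ is chosen so that with high probability every square
inside the area is regular; this gives nonempty relay sets and a crude drift of at most -R/10
(`drift_of_sum_estimates`) away from the boundary and outside the range of the destination. On a
fine grid, which resolves sums over nodes to any accuracy (`exists_grid`), irregular squares exist,
but fewer than a constant number k lie in any bounded window (`networkExpect_irregular_le`,
`tendsto_not_sparse`). The crude drift carries packets past them: exponentials of the distance to
the destination are supermartingales, and localised copies add up to a bounded potential that falls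
by 1 at each bad place and elsewhere rises by at most a small β in the mean (`exists_potential`).
Hence bad places account for few of the hops.

All errors are collected in one space-time potential in `one_sub_le_routeExpect_of_regular`: the
squared deviation from a linear decrease of the distance, a penalty for approaching the boundary of
the area, the bad-place potential together with the number of bad visits so far, and a budget for
the remaining hops. The supermartingale bound `one_sub_le_routeExpect` turns it into a probability,
and `one_sub_le_routeExpect_niceRoute` concludes that a route is nice with probability at least 1 -
δ. Averaging over the nodes, and discarding pairs which are close together or near the boundary,
`eventually_le_typicalExpect_nicePacket` makes all but a fraction 5δ of the packets nice.

On a nice route the average progress and h/ν are both μR(1 + o(1)). Most receivers have N ≈ λπR_I²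
potential interferers, so most hops succeed with probability q(1-q)^N = q exp(-λqπR_I²) + o(q),
because λqR² stays bounded. This probability is nearly constant along the route, so progress and
success decouple in the throughput. The other packets are negligible because the functionals have
deterministic bounds O(R), O(q), O(qR) of the same order as the main terms. The scaling law and the
multiplexing gain follow by asymptotic algebra. -/

namespace Network

/-! ### Random routes: first-step decomposition, bounds on expectations, and a supermartingale
criterion -/

section Routes

variable {n : ℕ} {R : ℝ} {x : Fin n → Plane} {d : Fin n}

/-- The probability that a packet for `d` follows the path `p`. -/
noncomputable def pathWeight (R : ℝ) (x : Fin n → Plane) (d : Fin n) {m : ℕ}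
    (p : Fin (m + 1) → Fin n) : ℝ :=
  ∏ k : Fin m, hopProb R x d (p k.castSucc) (p k.succ)

open scoped Classical in
/-- The contribution to `routeExpect` of the routes with `m` hops. -/
noncomputable def routeLevel (R : ℝ) (x : Fin n → Plane) (s d : Fin n) (m : ℕ)
    (f : (Fin (m + 1) → Fin n) → ℝ) : ℝ :=
  ∑ p : Fin (m + 1) → Fin n with IsRoute R x s d m p, pathWeight R x d p * f p

theorem routeExpect_eq_tsum (s : Fin n) (f : (m : ℕ) → (Fin (m + 1) → Fin n) → ℝ) :
    routeExpect R x s d f = ∑' m, routeLevel R x s d m (f m) := rfl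

theorem hopProb_nonneg (i j : Fin n) : 0 ≤ hopProb R x d i j := by
  unfold hopProb; split_ifs <;> positivity

theorem sum_hopProb_mul (i : Fin n) (g : Fin n → ℝ) :
    ∑ j, hopProb R x d i j * g j = (∑ j ∈ relays R x d i, g j) / (relays R x d i).card := by
  simp only [hopProb, ite_mul, zero_mul, Finset.sum_ite_mem, Finset.univ_inter, Finset.sum_div]
  exact Finset.sum_congr rfl fun j _ => by ring

theorem sum_hopProb_of_nonempty {i : Fin n} (h : (relays R x d i).Nonempty) :
    ∑ j, hopProb R x d i j = 1 := by
  have := sum_hopProb_mul (R := R) (x := x) (d := d) i fun _ => 1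
  have hc : ((relays R x d i).card : ℝ) ≠ 0 := by exact_mod_cast h.card_pos.ne'
  simpa [hc] using this

theorem sum_hopProb_le_one (i : Fin n) : ∑ j, hopProb R x d i j ≤ 1 := by
  rcases (relays R x d i).eq_empty_or_nonempty with h | h
  · simp [hopProb, h]
  · exact (sum_hopProb_of_nonempty h).le

theorem mem_relays_of_hopProb_ne_zero {i j : Fin n} (h : hopProb R x d i j ≠ 0) :
    j ∈ relays R x d i := by
  by_contra hj
  simp [hopProb, hj] at h

theorem mem_relays {i j : Fin n} : j ∈ relays R x d i ↔
    j ≠ i ∧ dist (x j) (x i) ≤ R ∧ 0 ≤ inner ℝ (x j - x i) (x d - x i) := by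
  classical
  simp only [relays, Finset.mem_filter, Finset.mem_univ, true_and]
  rfl

theorem ne_of_mem_relays {i j : Fin n} (h : j ∈ relays R x d i) : j ≠ i := (mem_relays.1 h).1

theorem dist_le_of_mem_relays {i j : Fin n} (h : j ∈ relays R x d i) :
    dist (x j) (x i) ≤ R := (mem_relays.1 h).2.1

theorem abs_progress_le {i j : Fin n} (h : dist (x j) (x i) ≤ R) : |progress x d i j| ≤ R := by
  unfold progress
  refine (abs_dist_sub_le _ _ _).trans ?_
  rwa [dist_comm]

theorem pathWeight_nonneg {m : ℕ} (p : Fin (m + 1) → Fin n) : 0 ≤ pathWeight R x d p :=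
  Finset.prod_nonneg fun _ _ => hopProb_nonneg _ _

theorem mem_relays_of_pathWeight_ne_zero {m : ℕ} {p : Fin (m + 1) → Fin n}
    (h : pathWeight R x d p ≠ 0) (k : Fin m) : p k.succ ∈ relays R x d (p k.castSucc) :=
  mem_relays_of_hopProb_ne_zero (Finset.prod_ne_zero_iff.1 h k (Finset.mem_univ _))

theorem pathWeight_cons {m : ℕ} (i : Fin n) (p : Fin (m + 1) → Fin n) :
    pathWeight R x d (Fin.cons i p : Fin (m + 1 + 1) → Fin n) =
      hopProb R x d i (p 0) * pathWeight R x d p := by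
  unfold pathWeight
  rw [Fin.prod_univ_succ]
  rfl

theorem isRoute_cons {m : ℕ} {s i : Fin n} {p : Fin (m + 1) → Fin n} :
    IsRoute R x s d (m + 1) (Fin.cons i p) ↔
      i = s ∧ R < dist (x i) (x d) ∧ IsRoute R x (p 0) d m p := by
  unfold IsRoute
  rw [Fin.forall_fin_succ]
  constructor
  · rintro ⟨h0, ⟨h1, h2⟩, h3⟩
    exact ⟨h0, h1, rfl, h2, h3⟩
  · rintro ⟨h0, h1, _, h2, h3⟩
    exact ⟨h0, ⟨h1, h2⟩, h3⟩

theorem routeLevel_zero (s : Fin n) (f : (Fin (0 + 1) → Fin n) → ℝ) :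
    routeLevel R x s d 0 f = if dist (x s) (x d) ≤ R then f fun _ => s else 0 := by
  classical
  unfold routeLevel
  rw [Finset.sum_filter]
  rw [Finset.sum_eq_single (fun _ => s)]
  · have : IsRoute R x s d 0 (fun _ => s) ↔ dist (x s) (x d) ≤ R := by
      simp [IsRoute]
    simp only [this]
    split_ifs <;> simp [pathWeight]
  · intro p _ hp
    rw [if_neg]
    rintro ⟨h, -⟩
    exact hp (funext fun k => by rw [← h, Fin.fin_one_eq_zero k])
  · simp

/-- The Markov property at the first hop: a path splits into its first node and its tail, and the
sum over `j` only records the first node of the tail. All later statements about routes reduce to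
this recursion. -/
theorem routeLevel_succ (s : Fin n) (m : ℕ) (f : (Fin (m + 1 + 1) → Fin n) → ℝ) :
    routeLevel R x s d (m + 1) f = if R < dist (x s) (x d) then
      ∑ j, hopProb R x d s j * routeLevel R x j d m (fun p => f (Fin.cons s p)) else 0 := by
  classical
  unfold routeLevel
  rw [Finset.sum_filter, ← (Fin.consEquiv fun _ : Fin (m + 1 + 1) => Fin n).sum_comp,
    Fintype.sum_prod_type, Finset.sum_eq_single s]
  · simp only [Fin.consEquiv, Equiv.coe_fn_mk, isRoute_cons, true_and]
    split_ifs with h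
    · simp only [Finset.sum_filter, Finset.mul_sum]
      rw [Finset.sum_comm]
      refine Finset.sum_congr rfl fun p _ => ?_
      rw [Finset.sum_eq_single (p 0)]
      · by_cases hp : IsRoute R x (p 0) d m p
        · simp only [hp, h, and_self, if_true]
          rw [pathWeight_cons]
          ring
        · simp [hp]
      · intro j _ hj
        rw [if_neg, mul_zero]
        rintro ⟨h0, -⟩
        exact hj h0.symm
      · simp
    · simp [h]
  · intro i _ hi
    refine Finset.sum_eq_zero fun p _ => ?_
    simp [Fin.consEquiv, isRoute_cons, hi]
  · simp

theorem routeLevel_mono {s : Fin n} {m : ℕ} {f g : (Fin (m + 1) → Fin n) → ℝ}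
    (h : ∀ p, IsRoute R x s d m p → pathWeight R x d p ≠ 0 → f p ≤ g p) :
    routeLevel R x s d m f ≤ routeLevel R x s d m g := by
  classical
  unfold routeLevel
  refine Finset.sum_le_sum fun p hp => ?_
  by_cases h0 : pathWeight R x d p = 0
  · simp [h0]
  · exact mul_le_mul_of_nonneg_left (h p (Finset.mem_filter.1 hp).2 h0) (pathWeight_nonneg p)

theorem routeLevel_add (s : Fin n) (m : ℕ) (f g : (Fin (m + 1) → Fin n) → ℝ) :
    routeLevel R x s d m (fun p => f p + g p) =
      routeLevel R x s d m f + routeLevel R x s d m g := by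
  simp [routeLevel, mul_add, Finset.sum_add_distrib]

theorem routeLevel_const_mul (s : Fin n) (m : ℕ) (c : ℝ) (f : (Fin (m + 1) → Fin n) → ℝ) :
    routeLevel R x s d m (fun p => c * f p) = c * routeLevel R x s d m f := by
  simp only [routeLevel, Finset.mul_sum]
  exact Finset.sum_congr rfl fun p _ => by ring

theorem routeLevel_one_nonneg (s : Fin n) (m : ℕ) : 0 ≤ routeLevel R x s d m fun _ => 1 :=
  Finset.sum_nonneg fun _ _ => by simpa using pathWeight_nonneg _

/-- The levels are disjoint events, the first entry into the range of the destination happening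
after exactly `m` hops. Their total mass may stay below 1, since a route can get stuck or never
arrive. -/
theorem sum_routeLevel_one_le (N : ℕ) (s : Fin n) :
    ∑ m ∈ Finset.range N, routeLevel R x s d m (fun _ => 1) ≤ 1 := by
  induction N generalizing s with
  | zero => simp
  | succ N ih =>
    rw [Finset.sum_range_succ', routeLevel_zero]
    simp only [routeLevel_succ]
    by_cases h : R < dist (x s) (x d)
    · simp only [h, not_le.2 h, if_true, if_false, add_zero]
      rw [Finset.sum_comm]
      calc ∑ j, ∑ m ∈ Finset.range N, hopProb R x d s j * routeLevel R x j d m (fun _ => 1)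
          ≤ ∑ j, hopProb R x d s j := by
            refine Finset.sum_le_sum fun j _ => ?_
            rw [← Finset.mul_sum]
            exact mul_le_of_le_one_right (hopProb_nonneg _ _) (ih j)
        _ ≤ 1 := sum_hopProb_le_one s
    · simp [h, not_lt.1 h]

theorem summable_routeLevel_one (s : Fin n) :
    Summable fun m => routeLevel R x s d m fun _ => 1 :=
  summable_of_sum_range_le (fun m => routeLevel_one_nonneg s m) fun N => sum_routeLevel_one_le N s

theorem routeExpect_one_le (s : Fin n) : routeExpect R x s d (fun _ _ => 1) ≤ 1 := by
  rw [routeExpect_eq_tsum]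
  exact (summable_routeLevel_one s).tsum_le_of_sum_range_le fun N => sum_routeLevel_one_le N s

/-- `f` is bounded by `B` on the routes from `s` to `d` of positive probability. -/
def RouteBound (R : ℝ) (x : Fin n → Plane) (s d : Fin n) (B : ℝ)
    (f : (m : ℕ) → (Fin (m + 1) → Fin n) → ℝ) : Prop :=
  ∀ m p, IsRoute R x s d m p → pathWeight R x d p ≠ 0 → |f m p| ≤ B

variable {s : Fin n} {f g : (m : ℕ) → (Fin (m + 1) → Fin n) → ℝ} {B : ℝ}

theorem RouteBound.abs_routeLevel_le (hf : RouteBound R x s d B f) (m : ℕ) :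
    |routeLevel R x s d m (f m)| ≤ B * routeLevel R x s d m fun _ => 1 := by
  have h1 := routeLevel_mono (R := R) (x := x) (s := s) (d := d) (f := f m) (g := fun _ => B * 1)
    fun p hp h0 => by simpa using (abs_le.1 (hf m p hp h0)).2
  have h2 := routeLevel_mono (R := R) (x := x) (s := s) (d := d) (f := fun _ => (-B) * 1) (g := f m)
    fun p hp h0 => by simpa using (abs_le.1 (hf m p hp h0)).1
  rw [routeLevel_const_mul] at h1 h2
  rw [abs_le]
  constructor <;> linarith

theorem RouteBound.summable (hf : RouteBound R x s d B f) :
    Summable fun m => routeLevel R x s d m (f m) :=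
  Summable.of_norm_bounded ((summable_routeLevel_one s).mul_left B) fun m =>
    hf.abs_routeLevel_le m

theorem routeExpect_mono (hf : RouteBound R x s d B f) (hg : RouteBound R x s d B g)
    (h : ∀ m p, IsRoute R x s d m p → pathWeight R x d p ≠ 0 → f m p ≤ g m p) :
    routeExpect R x s d f ≤ routeExpect R x s d g :=
  hf.summable.tsum_le_tsum (fun m => routeLevel_mono (h m)) hg.summable

theorem routeExpect_add (hf : RouteBound R x s d B f) (hg : RouteBound R x s d B g) :
    routeExpect R x s d (fun m p => f m p + g m p) =
      routeExpect R x s d f + routeExpect R x s d g := by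
  simp only [routeExpect_eq_tsum]
  rw [← hf.summable.tsum_add hg.summable]
  exact tsum_congr fun m => routeLevel_add s m _ _

theorem routeExpect_const_mul (c : ℝ) :
    routeExpect R x s d (fun m p => c * f m p) = c * routeExpect R x s d f := by
  simp only [routeExpect_eq_tsum]
  rw [← tsum_mul_left]
  exact tsum_congr fun m => routeLevel_const_mul s m c _

theorem abs_routeExpect_le (hB : 0 ≤ B) (hf : RouteBound R x s d B f) :
    |routeExpect R x s d f| ≤ B := by
  have h1 : RouteBound R x s d B fun _ _ => B * 1 := fun _ _ _ _ => by simp [abs_of_nonneg hB]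
  have h2 : RouteBound R x s d B fun _ _ => (-B) * 1 := fun _ _ _ _ => by simp [abs_of_nonneg hB]
  have h3 := routeExpect_mono hf h1 fun m p hp h0 => by simpa using (abs_le.1 (hf m p hp h0)).2
  have h4 := routeExpect_mono h2 hf fun m p hp h0 => by simpa using (abs_le.1 (hf m p hp h0)).1
  rw [routeExpect_const_mul] at h3 h4
  have := routeExpect_one_le (R := R) (x := x) (d := d) s
  rw [abs_le]
  constructor <;> nlinarith

open scoped Classical in
/-- A functional which is nearly constant on a class `Q` of routes and bounded on the other routes
has nearly the expectation of that constant on `Q`. -/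
theorem abs_routeExpect_sub_le {c δ : ℝ} (hδ : 0 ≤ δ) (hB : 0 ≤ B)
    (Q : (m : ℕ) → (Fin (m + 1) → Fin n) → Prop) (hf : RouteBound R x s d B f)
    (hQ : ∀ m p, IsRoute R x s d m p → pathWeight R x d p ≠ 0 → Q m p → |f m p - c| ≤ δ) :
    |routeExpect R x s d f - c * routeExpect R x s d (fun m p => if Q m p then 1 else 0)| ≤
      δ * routeExpect R x s d (fun m p => if Q m p then 1 else 0) +
        B * (1 - routeExpect R x s d (fun m p => if Q m p then 1 else 0)) := by
  set I : (m : ℕ) → (Fin (m + 1) → Fin n) → ℝ := fun m p => if Q m p then 1 else 0 with hI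
  set C := B + |c| + δ with hC
  have bnd : ∀ a b : ℝ, |a| + |b| ≤ C →
      RouteBound R x s d C fun m p => a * I m p + b * 1 := by
    intro a b hab m p _ _
    simp only [hI]
    refine le_trans ?_ hab
    split_ifs
    · simpa using abs_add_le a b
    · simp
  have hc := abs_nonneg c
  have hfC : RouteBound R x s d C f := fun m p h h0 => (hf m p h h0).trans (by linarith)
  have lin : ∀ a b : ℝ, routeExpect R x s d (fun m p => a * I m p + b * 1) =
      a * routeExpect R x s d I + b * routeExpect R x s d fun _ _ => 1 := by
    intro a b
    rw [routeExpect_add (B := |a| + |b|), routeExpect_const_mul, routeExpect_const_mul]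
    · intro m p _ _
      have := abs_nonneg b
      simp only [hI]; split_ifs
      · simp
      · simp; positivity
    · intro m p _ _
      simp
  have gen : ∀ (a b : ℝ), RouteBound R x s d (C + |a| + |b|) fun m p => a * I m p + b * 1 := by
    intro a b m p _ _
    have := abs_nonneg a
    have := abs_nonneg b
    simp only [hI]; split_ifs
    · have := abs_add_le a b
      simp only [mul_one]; linarith
    · simp only [mul_zero, mul_one, zero_add]; linarith
  -- The functional is at most c + δ on `Q` and at most `B` off it, and this majorant is affine in
  -- the indicator. The constant part has mass at most 1, so the bound `B` also pays for routes
  -- which never arrive.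
  have up : routeExpect R x s d f ≤ routeExpect R x s d fun m p => (c + δ - B) * I m p + B * 1 := by
    refine routeExpect_mono (B := C + |c + δ - B| + |B|) ?_ (gen _ _) ?_
    · intro m p h h0
      have := abs_nonneg (c + δ - B)
      have := abs_nonneg B
      exact (hfC m p h h0).trans (by linarith)
    · intro m p h h0
      simp only [hI]; split_ifs with hq
      · have := (abs_le.1 (hQ m p h h0 hq)).2; linarith
      · have := (abs_le.1 (hf m p h h0)).2; linarith
  have lo : (routeExpect R x s d fun m p => (c - δ + B) * I m p + (-B) * 1) ≤
      routeExpect R x s d f := by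
    refine routeExpect_mono (B := C + |c - δ + B| + |-B|) (gen _ _) ?_ ?_
    · intro m p h h0
      have := abs_nonneg (c - δ + B)
      have := abs_nonneg (-B)
      exact (hfC m p h h0).trans (by linarith)
    · intro m p h h0
      simp only [hI]; split_ifs with hq
      · have := (abs_le.1 (hQ m p h h0 hq)).1; linarith
      · have := (abs_le.1 (hf m p h h0)).1; linarith
  rw [lin] at up lo
  have h1 := routeExpect_one_le (R := R) (x := x) (d := d) s
  rw [abs_le]
  constructor <;> nlinarith

/-- Lower bound, by a potential function `W`, for the probability that a route reaches its
destination within `N` hops and satisfies `Q` there. The potential and `Q` depend on the number of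
hops, on the sum of `c` along the route and on the present node. -/
theorem one_sub_le_routeExpect (W : ℕ → ℕ → Fin n → ℝ) (c : Fin n → ℕ) (N : ℕ)
    (Q : ℕ → ℕ → Fin n → Prop) [∀ k a i, Decidable (Q k a i)] (h0 : ∀ k a i, 0 ≤ W k a i)
    (habs : ∀ k a i, dist (x i) (x d) ≤ R → ¬ Q k a i → 1 ≤ W k a i)
    (hend : ∀ a i, R < dist (x i) (x d) → 1 ≤ W N a i)
    (hstep : ∀ k a i, k < N → R < dist (x i) (x d) → W k a i < 1 → (relays R x d i).Nonempty ∧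
      ∑ j, hopProb R x d i j * W (k + 1) (a + c i) j ≤ W k a i) :
    1 - W 0 0 s ≤ routeExpect R x s d
      fun m p => if Q m (∑ k : Fin m, c (p k.castSucc)) (p (Fin.last m)) then 1 else 0 := by
  -- Induction on the number `r` of hops still allowed, for all starting nodes, clock values `k` and
  -- accumulated sums `a` at once.
  have key : ∀ r k a i, k + r = N → 1 - W k a i ≤ ∑ m ∈ Finset.range (r + 1),
      routeLevel R x i d m fun p =>
        if Q (k + m) (a + ∑ l : Fin m, c (p l.castSucc)) (p (Fin.last m)) then (1 : ℝ) else 0 := by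
    have nn : ∀ r k a i, 0 ≤ ∑ m ∈ Finset.range (r + 1), routeLevel R x i d m fun p =>
        if Q (k + m) (a + ∑ l : Fin m, c (p l.castSucc)) (p (Fin.last m)) then (1 : ℝ) else 0 := by
      intro r k a i
      refine Finset.sum_nonneg fun m _ => Finset.sum_nonneg fun p _ => mul_nonneg
        (pathWeight_nonneg p) ?_
      dsimp only
      split_ifs <;> simp
    intro r
    induction r with
    | zero =>
      intro k a i hk
      by_cases h : R < dist (x i) (x d)
      · have h1 := hend a i h
        rw [← hk, add_zero] at h1
        exact le_trans (by linarith) (nn 0 k a i)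
      · by_cases hQ : Q k a i
        · simp [routeLevel_zero, not_lt.1 h, hQ, h0]
        · exact le_trans (by linarith [habs k a i (not_lt.1 h) hQ]) (nn 0 k a i)
    | succ r ih =>
      intro k a i hk
      by_cases h : R < dist (x i) (x d)
      -- Where the potential has reached 1 there is nothing to prove. The supermartingale property
      -- is therefore needed only below 1, and so only in the region to which the potential confines
      -- the route.
      · rcases le_or_gt 1 (W k a i) with h1 | h1
        · exact le_trans (by linarith) (nn (r + 1) k a i)
        obtain ⟨hne, hW⟩ := hstep k a i (by omega) h h1
        rw [Finset.sum_range_succ', routeLevel_zero, if_neg (not_le.2 h), add_zero]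
        simp only [routeLevel_succ, if_pos h]
        rw [Finset.sum_comm]
        calc 1 - W k a i ≤ ∑ j, hopProb R x d i j * (1 - W (k + 1) (a + c i) j) := by
              simp only [mul_sub, mul_one, Finset.sum_sub_distrib, sum_hopProb_of_nonempty hne]
              linarith
          _ ≤ _ := by
              refine Finset.sum_le_sum fun j _ => ?_
              rw [← Finset.mul_sum]
              refine mul_le_mul_of_nonneg_left ?_ (hopProb_nonneg _ _)
              refine (ih (k + 1) (a + c i) j (by omega)).trans (le_of_eq ?_)
              refine Finset.sum_congr rfl fun m _ => ?_
              congr 1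
              funext p
              rw [Fin.sum_univ_succ]
              simp only [Fin.castSucc_zero, Fin.cons_zero, ← Fin.succ_castSucc, Fin.cons_succ,
                ← Fin.succ_last, add_assoc, add_comm m 1]
      · by_cases hQ : Q k a i
        · rw [Finset.sum_range_succ', routeLevel_zero, if_pos (not_lt.1 h)]
          simp only [routeLevel_succ, if_neg h]
          simp [hQ, h0]
        · exact le_trans (by linarith [habs k a i (not_lt.1 h) hQ]) (nn _ k a i)
  have hb : RouteBound R x s d 1
      fun m p => if Q m (∑ k : Fin m, c (p k.castSucc)) (p (Fin.last m)) then 1 else 0 := by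
    intro m p _ _
    dsimp only
    split_ifs <;> simp
  have hk := key N 0 0 s (zero_add N)
  simp only [zero_add] at hk
  refine hk.trans (hb.summable.sum_le_tsum _ fun m _ => ?_)
  refine Finset.sum_nonneg fun p _ => mul_nonneg (pathWeight_nonneg p) ?_
  dsimp only
  split_ifs <;> simp

theorem sum_progress {m : ℕ} (p : Fin (m + 1) → Fin n) :
    ∑ k : Fin m, progress x d (p k.castSucc) (p k.succ) =
      dist (x (p 0)) (x d) - dist (x (p (Fin.last m))) (x d) := by
  induction m with
  | zero => simp
  | succ m ih =>
    rw [Fin.sum_univ_castSucc]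
    have := ih fun k => p k.castSucc
    simp only [Fin.castSucc_zero] at this
    simp only [← Fin.succ_castSucc, Fin.succ_last] at this ⊢
    rw [this]
    unfold progress
    ring

theorem abs_hopAverage_le {m : ℕ} {p : Fin (m + 1) → Fin n} {g : Fin n → Fin n → ℝ} (hB : 0 ≤ B)
    (h : ∀ k : Fin m, |g (p k.castSucc) (p k.succ)| ≤ B) : |hopAverage p g| ≤ B := by
  unfold hopAverage
  rcases Nat.eq_zero_or_pos m with rfl | hm
  · simpa using hB
  have hm' : (0 : ℝ) < m := by exact_mod_cast hm
  rw [abs_div, abs_of_pos hm', div_le_iff₀ hm']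
  calc |∑ k : Fin m, g (p k.castSucc) (p k.succ)| ≤ ∑ k : Fin m, B :=
        (Finset.abs_sum_le_sum_abs _ _).trans (Finset.sum_le_sum fun k _ => h k)
    _ = B * m := by simp [mul_comm]

end Routes

/-! ### Slotted ALOHA: the success probability of a hop -/

section Aloha

variable {n : ℕ}

theorem alohaExpect_const_mul (q c : ℝ) (f : (Fin n → Bool) → ℝ) :
    alohaExpect q (fun ω => c * f ω) = c * alohaExpect q f := by
  simp only [alohaExpect, Finset.mul_sum]
  exact Finset.sum_congr rfl fun ω _ => by ring

open scoped Classical in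
/-- The number of nodes other than `i` within distance `RI` of `j`. -/
noncomputable def interferers (RI : ℝ) (x : Fin n → Plane) (i j : Fin n) : Finset (Fin n) :=
  {k | k ≠ i ∧ dist (x k) (x j) ≤ RI}

/-- Success is a product of constraints on single nodes, so independence factorises the sum over all
decisions: the sender contributes `q`, each interferer 1 - q, every other node 1. The receiver, when
in range of itself, is among the interferers. -/
theorem alohaExpect_successInd (q RI : ℝ) (x : Fin n → Plane) (i j : Fin n) :
    alohaExpect q (successInd RI x i j) = q * (1 - q) ^ (interferers RI x i j).card := by
  classical
  let w : Fin n → Bool → ℝ := fun k b =>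
    (if b then q else 1 - q) * (if k = i then (if b then 1 else 0) else
      if dist (x k) (x j) ≤ RI then (if b then 0 else 1) else 1)
  have h1 : alohaExpect q (successInd RI x i j) = ∑ ω : Fin n → Bool, ∏ k, w k (ω k) := by
    unfold alohaExpect
    refine Finset.sum_congr rfl fun ω _ => ?_
    simp only [w, Finset.prod_mul_distrib]
    congr 1
    unfold successInd
    split_ifs with h
    · symm
      refine Finset.prod_eq_one fun k _ => ?_
      by_cases hk : k = i
      · simp [hk, h.1]
      · by_cases hd : dist (x k) (x j) ≤ RI
        · simp [hk, hd, h.2 k hk hd]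
        · simp [hk, hd]
    · symm
      rw [Finset.prod_eq_zero_iff]
      by_cases hi : ω i = true
      · have : ∃ k, k ≠ i ∧ dist (x k) (x j) ≤ RI ∧ ω k = true := by
          by_contra hne
          push Not at hne
          exact h ⟨hi, fun k hk hd => by simpa using hne k hk hd⟩
        obtain ⟨k, hk, hd, hω⟩ := this
        exact ⟨k, Finset.mem_univ _, by simp [hk, hd, hω]⟩
      · exact ⟨i, Finset.mem_univ _, by simp [hi]⟩
  have h2 : ∑ ω : Fin n → Bool, ∏ k, w k (ω k) = ∏ k, ∑ b, w k b := by
    rw [Finset.prod_univ_sum, Fintype.piFinset_univ]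
  have h3 : ∀ k, ∑ b, w k b =
      if k = i then q else if dist (x k) (x j) ≤ RI then 1 - q else 1 := by
    intro k
    by_cases h1 : k = i
    · simp [w, h1]
    · by_cases h2 : dist (x k) (x j) ≤ RI <;> simp [w, h1, h2]
  rw [h1, h2, Finset.prod_congr rfl fun k _ => h3 k,
    ← Finset.mul_prod_erase _ _ (Finset.mem_univ i), if_pos rfl, interferers]
  congr 1
  rw [Finset.prod_congr rfl (g := fun k => if dist (x k) (x j) ≤ RI then 1 - q else 1)
    fun k hk => if_neg (Finset.ne_of_mem_erase hk), Finset.prod_ite]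
  simp only [Finset.prod_const, one_pow, mul_one]
  congr 2
  ext k
  simp

end Aloha

end Network

namespace Network

/-! ### Expectation over the Poisson point process -/

section Expectation

/-- The law of the position of a node. -/
noncomputable abbrev positionLaw (ρ : ℝ) : Measure Plane := (volume : Measure Plane)[|area ρ]

theorem volume_area (ρ : ℝ) : volume (area ρ) = ENNReal.ofReal ρ ^ 2 * ENNReal.ofReal Real.pi :=
  EuclideanSpace.volume_closedBall_fin_two 0 ρ

theorem volume_real_closedBall (p : Plane) {r : ℝ} (hr : 0 ≤ r) :
    volume.real (Metric.closedBall p r) = Real.pi * r ^ 2 := by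
  rw [measureReal_def, EuclideanSpace.volume_closedBall_fin_two, ENNReal.toReal_mul,
    ENNReal.toReal_pow, ENNReal.toReal_ofReal hr, ENNReal.toReal_ofReal Real.pi_pos.le, mul_comm]

theorem volume_real_area {ρ : ℝ} (hρ : 0 ≤ ρ) : volume.real (area ρ) = Real.pi * ρ ^ 2 :=
  volume_real_closedBall 0 hρ

theorem measurableSet_area (ρ : ℝ) : MeasurableSet (area ρ) := Metric.isClosed_closedBall.measurableSet

theorem isProbabilityMeasure_positionLaw {ρ : ℝ} (hρ : 0 < ρ) :
    IsProbabilityMeasure (positionLaw ρ) := by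
  refine cond_isProbabilityMeasure_of_finite ?_ ?_
  · rw [volume_area]; simp [hρ, Real.pi_pos]
  · rw [volume_area]; exact ENNReal.mul_ne_top (by simp) (by simp)

/-- The random variables which can be integrated: measurable and of at most exponential growth in
the number of nodes. -/
structure Admissible (F : (n : ℕ) → (Fin n → Plane) → ℝ) : Prop where
  measurable : ∀ n, Measurable (F n)
  bound : ∃ C K : ℝ, 0 ≤ C ∧ 1 ≤ K ∧ ∀ n x, |F n x| ≤ C * K ^ n

variable {F G : (n : ℕ) → (Fin n → Plane) → ℝ}

theorem Admissible.of_abs_le {B : ℝ} (hm : ∀ n, Measurable (F n)) (hB : 0 ≤ B)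
    (h : ∀ n x, |F n x| ≤ B * n) : Admissible F := by
  refine ⟨hm, B, 2, hB, by norm_num, fun n x => (h n x).trans ?_⟩
  refine mul_le_mul_of_nonneg_left ?_ hB
  exact_mod_cast Nat.lt_two_pow_self.le

theorem Admissible.of_abs_le_const {B : ℝ} (hm : ∀ n, Measurable (F n)) (hB : 0 ≤ B)
    (h : ∀ n x, |F n x| ≤ B) : Admissible F :=
  ⟨hm, B, 1, hB, le_rfl, fun n x => by simpa using h n x⟩

theorem Admissible.add (hF : Admissible F) (hG : Admissible G) :
    Admissible fun n x => F n x + G n x := by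
  obtain ⟨C, K, hC, hK, h⟩ := hF.bound
  obtain ⟨C', K', hC', hK', h'⟩ := hG.bound
  refine ⟨fun n => (hF.measurable n).add (hG.measurable n), C + C', max K K', by positivity,
    le_max_of_le_left hK, fun n x => (abs_add_le _ _).trans ?_⟩
  rw [add_mul]
  refine add_le_add ((h n x).trans ?_) ((h' n x).trans ?_) <;> gcongr <;> simp

theorem Admissible.const_mul (c : ℝ) (hF : Admissible F) : Admissible fun n x => c * F n x := by
  obtain ⟨C, K, hC, hK, h⟩ := hF.bound
  refine ⟨fun n => (hF.measurable n).const_mul c, |c| * C, K, by positivity, hK, fun n x => ?_⟩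
  rw [abs_mul, mul_assoc]
  exact mul_le_mul_of_nonneg_left (h n x) (abs_nonneg c)

theorem Admissible.sum {ι : Type*} {F : ι → (n : ℕ) → (Fin n → Plane) → ℝ} (s : Finset ι)
    (hF : ∀ i ∈ s, Admissible (F i)) : Admissible fun n x => ∑ i ∈ s, F i n x := by
  classical
  induction s using Finset.induction_on with
  | empty => exact Admissible.of_abs_le_const (B := 0) (by simp) le_rfl (by simp)
  | insert i s hi ih =>
    simp only [Finset.sum_insert hi]
    exact (hF i (by simp)).add (ih fun j hj => hF j (by simp [hj]))

theorem integrable_pow_poissonMeasure (r : NNReal) (K : ℝ) :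
    Integrable (fun n : ℕ => K ^ n) (poissonMeasure r) := by
  rw [integrable_poissonMeasure_iff]
  have := (Real.summable_pow_div_factorial (r * |K|)).mul_left (Real.exp (-r))
  refine this.congr fun n => ?_
  rw [Real.norm_eq_abs, abs_pow, mul_pow]
  ring

theorem integral_pow_poissonMeasure (r : NNReal) (K : ℝ) :
    ∫ n : ℕ, K ^ n ∂poissonMeasure r = Real.exp (r * (K - 1)) := by
  rw [integral_poissonMeasure]
  have h := (NormedSpace.expSeries_div_hasSum_exp ((r : ℝ) * K)).mul_left (Real.exp (-r))
  rw [← Real.exp_eq_exp_ℝ, ← Real.exp_add] at h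
  rw [show (r : ℝ) * (K - 1) = -r + r * K by ring, ← h.tsum_eq]
  refine tsum_congr fun n => ?_
  rw [smul_eq_mul, mul_pow]
  ring

theorem integral_natCast_poissonMeasure (r : NNReal) :
    ∫ n : ℕ, (n : ℝ) ∂poissonMeasure r = r := by
  rw [integral_poissonMeasure]
  have h := (hasSum_one_poissonMeasure r).mul_left (r : ℝ)
  rw [mul_one] at h
  refine HasSum.tsum_eq ?_
  rw [← hasSum_nat_add_iff' 1]
  simp only [Finset.sum_range_one, CharP.cast_eq_zero, smul_zero, sub_zero]
  convert! h using 2 with n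
  rw [smul_eq_mul, Nat.factorial_succ]
  have := n.factorial_ne_zero
  push_cast
  field_simp
  ring

variable {ρ : ℝ} {lam : ℝ}

theorem Admissible.integrable (hρ : 0 < ρ) (hF : Admissible F) (n : ℕ) :
    Integrable (F n) (Measure.pi fun _ : Fin n => positionLaw ρ) := by
  have := isProbabilityMeasure_positionLaw hρ
  obtain ⟨C, K, hC, hK, h⟩ := hF.bound
  exact Integrable.of_bound (hF.measurable n).aestronglyMeasurable (C * K ^ n)
    (ae_of_all _ fun x => h n x)

theorem Admissible.integrable_integral (hρ : 0 < ρ) (hF : Admissible F) (r : NNReal) :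
    Integrable (fun n : ℕ => ∫ x, F n x ∂(Measure.pi fun _ : Fin n => positionLaw ρ))
      (poissonMeasure r) := by
  have := isProbabilityMeasure_positionLaw hρ
  obtain ⟨C, K, hC, hK, h⟩ := hF.bound
  refine ((integrable_pow_poissonMeasure r K).const_mul C).mono'
    (Measurable.of_discrete.aestronglyMeasurable) (ae_of_all _ fun n => ?_)
  refine (norm_integral_le_of_norm_le_const (C := C * K ^ n) (ae_of_all _ fun x => h n x)).trans ?_
  simp

/-- Comparison after averaging the positions for each fixed number of nodes.
`networkExpect_pairs_le` needs this form, since its bound fails for individual configurations. -/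
theorem networkExpect_mono_of_integral (hρ : 0 < ρ) (hF : Admissible F) (hG : Admissible G)
    (h : ∀ n, ∫ x, F n x ∂(Measure.pi fun _ : Fin n => positionLaw ρ) ≤
      ∫ x, G n x ∂(Measure.pi fun _ : Fin n => positionLaw ρ)) :
    networkExpect ρ lam F ≤ networkExpect ρ lam G :=
  integral_mono (hF.integrable_integral hρ _) (hG.integrable_integral hρ _) h

theorem networkExpect_mono (hρ : 0 < ρ) (hF : Admissible F) (hG : Admissible G)
    (h : ∀ n x, F n x ≤ G n x) : networkExpect ρ lam F ≤ networkExpect ρ lam G :=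
  networkExpect_mono_of_integral hρ hF hG fun n =>
    integral_mono (hF.integrable hρ n) (hG.integrable hρ n) (h n)

theorem networkExpect_add (hρ : 0 < ρ) (hF : Admissible F) (hG : Admissible G) :
    networkExpect ρ lam (fun n x => F n x + G n x) =
      networkExpect ρ lam F + networkExpect ρ lam G := by
  unfold networkExpect
  rw [← integral_add (hF.integrable_integral hρ _) (hG.integrable_integral hρ _)]
  congr 1
  funext n
  exact integral_add (hF.integrable hρ n) (hG.integrable hρ n)

theorem networkExpect_const_mul (c : ℝ) :
    networkExpect ρ lam (fun n x => c * F n x) = c * networkExpect ρ lam F := by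
  simp only [networkExpect, integral_const_mul]

theorem networkExpect_sum (hρ : 0 < ρ) {ι : Type*} {F : ι → (n : ℕ) → (Fin n → Plane) → ℝ}
    (s : Finset ι) (hF : ∀ i ∈ s, Admissible (F i)) :
    networkExpect ρ lam (fun n x => ∑ i ∈ s, F i n x) = ∑ i ∈ s, networkExpect ρ lam (F i) := by
  classical
  induction s using Finset.induction_on with
  | empty => simp [networkExpect]
  | insert i s hi ih =>
    simp only [Finset.sum_insert hi]
    rw [networkExpect_add hρ (hF i (by simp)) (Admissible.sum s fun j hj => hF j (by simp [hj])),
      ih fun j hj => hF j (by simp [hj])]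

theorem networkExpect_const (hρ : 0 < ρ) (c : ℝ) : networkExpect ρ lam (fun _ _ => c) = c := by
  have := isProbabilityMeasure_positionLaw hρ
  simp [networkExpect]

theorem networkExpect_card (hρ : 0 < ρ) (hlam : 0 ≤ lam) :
    networkExpect ρ lam (fun n _ => n) = lam * volume.real (area ρ) := by
  have := isProbabilityMeasure_positionLaw hρ
  simp only [networkExpect, integral_const, probReal_univ, one_smul]
  rw [integral_natCast_poissonMeasure, Real.coe_toNNReal _ (by positivity)]

/-- The Laplace functional of the Poisson process: given `n` nodes the product integrates to the
n-th power of the mean of `h`, and the Poisson generating function sums these powers. -/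
theorem networkExpect_prod (hρ : 0 < ρ) (hlam : 0 ≤ lam) (h : Plane → ℝ) :
    networkExpect ρ lam (fun _ x => ∏ j, h (x j)) =
      Real.exp (lam * (∫ y in area ρ, h y) - lam * volume.real (area ρ)) := by
  have := isProbabilityMeasure_positionLaw hρ
  have hA : volume.real (area ρ) ≠ 0 := by
    rw [volume_real_area hρ.le]; positivity
  have hA' : volume (area ρ) ≠ ⊤ := by
    rw [volume_area]; exact ENNReal.mul_ne_top (by simp) (by simp)
  simp only [networkExpect]
  simp_rw [integral_fintype_prod_eq_pow h, Fintype.card_fin]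
  rw [integral_pow_poissonMeasure, Real.coe_toNNReal _ (by positivity), ProbabilityTheory.cond,
    integral_smul_measure, ENNReal.toReal_inv, smul_eq_mul, ← measureReal_def]
  congr 1
  field_simp

theorem admissible_prod {h : Plane → ℝ} (hm : Measurable h) {K : ℝ} (hK : ∀ y, |h y| ≤ K) :
    Admissible fun _ x => ∏ j, h (x j) := by
  refine ⟨fun n => Finset.measurable_prod _ fun j _ => hm.comp (measurable_pi_apply j), 1, max K 1,
    zero_le_one, le_max_right _ _, fun n x => ?_⟩
  rw [Finset.abs_prod, one_mul]
  refine (Finset.prod_le_prod (fun _ _ => abs_nonneg _) fun j _ =>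
    (hK (x j)).trans (le_max_left K 1)).trans ?_
  simp

theorem admissible_card : Admissible fun n _ => (n : ℝ) :=
  Admissible.of_abs_le (B := 1) (fun n => measurable_const) zero_le_one (by simp)

open scoped Classical in
/-- The mean number of nodes in an unlikely event is of smaller order than the number of nodes. -/
theorem networkExpect_card_mul_indicator_le (hρ : 0 < ρ) (hlam : 2 ≤ lam * volume.real (area ρ))
    {E : (n : ℕ) → (Fin n → Plane) → Prop} (hE : ∀ n, MeasurableSet {x | E n x}) {K : ℝ}
    (hK : 0 ≤ K) :
    networkExpect ρ lam (fun n x => if E n x then (n : ℝ) else 0) ≤ lam * volume.real (area ρ) *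
      (K * networkExpect ρ lam (fun n x => if E n x then 1 else 0) + Real.exp (4 - K)) := by
  set r := lam * volume.real (area ρ) with hr
  have hr0 : 0 < r := by linarith
  have hlam0 : 0 ≤ lam := by
    by_contra hneg
    have := mul_nonpos_of_nonpos_of_nonneg (not_le.1 hneg).le
      (measureReal_nonneg (μ := (volume : Measure Plane)) (s := area ρ))
    linarith
  have hI : Admissible fun n x => if E n x then (1 : ℝ) else 0 :=
    Admissible.of_abs_le_const (B := 1)
      (fun n => Measurable.ite (hE n) measurable_const measurable_const) zero_le_one
      fun n x => by split_ifs <;> simp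
  have hN : Admissible fun n x => if E n x then (n : ℝ) else 0 :=
    Admissible.of_abs_le (B := 1)
      (fun n => Measurable.ite (hE n) measurable_const measurable_const) zero_le_one
      fun n x => by split_ifs <;> simp
  have hP : Admissible fun n x => ∏ _j : Fin n, Real.exp (2 / r) :=
    admissible_prod measurable_const (K := Real.exp (2 / r)) fun _ => by simp
  calc networkExpect ρ lam (fun n x => if E n x then (n : ℝ) else 0)
      ≤ networkExpect ρ lam (fun n x => (r * K) * (if E n x then (1 : ℝ) else 0) +
          (r * Real.exp (-K)) * ∏ _j : Fin n, Real.exp (2 / r)) := by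
        -- Either n ≤ rK, and the first term dominates, or n > rK, and then n ≤ r exp(n/r) ≤ r
        -- exp(-K) exp(2n/r). The exponential moment at 2/r is bounded by e⁴ because 2/r ≤ 1.
        refine networkExpect_mono hρ hN ((hI.const_mul _).add (hP.const_mul _)) fun n x => ?_
        have hpow : ∏ _j : Fin n, Real.exp (2 / r) = Real.exp (n * (2 / r)) := by
          simp [← Real.exp_nat_mul]
        rw [hpow]
        have hpos : 0 ≤ r * Real.exp (-K) * Real.exp (n * (2 / r)) := by positivity
        split_ifs
        · rcases le_total (n : ℝ) (r * K) with h | h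
          · linarith
          · have h1 : (n : ℝ) / r ≤ Real.exp (n / r) := by
              linarith [Real.add_one_le_exp ((n : ℝ) / r)]
            have h2 : Real.exp ((n : ℝ) / r) ≤ Real.exp (-K) * Real.exp (n * (2 / r)) := by
              rw [← Real.exp_add, Real.exp_le_exp]
              have : K ≤ n / r := by rw [le_div_iff₀ hr0]; linarith
              have h3 : (n : ℝ) * (2 / r) = 2 * (n / r) := by ring
              linarith
            have h3 : (n : ℝ) = r * (n / r) := by field_simp
            have h4 : (n : ℝ) ≤ r * (Real.exp (-K) * Real.exp (n * (2 / r))) := by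
              conv_lhs => rw [h3]
              exact mul_le_mul_of_nonneg_left (h1.trans h2) hr0.le
            have : 0 ≤ r * K := by positivity
            linarith
        · linarith
    _ = r * K * networkExpect ρ lam (fun n x => if E n x then 1 else 0) +
          r * Real.exp (-K) * Real.exp (r * (Real.exp (2 / r) - 1)) := by
        rw [networkExpect_add hρ (hI.const_mul _) (hP.const_mul _), networkExpect_const_mul,
          networkExpect_const_mul, networkExpect_prod hρ hlam0 (fun _ => Real.exp (2 / r))]
        congr 3
        simp only [setIntegral_const, smul_eq_mul]
        rw [hr]; ring
    _ ≤ _ := by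
        have h1 : Real.exp (2 / r) - 1 ≤ 2 * (2 / r) := by
          have h2r : 2 / r ≤ 1 := by rw [div_le_one hr0]; exact hlam
          have h0 : 0 ≤ 2 / r := by positivity
          have := Real.abs_exp_sub_one_le (x := 2 / r) (by rwa [abs_of_nonneg h0])
          rw [abs_of_nonneg h0] at this
          exact (le_abs_self _).trans this
        have h2 : r * (Real.exp (2 / r) - 1) ≤ 4 := by
          calc r * (Real.exp (2 / r) - 1) ≤ r * (2 * (2 / r)) := by gcongr
            _ = 4 := by field_simp; norm_num
        have h3 : Real.exp (-K) * Real.exp (r * (Real.exp (2 / r) - 1)) ≤ Real.exp (4 - K) := by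
          rw [← Real.exp_add, Real.exp_le_exp]; linarith
        have := mul_le_mul_of_nonneg_left h3 hr0.le
        linarith

theorem positionLaw_ball_le (hρ : 0 < ρ) (p : Plane) {η : ℝ} (hη : 0 ≤ η) :
    (positionLaw ρ).real (Metric.closedBall p η) ≤ η ^ 2 / ρ ^ 2 := by
  rw [measureReal_def, cond_apply (measurableSet_area ρ), ENNReal.toReal_mul, ENNReal.toReal_inv,
    ← measureReal_def, ← measureReal_def, volume_real_area hρ.le]
  have h1 : volume.real (area ρ ∩ Metric.closedBall p η) ≤ Real.pi * η ^ 2 := by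
    rw [← volume_real_closedBall p hη]
    exact measureReal_mono Set.inter_subset_right (by
      rw [EuclideanSpace.volume_closedBall_fin_two]; exact ENNReal.mul_ne_top (by simp) (by simp))
  calc (Real.pi * ρ ^ 2)⁻¹ * volume.real (area ρ ∩ Metric.closedBall p η)
      ≤ (Real.pi * ρ ^ 2)⁻¹ * (Real.pi * η ^ 2) := by gcongr
    _ = η ^ 2 / ρ ^ 2 := by have := Real.pi_pos; field_simp

theorem positionLaw_compl_area (hρ : 0 < ρ) {r : ℝ} (hr : 0 ≤ r) (hrρ : r ≤ ρ) :
    (positionLaw ρ).real {y | r < ‖y‖} = 1 - r ^ 2 / ρ ^ 2 := by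
  have := isProbabilityMeasure_positionLaw hρ
  have h1 : {y : Plane | r < ‖y‖} = (area r)ᶜ := by
    ext y; simp [area]
  rw [h1, probReal_compl_eq_one_sub (measurableSet_area r), measureReal_def,
    cond_apply (measurableSet_area ρ), ENNReal.toReal_mul, ENNReal.toReal_inv,
    ← measureReal_def, ← measureReal_def, volume_real_area hρ.le,
    Set.inter_eq_right.2 (show area r ⊆ area ρ from Metric.closedBall_subset_closedBall hrρ),
    volume_real_area hr]
  have := Real.pi_pos
  field_simp

theorem pi_positionLaw_eval (hρ : 0 < ρ) {n : ℕ} (s : Fin n) {S : Set Plane}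
    (hS : MeasurableSet S) :
    (Measure.pi fun _ : Fin n => positionLaw ρ).real {x | x s ∈ S} = (positionLaw ρ).real S := by
  have := isProbabilityMeasure_positionLaw hρ
  have h := (measurePreserving_eval (fun _ : Fin n => positionLaw ρ) s).measure_preimage
    hS.nullMeasurableSet
  rw [measureReal_def, measureReal_def, ← h]
  rfl

/-- The two positions are independent, so Fubini reduces the claim to the probability of a disk of
radius `η` around a fixed point. -/
theorem pi_positionLaw_dist_le (hρ : 0 < ρ) {n : ℕ} {s d : Fin n} (hsd : s ≠ d) {η : ℝ}
    (hη : 0 ≤ η) :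
    (Measure.pi fun _ : Fin n => positionLaw ρ).real {x | dist (x d) (x s) ≤ η} ≤
      η ^ 2 / ρ ^ 2 := by
  have := isProbabilityMeasure_positionLaw hρ
  have hi : iIndepFun (fun (i : Fin n) (x : Fin n → Plane) => x i)
      (Measure.pi fun _ : Fin n => positionLaw ρ) :=
    iIndepFun_pi (X := fun _ => id) fun _ => aemeasurable_id
  have h2 := (indepFun_iff_map_prod_eq_prod_map_map (measurable_pi_apply s).aemeasurable
    (measurable_pi_apply d).aemeasurable).1 (hi.indepFun hsd)
  rw [(measurePreserving_eval (fun _ : Fin n => positionLaw ρ) s).map_eq] at h2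
  rw [(measurePreserving_eval (fun _ : Fin n => positionLaw ρ) d).map_eq] at h2
  have hm : MeasurableSet {z : Plane × Plane | dist z.2 z.1 ≤ η} :=
    measurableSet_le (measurable_snd.dist measurable_fst) measurable_const
  have h3 : (Measure.pi fun _ : Fin n => positionLaw ρ) {x | dist (x d) (x s) ≤ η} =
      ((positionLaw ρ).prod (positionLaw ρ)) {z : Plane × Plane | dist z.2 z.1 ≤ η} := by
    rw [← h2, Measure.map_apply (by fun_prop) hm]
    rfl
  rw [measureReal_def, h3, Measure.prod_apply hm]
  refine ENNReal.toReal_le_of_le_ofReal (by positivity) ?_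
  calc ∫⁻ a, positionLaw ρ (Prod.mk a ⁻¹' {z : Plane × Plane | dist z.2 z.1 ≤ η}) ∂positionLaw ρ
      ≤ ∫⁻ _, ENNReal.ofReal (η ^ 2 / ρ ^ 2) ∂positionLaw ρ := by
        refine lintegral_mono fun a => ?_
        have h4 := positionLaw_ball_le hρ a hη
        rw [measureReal_def] at h4
        exact (ENNReal.le_ofReal_iff_toReal_le (measure_ne_top _ _) (by positivity)).2 h4
    _ = ENNReal.ofReal (η ^ 2 / ρ ^ 2) := by simp

end Expectation

end Network

namespace Network

/-! ### Averages over sources, destinations and routes -/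

section Packets

theorem abs_destExpect_le {n : ℕ} {s : Fin n} {f : Fin n → ℝ} {B : ℝ} (hB : 0 ≤ B)
    (h : ∀ d, d ≠ s → |f d| ≤ B) : |destExpect s f| ≤ B := by
  have hn : 1 ≤ n := s.pos
  have hn' : (1 : ℝ) ≤ n := by exact_mod_cast hn
  unfold destExpect
  rw [abs_div, abs_of_nonneg (by linarith : (0 : ℝ) ≤ (n : ℝ) - 1)]
  refine div_le_of_le_mul₀ (by linarith) hB ?_
  calc |∑ d ∈ Finset.univ.erase s, f d| ≤ ∑ d ∈ Finset.univ.erase s, B :=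
        (Finset.abs_sum_le_sum_abs _ _).trans
          (Finset.sum_le_sum fun d hd => h d (Finset.ne_of_mem_erase hd))
    _ = B * (n - 1) := by
        rw [Finset.sum_const, Finset.card_erase_of_mem (Finset.mem_univ s), Finset.card_univ,
          Fintype.card_fin, nsmul_eq_mul, Nat.cast_sub hn, Nat.cast_one, mul_comm]

theorem destExpect_mono {n : ℕ} {s : Fin n} {f g : Fin n → ℝ} (h : ∀ d, d ≠ s → f d ≤ g d) :
    destExpect s f ≤ destExpect s g := by
  have hn : (1 : ℝ) ≤ n := by exact_mod_cast s.pos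
  exact div_le_div_of_nonneg_right
    (Finset.sum_le_sum fun d hd => h d (Finset.ne_of_mem_erase hd)) (by linarith)

theorem destExpect_add {n : ℕ} (s : Fin n) (f g : Fin n → ℝ) :
    destExpect s (fun d => f d + g d) = destExpect s f + destExpect s g := by
  simp only [destExpect, Finset.sum_add_distrib, add_div]

theorem destExpect_const_mul {n : ℕ} (s : Fin n) (c : ℝ) (f : Fin n → ℝ) :
    destExpect s (fun d => c * f d) = c * destExpect s f := by
  simp only [destExpect, ← Finset.mul_sum, mul_div_assoc]

/-- A single node has no possible destination, and the average is then the default value 0. This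
exception costs one packet in `le_packetSum`. -/
theorem destExpect_const {n : ℕ} (hn : 2 ≤ n) (s : Fin n) (c : ℝ) :
    destExpect s (fun _ => c) = c := by
  have hn' : (2 : ℝ) ≤ n := by exact_mod_cast hn
  unfold destExpect
  rw [Finset.sum_const, Finset.card_erase_of_mem (Finset.mem_univ s), Finset.card_univ,
    Fintype.card_fin, nsmul_eq_mul, Nat.cast_sub (by omega), Nat.cast_one]
  have : (n : ℝ) - 1 ≠ 0 := by linarith
  field_simp

/-- Functionals of the nodes, the source, the destination and the route of a packet. -/
abbrev PacketFunctional : Type :=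
  (n : ℕ) → (Fin n → Plane) → (s d : Fin n) → (m : ℕ) → (Fin (m + 1) → Fin n) → ℝ

/-- The sum over all packets of the conditional mean of a functional given the nodes. -/
noncomputable def packetSum (R : ℝ) (f : PacketFunctional) : (n : ℕ) → (Fin n → Plane) → ℝ :=
  fun n x => ∑ s, destExpect s fun d => routeExpect R x s d (f n x s d)

theorem typicalExpect_eq (ρ lam R : ℝ) (f : PacketFunctional) :
    typicalExpect ρ lam R f =
      networkExpect ρ lam (packetSum R f) / (lam * volume.real (area ρ)) := rfl

/-- A measurable functional which is bounded by `B` on the routes of positive probability. -/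
structure RegularFunctional (R B : ℝ) (f : PacketFunctional) : Prop where
  measurable : ∀ n s d m p, Measurable fun x => f n x s d m p
  bound : ∀ n x s d, RouteBound R x s d B (f n x s d)

variable {R : ℝ}

theorem measurableSet_mem_relays {n : ℕ} (d i j : Fin n) :
    MeasurableSet {x : Fin n → Plane | j ∈ relays R x d i} := by
  classical
  have : {x : Fin n → Plane | j ∈ relays R x d i} =
      {x | j ≠ i} ∩ ({x | dist (x j) (x i) ≤ R} ∩ {x | 0 ≤ inner ℝ (x j - x i) (x d - x i)}) := by
    ext x
    simp only [mem_relays, Set.mem_ofPred_eq, Set.mem_inter_iff]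
  rw [this]
  refine (MeasurableSet.const _).inter ((measurableSet_le ?_ measurable_const).inter
    (measurableSet_le measurable_const ?_)) <;> fun_prop

theorem measurable_hopProb {n : ℕ} (d i j : Fin n) :
    Measurable fun x : Fin n → Plane => hopProb R x d i j := by
  classical
  have hc : Measurable fun x : Fin n → Plane => ((relays R x d i).card : ℝ) := by
    have : (fun x : Fin n → Plane => ((relays R x d i).card : ℝ)) =
        fun x => ∑ k, if k ∈ relays R x d i then (1 : ℝ) else 0 := by
      funext x; simp
    rw [this]
    exact Finset.measurable_sum _ fun k _ =>
      Measurable.ite (measurableSet_mem_relays d i k) measurable_const measurable_const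
  unfold hopProb
  exact Measurable.ite (measurableSet_mem_relays d i j) (hc.const_div 1) measurable_const

theorem measurableSet_isRoute {n : ℕ} (s d : Fin n) (m : ℕ) (p : Fin (m + 1) → Fin n) :
    MeasurableSet {x : Fin n → Plane | IsRoute R x s d m p} := by
  have : {x : Fin n → Plane | IsRoute R x s d m p} = {_x : Fin n → Plane | p 0 = s} ∩
      ((⋂ k : Fin m, {x : Fin n → Plane | R < dist (x (p k.castSucc)) (x d)}) ∩
        {x | dist (x (p (Fin.last m))) (x d) ≤ R}) := by
    ext x; simp [IsRoute]
  rw [this]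
  refine (MeasurableSet.const _).inter (MeasurableSet.inter (MeasurableSet.iInter fun k =>
    measurableSet_lt measurable_const ?_) (measurableSet_le ?_ measurable_const)) <;> fun_prop

variable {B : ℝ} {f : PacketFunctional}

/-- Each level is a finite sum of measurable terms. The series is a pointwise limit of partial sums
because boundedness on routes of positive weight makes it summable. -/
theorem RegularFunctional.measurable_routeExpect (hf : RegularFunctional R B f) {n : ℕ}
    (s d : Fin n) : Measurable fun x => routeExpect R x s d (f n x s d) := by
  classical
  have hlev : ∀ m, Measurable fun x => routeLevel R x s d m (f n x s d m) := by
    intro m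
    simp only [routeLevel, Finset.sum_filter]
    refine Finset.measurable_sum _ fun p _ => ?_
    refine Measurable.ite (measurableSet_isRoute s d m p) (Measurable.mul ?_
      (hf.measurable n s d m p)) measurable_const
    exact Finset.measurable_prod _ fun k _ => measurable_hopProb _ _ _
  refine measurable_of_tendsto_metrizable
    (f := fun N x => ∑ m ∈ Finset.range N, routeLevel R x s d m (f n x s d m))
    (fun N => Finset.measurable_sum _ fun m _ => hlev m) ?_
  rw [tendsto_pi_nhds]
  intro x
  exact (hf.bound n x s d).summable.tendsto_sum_tsum_nat

theorem RegularFunctional.abs_packetSum_le (hf : RegularFunctional R B f) (hB : 0 ≤ B) (n : ℕ)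
    (x : Fin n → Plane) : |packetSum R f n x| ≤ B * n := by
  refine (Finset.abs_sum_le_sum_abs _ _).trans ?_
  calc ∑ s, |destExpect s fun d => routeExpect R x s d (f n x s d)| ≤ ∑ _s : Fin n, B :=
        Finset.sum_le_sum fun s _ => abs_destExpect_le hB fun d _ =>
          abs_routeExpect_le hB (hf.bound n x s d)
    _ = B * n := by simp [mul_comm]

theorem RegularFunctional.admissible (hf : RegularFunctional R B f) (hB : 0 ≤ B) :
    Admissible (packetSum R f) := by
  refine Admissible.of_abs_le (fun n => ?_) hB (hf.abs_packetSum_le hB)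
  refine Finset.measurable_sum _ fun s _ => ?_
  exact (Finset.measurable_sum _ fun d _ => hf.measurable_routeExpect s d).div_const _

open scoped Classical in
/-- The indicator of a class of packets. -/
noncomputable def indicatorFunctional
    (Q : (n : ℕ) → (Fin n → Plane) → (s d : Fin n) → (m : ℕ) → (Fin (m + 1) → Fin n) → Prop) :
    PacketFunctional :=
  fun n x s d m p => if Q n x s d m p then 1 else 0

variable {Q : (n : ℕ) → (Fin n → Plane) → (s d : Fin n) → (m : ℕ) → (Fin (m + 1) → Fin n) → Prop}

theorem regularFunctional_indicator (hQ : ∀ n s d m p, MeasurableSet {x | Q n x s d m p}) :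
    RegularFunctional R 1 (indicatorFunctional Q) := by
  classical
  refine ⟨fun n s d m p => Measurable.ite (hQ n s d m p) measurable_const measurable_const,
    fun n x s d m p _ _ => ?_⟩
  unfold indicatorFunctional
  split_ifs <;> simp

/-- The bound of `abs_routeExpect_sub_le` is affine in the indicator and survives averaging. Missing
mass, from routes that never arrive or from a lone node, is counted by `B` together with the routes
outside `Q`. -/
theorem abs_packetSum_sub_le {c δ : ℝ} (hδ : 0 ≤ δ) (hB : 0 ≤ B) (hf : RegularFunctional R B f)
    {n : ℕ} {x : Fin n → Plane}
    (h : ∀ s d m p, IsRoute R x s d m p → pathWeight R x d p ≠ 0 → Q n x s d m p →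
      |f n x s d m p - c| ≤ δ) :
    |packetSum R f n x - c * packetSum R (indicatorFunctional Q) n x| ≤
      δ * packetSum R (indicatorFunctional Q) n x +
        B * (n - packetSum R (indicatorFunctional Q) n x) := by
  have hI : ∀ s d, |routeExpect R x s d (f n x s d) -
      c * routeExpect R x s d (indicatorFunctional Q n x s d)| ≤
      δ * routeExpect R x s d (indicatorFunctional Q n x s d) +
        B * (1 - routeExpect R x s d (indicatorFunctional Q n x s d)) :=
    fun s d => abs_routeExpect_sub_le hδ hB (Q n x s d) (hf.bound n x s d) (h s d)
  have hs : ∀ s : Fin n, |destExpect s (fun d => routeExpect R x s d (f n x s d)) -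
      c * destExpect s fun d => routeExpect R x s d (indicatorFunctional Q n x s d)| ≤
      δ * destExpect s (fun d => routeExpect R x s d (indicatorFunctional Q n x s d)) +
        B * (1 - destExpect s
          fun d => routeExpect R x s d (indicatorFunctional Q n x s d)) := by
    intro s
    set g := fun d => routeExpect R x s d (indicatorFunctional Q n x s d)
    have h1 := destExpect_mono (s := s) (f := fun d => routeExpect R x s d (f n x s d))
      (g := fun d => (c + δ - B) * g d + B * 1) fun d _ => by
        have := (abs_le.1 (hI s d)).2
        simp only [g]; linarith
    have h2 := destExpect_mono (s := s) (g := fun d => routeExpect R x s d (f n x s d))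
      (f := fun d => (c - δ + B) * g d + (-B) * 1) fun d _ => by
        have := (abs_le.1 (hI s d)).1
        simp only [g]; linarith
    rw [destExpect_add, destExpect_const_mul, destExpect_const_mul] at h1 h2
    have h3 : destExpect s (fun _ : Fin n => (1 : ℝ)) ≤ 1 :=
      (abs_le.1 (abs_destExpect_le zero_le_one fun d _ => by simp)).2
    rw [abs_le]
    constructor <;> nlinarith
  unfold packetSum
  have hn : (n : ℝ) = ∑ _s : Fin n, (1 : ℝ) := by simp
  rw [hn, Finset.mul_sum, Finset.mul_sum, ← Finset.sum_sub_distrib, ← Finset.sum_sub_distrib,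
    Finset.mul_sum, ← Finset.sum_add_distrib]
  exact (Finset.abs_sum_le_sum_abs _ _).trans (Finset.sum_le_sum fun s _ => hs s)

theorem abs_typicalExpect_sub_le {ρ lam c δ : ℝ} (hρ : 0 < ρ) (hlam : 0 < lam) (hδ : 0 ≤ δ)
    (hB : 0 ≤ B) (hf : RegularFunctional R B f)
    (hQ : ∀ n s d m p, MeasurableSet {x | Q n x s d m p})
    (h : ∀ n x s d m p, IsRoute R x s d m p → pathWeight R x d p ≠ 0 → Q n x s d m p →
      |f n x s d m p - c| ≤ δ) :
    |typicalExpect ρ lam R f - c * typicalExpect ρ lam R (indicatorFunctional Q)| ≤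
      δ * typicalExpect ρ lam R (indicatorFunctional Q) +
        B * (1 - typicalExpect ρ lam R (indicatorFunctional Q)) := by
  have hA : 0 < lam * volume.real (area ρ) := by
    rw [volume_real_area hρ.le]; have := Real.pi_pos; positivity
  have hIa := (regularFunctional_indicator (R := R) hQ).admissible zero_le_one
  have hfa := hf.admissible hB
  have h1 : networkExpect ρ lam (packetSum R f) ≤ networkExpect ρ lam fun n x =>
      (c + δ - B) * packetSum R (indicatorFunctional Q) n x + B * n := by
    refine networkExpect_mono hρ hfa ((hIa.const_mul _).add (admissible_card.const_mul _))
      fun n x => ?_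
    have := (abs_le.1 (abs_packetSum_sub_le hδ hB hf (h n x))).2
    linarith
  have h2 : (networkExpect ρ lam fun n x =>
      (c - δ + B) * packetSum R (indicatorFunctional Q) n x + (-B) * n) ≤
      networkExpect ρ lam (packetSum R f) := by
    refine networkExpect_mono hρ ((hIa.const_mul _).add (admissible_card.const_mul _)) hfa
      fun n x => ?_
    have := (abs_le.1 (abs_packetSum_sub_le hδ hB hf (h n x))).1
    linarith
  rw [networkExpect_add hρ (hIa.const_mul _) (admissible_card.const_mul _),
    networkExpect_const_mul, networkExpect_const_mul, networkExpect_card hρ hlam.le] at h1 h2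
  simp only [typicalExpect_eq]
  set V := lam * volume.real (area ρ)
  set I := networkExpect ρ lam (packetSum R (indicatorFunctional Q))
  set F := networkExpect ρ lam (packetSum R f)
  have e1 : F / V - c * (I / V) = (F - c * I) / V := by ring
  have e2 : δ * (I / V) + B * (1 - I / V) = (δ * I + B * (V - I)) / V := by field_simp
  rw [e1, e2, abs_div, abs_of_pos hA, div_le_div_iff_of_pos_right hA, abs_le]
  constructor <;> linarith

theorem typicalExpect_indicator_le_one {ρ lam : ℝ} (hρ : 0 < ρ) (hlam : 0 < lam)
    (hQ : ∀ n s d m p, MeasurableSet {x | Q n x s d m p}) :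
    typicalExpect ρ lam R (indicatorFunctional Q) ≤ 1 := by
  have hA : 0 < lam * volume.real (area ρ) := by
    rw [volume_real_area hρ.le]; have := Real.pi_pos; positivity
  rw [typicalExpect_eq, div_le_one hA, ← networkExpect_card hρ hlam.le]
  refine networkExpect_mono hρ ((regularFunctional_indicator hQ).admissible zero_le_one)
    admissible_card fun n x => ?_
  simpa using (abs_le.1 ((regularFunctional_indicator (R := R) hQ).abs_packetSum_le
    zero_le_one n x)).2

theorem measurableSet_farPair (r η : ℝ) (n : ℕ) (s d : Fin n) :
    MeasurableSet {x : Fin n → Plane | ‖x s‖ ≤ r ∧ ‖x d‖ ≤ r ∧ η < dist (x s) (x d)} := by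
  have : {x : Fin n → Plane | ‖x s‖ ≤ r ∧ ‖x d‖ ≤ r ∧ η < dist (x s) (x d)} =
      {x | ‖x s‖ ≤ r} ∩ ({x | ‖x d‖ ≤ r} ∩ {x | η < dist (x s) (x d)}) := by
    ext x; simp
  rw [this]
  refine (measurableSet_le ?_ measurable_const).inter ((measurableSet_le ?_
    measurable_const).inter (measurableSet_lt measurable_const ?_)) <;> fun_prop

open scoped Classical in
theorem measurable_pairIndicator (r η : ℝ) (n : ℕ) (s d : Fin n) :
    Measurable fun x : Fin n → Plane =>
      if ‖x s‖ ≤ r ∧ ‖x d‖ ≤ r ∧ η < dist (x s) (x d) then (0 : ℝ) else 1 :=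
  Measurable.ite (measurableSet_farPair r η n s d) measurable_const measurable_const

open scoped Classical in
theorem admissible_pairs (r η : ℝ) : Admissible fun n x => ∑ s : Fin n, destExpect s fun d =>
    if ‖x s‖ ≤ r ∧ ‖x d‖ ≤ r ∧ η < dist (x s) (x d) then (0 : ℝ) else 1 := by
  refine Admissible.of_abs_le (B := 1) (fun n => Finset.measurable_sum _ fun s _ =>
    (Finset.measurable_sum _ fun d _ => measurable_pairIndicator r η n s d).div_const _)
    zero_le_one fun n x => ?_
  refine (Finset.abs_sum_le_sum_abs _ _).trans ?_
  calc _ ≤ ∑ _s : Fin n, (1 : ℝ) := Finset.sum_le_sum fun s _ =>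
        abs_destExpect_le zero_le_one fun d _ => by split_ifs <;> simp
    _ = 1 * n := by simp

open scoped Classical in
/-- The number of pairs of a source and a destination, one of which is outside of the disk of
radius `r`, or which are within distance `η`, is a small fraction of all pairs. -/
theorem networkExpect_pairs_le {ρ lam r η : ℝ} (hρ : 0 < ρ) (hlam : 0 ≤ lam) (hr : 0 ≤ r)
    (hrρ : r ≤ ρ) (hη : 0 ≤ η) :
    networkExpect ρ lam (fun n x => ∑ s : Fin n, destExpect s fun d =>
      if ‖x s‖ ≤ r ∧ ‖x d‖ ≤ r ∧ η < dist (x s) (x d) then 0 else 1) ≤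
      (2 * (1 - r ^ 2 / ρ ^ 2) + η ^ 2 / ρ ^ 2) * (lam * volume.real (area ρ)) := by
  have := isProbabilityMeasure_positionLaw hρ
  set κ := 2 * (1 - r ^ 2 / ρ ^ 2) + η ^ 2 / ρ ^ 2 with hκ
  have hr1 : r ^ 2 / ρ ^ 2 ≤ 1 := by rw [div_le_one (by positivity)]; gcongr
  have hκ0 : 0 ≤ κ := by have : 0 ≤ η ^ 2 / ρ ^ 2 := by positivity
                         linarith
  have hmS := measurableSet_farPair r η
  have hmI := measurable_pairIndicator r η
  have hadm := admissible_pairs r η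
  calc _ ≤ networkExpect ρ lam (fun n _ => κ * n) := by
        refine networkExpect_mono_of_integral hρ hadm (admissible_card.const_mul κ) fun n => ?_
        have hint : ∀ s d : Fin n, Integrable (fun x : Fin n → Plane =>
            if ‖x s‖ ≤ r ∧ ‖x d‖ ≤ r ∧ η < dist (x s) (x d) then (0 : ℝ) else 1)
            (Measure.pi fun _ : Fin n => positionLaw ρ) := fun s d =>
          Integrable.of_bound (hmI n s d).aestronglyMeasurable 1
            (ae_of_all _ fun x => by split_ifs <;> simp)
        have hpair : ∀ s d : Fin n, d ≠ s → ∫ x : Fin n → Plane,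
            (if ‖x s‖ ≤ r ∧ ‖x d‖ ≤ r ∧ η < dist (x s) (x d) then (0 : ℝ) else 1)
            ∂(Measure.pi fun _ : Fin n => positionLaw ρ) ≤ κ := by
          intro s d hsd
          have hm1 : MeasurableSet {y : Plane | r < ‖y‖} :=
            measurableSet_lt measurable_const measurable_norm
          have h1 := pi_positionLaw_eval hρ s hm1
          have h2 := pi_positionLaw_eval hρ d hm1
          have h3 := pi_positionLaw_dist_le hρ hsd hη
          rw [positionLaw_compl_area hρ hr hrρ] at h1 h2
          have e : (fun x : Fin n → Plane =>
              if ‖x s‖ ≤ r ∧ ‖x d‖ ≤ r ∧ η < dist (x s) (x d) then (0 : ℝ) else 1) =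
              Set.indicator {x | ‖x s‖ ≤ r ∧ ‖x d‖ ≤ r ∧ η < dist (x s) (x d)}ᶜ 1 := by
            funext x
            by_cases hx : ‖x s‖ ≤ r ∧ ‖x d‖ ≤ r ∧ η < dist (x s) (x d) <;>
              simp [Set.indicator, hx]
          rw [e, integral_indicator_one (hmS n s d).compl]
          -- A union bound: the source is too far out, or the destination is, or the two are too
          -- close to each other.
          calc _ ≤ (Measure.pi fun _ : Fin n => positionLaw ρ).real
                (({x | x s ∈ {y : Plane | r < ‖y‖}} ∪ {x | x d ∈ {y : Plane | r < ‖y‖}}) ∪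
                  {x | dist (x s) (x d) ≤ η}) := by
                refine measureReal_mono ?_ (measure_ne_top _ _)
                intro x hx
                simp only [Set.mem_compl_iff, Set.mem_ofPred_eq, not_and_or, not_le, not_lt] at hx
                simp only [Set.mem_union, Set.mem_ofPred_eq]
                tauto
            _ ≤ _ := by
                refine (measureReal_union_le _ _).trans ?_
                have := measureReal_union_le (μ := Measure.pi fun _ : Fin n => positionLaw ρ)
                  {x | x s ∈ {y : Plane | r < ‖y‖}} {x | x d ∈ {y : Plane | r < ‖y‖}}
                linarith
        simp only [destExpect]
        rw [integral_finsetSum _ fun s _ => (integrable_finsetSum _ fun d _ =>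
          hint s d).div_const _]
        calc _ ≤ ∑ _s : Fin n, κ := by
              refine Finset.sum_le_sum fun s _ => ?_
              rw [integral_div, integral_finsetSum _ fun d _ => hint s d]
              refine (le_abs_self _).trans (abs_destExpect_le (s := s) hκ0 fun d hd => ?_)
              rw [abs_of_nonneg]
              · exact hpair s d hd
              · exact integral_nonneg fun x => by dsimp only; split_ifs <;> simp
          _ = ∫ _x : Fin n → Plane, κ * n ∂(Measure.pi fun _ : Fin n => positionLaw ρ) := by
              simp [mul_comm]
    _ = _ := by rw [networkExpect_const_mul, networkExpect_card hρ hlam]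

end Packets

end Network

namespace Network

/-! ### Integrals over half-disks, areas of strips and annuli -/

section HalfDisk

/-- A linear isometry from the complex plane which maps `1` to a given unit vector. -/
theorem exists_isometry_complex {u : Plane} (hu : ‖u‖ = 1) : ∃ L : ℂ ≃ₗᵢ[ℝ] Plane, L 1 = u := by
  let L₀ : ℂ ≃ₗᵢ[ℝ] Plane := Complex.orthonormalBasisOneI.repr
  have h : ‖L₀ 1‖ = ‖u‖ := by rw [L₀.norm_map, hu]; simp
  exact ⟨L₀.trans (Submodule.reflection (ℝ ∙ (L₀ 1 - u))ᗮ), Submodule.reflection_sub h⟩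

theorem inner_isometry_complex {u : Plane} {L : ℂ ≃ₗᵢ[ℝ] Plane} (hL : L 1 = u) (w : ℂ) :
    inner ℝ (L w) u = w.re := by
  rw [← hL, L.inner_map_map]
  simp [Complex.inner]

/-- Polar coordinates separate the variables. The Jacobian adds one power of `r`, and the condition
on the real part restricts the angle to a half-turn. -/
theorem integral_rightHalfDisk {R : ℝ} (hR : 0 ≤ R) (k : ℕ) (g : ℝ → ℝ) {F : ℂ → ℝ}
    (hF : ∀ r θ, F (Complex.polarCoord.symm (r, θ)) = r ^ k * g θ) :
    ∫ w in {w : ℂ | ‖w‖ ≤ R ∧ 0 ≤ w.re}, F w =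
      R ^ (k + 2) / (k + 2) * ∫ θ in (-(Real.pi / 2))..(Real.pi / 2), g θ := by
  have hS : MeasurableSet {w : ℂ | ‖w‖ ≤ R ∧ 0 ≤ w.re} := by
    have : {w : ℂ | ‖w‖ ≤ R ∧ 0 ≤ w.re} = {w : ℂ | ‖w‖ ≤ R} ∩ {w : ℂ | 0 ≤ w.re} := by
      ext; simp
    rw [this]
    exact (measurableSet_le measurable_norm measurable_const).inter
      (measurableSet_le measurable_const Complex.measurable_re)
  have hpi := Real.pi_pos
  rw [← integral_indicator hS, ← Complex.integral_comp_polarCoord_symm]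
  have hT : MeasurableSet (Set.Ioc 0 R ×ˢ Set.Ioc (-(Real.pi / 2)) (Real.pi / 2)) :=
    measurableSet_Ioc.prod measurableSet_Ioc
  have h1 : ∀ p ∈ polarCoord.target, p.2 ≠ -(Real.pi / 2) →
      p.1 • Set.indicator {w : ℂ | ‖w‖ ≤ R ∧ 0 ≤ w.re} F (Complex.polarCoord.symm p) =
      Set.indicator (Set.Ioc 0 R ×ˢ Set.Ioc (-(Real.pi / 2)) (Real.pi / 2))
        (fun p => p.1 ^ (k + 1) * g p.2) p := by
    rintro ⟨r, θ⟩ hp hne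
    simp only [polarCoord_target, Set.mem_prod, Set.mem_Ioi, Set.mem_Ioo] at hp
    obtain ⟨hr, hθ1, hθ2⟩ := hp
    have hmem : Complex.polarCoord.symm (r, θ) ∈ {w : ℂ | ‖w‖ ≤ R ∧ 0 ≤ w.re} ↔
        (r, θ) ∈ Set.Ioc 0 R ×ˢ Set.Ioc (-(Real.pi / 2)) (Real.pi / 2) := by
      have hre : (Complex.polarCoord.symm (r, θ)).re = r * Real.cos θ := by
        rw [Complex.polarCoord_symm_apply]
        simp only [Complex.re_ofReal_mul, Complex.add_re, Complex.ofReal_re, Complex.mul_I_re,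
          Complex.ofReal_im, neg_zero, add_zero]
      simp only [Set.mem_ofPred_eq, Complex.norm_polarCoord_symm, abs_of_pos hr, hre, Set.mem_prod,
        Set.mem_Ioc, hr, true_and]
      refine and_congr_right fun _ => ?_
      rw [mul_nonneg_iff_of_pos_left hr]
      constructor
      · intro hc
        constructor
        · by_contra hlt
          have hlt' : θ < -(Real.pi / 2) := lt_of_le_of_ne (not_lt.1 hlt) hne
          have := Real.cos_neg_of_pi_div_two_lt_of_lt (x := -θ) (by linarith) (by linarith)
          rw [Real.cos_neg] at this
          linarith
        · by_contra hlt
          have := Real.cos_neg_of_pi_div_two_lt_of_lt (x := θ) (by linarith) (by linarith)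
          linarith
      · rintro ⟨h1, h2⟩
        exact Real.cos_nonneg_of_neg_pi_div_two_le_of_le (by linarith) h2
    by_cases hm : (r, θ) ∈ Set.Ioc 0 R ×ˢ Set.Ioc (-(Real.pi / 2)) (Real.pi / 2)
    · rw [Set.indicator_of_mem (hmem.2 hm), Set.indicator_of_mem hm, hF, smul_eq_mul]
      ring
    · rw [Set.indicator_of_notMem (mt hmem.1 hm), Set.indicator_of_notMem hm, smul_zero]
  -- The angle -π/2 lies in the closed half-disk but not in the half-open interval used for the
  -- integral. It is a null set.
  have hnull : ∀ᵐ p : ℝ × ℝ, p.2 ≠ -(Real.pi / 2) := by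
    have : (volume : Measure (ℝ × ℝ)) (Set.univ ×ˢ {-(Real.pi / 2)}) = 0 := by
      rw [Measure.volume_eq_prod, Measure.prod_prod]; simp
    refine measure_mono_null (fun p hp => ?_) this
    simpa using hp
  rw [setIntegral_congr_ae (g := Set.indicator (Set.Ioc 0 R ×ˢ Set.Ioc (-(Real.pi / 2))
    (Real.pi / 2)) fun p : ℝ × ℝ => p.1 ^ (k + 1) * g p.2)
    polarCoord.open_target.measurableSet (hnull.mono fun p hp hpt => h1 p hpt hp),
    setIntegral_indicator hT]
  have hsub : polarCoord.target ∩ Set.Ioc 0 R ×ˢ Set.Ioc (-(Real.pi / 2)) (Real.pi / 2) =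
      Set.Ioc 0 R ×ˢ Set.Ioc (-(Real.pi / 2)) (Real.pi / 2) := by
    rw [Set.inter_eq_right]
    rintro ⟨r, θ⟩ ⟨h1, h2⟩
    exact ⟨h1.1, by simp only [Set.mem_Ioo]; exact ⟨by linarith [h2.1], by linarith [h2.2]⟩⟩
  rw [hsub, Measure.volume_eq_prod, setIntegral_prod_mul (fun r : ℝ => r ^ (k + 1)) g,
    intervalIntegral.integral_of_le (by linarith), ← intervalIntegral.integral_of_le hR,
    integral_pow]
  congr 1
  push_cast
  rw [zero_pow (by omega), sub_zero]
  congr 1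
  ring

variable {R : ℝ} {p z : Plane}

theorem measurableSet_halfDisk : MeasurableSet (halfDisk R p z) := by
  have : halfDisk R p z = {y | dist y p ≤ R} ∩ {y | 0 ≤ inner ℝ (y - p) (z - p)} := by
    ext; simp [halfDisk]
  rw [this]
  refine (measurableSet_le ?_ measurable_const).inter (measurableSet_le measurable_const ?_) <;>
    fun_prop

/-- A half-disk depends only on its centre and the direction of the destination, so an isometry
carries it to the right half-disk of the complex plane. -/
theorem setIntegral_halfDisk {u : Plane} {t : ℝ} (ht : 0 < t) (hz : z = p + t • u)
    {L : ℂ ≃ₗᵢ[ℝ] Plane} (hL : L 1 = u) (G : Plane → ℝ) :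
    ∫ y in halfDisk R p z, G y = ∫ w in {w : ℂ | ‖w‖ ≤ R ∧ 0 ≤ w.re}, G (p + L w) := by
  have hpre : {w : ℂ | ‖w‖ ≤ R ∧ 0 ≤ w.re} = (fun w => p + L w) ⁻¹' halfDisk R p z := by
    ext w
    simp only [halfDisk, Set.mem_ofPred_eq, Set.mem_preimage, dist_eq_norm, add_sub_cancel_left,
      hz, L.norm_map, inner_smul_right, inner_isometry_complex hL, mul_nonneg_iff_of_pos_left ht]
  have hmp : MeasurePreserving (fun w : ℂ => p + L w) volume volume :=
    (measurePreserving_add_left volume p).comp L.measurePreserving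
  have hme : MeasurableEmbedding fun w : ℂ => p + L w :=
    (MeasurableEquiv.addLeft p).measurableEmbedding.comp L.toMeasurableEquiv.measurableEmbedding
  rw [hpre, hmp.setIntegral_preimage_emb hme]

theorem integral_halfDisk_one (hR : 0 ≤ R) (h : p ≠ z) :
    ∫ _y in halfDisk R p z, (1 : ℝ) = Real.pi / 2 * R ^ 2 := by
  have hzp : 0 < ‖z - p‖ := norm_pos_iff.2 (sub_ne_zero.2 h.symm)
  obtain ⟨L, hL⟩ := exists_isometry_complex (u := ‖z - p‖⁻¹ • (z - p))
    (by rw [norm_smul, norm_inv, norm_norm]; field_simp)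
  rw [setIntegral_halfDisk hzp (by rw [smul_smul, mul_inv_cancel₀ hzp.ne']; simp) hL,
    integral_rightHalfDisk hR 0 (fun _ => 1) (by simp)]
  simp
  ring

/-- Divided by the area, this is the mean squared length R²/2 of a hop, which controls the curvature
correction to the progress. -/
theorem integral_halfDisk_sq (hR : 0 ≤ R) (h : p ≠ z) :
    ∫ y in halfDisk R p z, dist y p ^ 2 = Real.pi / 4 * R ^ 4 := by
  have hzp : 0 < ‖z - p‖ := norm_pos_iff.2 (sub_ne_zero.2 h.symm)
  obtain ⟨L, hL⟩ := exists_isometry_complex (u := ‖z - p‖⁻¹ • (z - p))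
    (by rw [norm_smul, norm_inv, norm_norm]; field_simp)
  rw [setIntegral_halfDisk hzp (by rw [smul_smul, mul_inv_cancel₀ hzp.ne']; simp) hL,
    integral_rightHalfDisk hR 2 (fun _ => 1) fun r θ => by
      rw [dist_eq_norm, add_sub_cancel_left, L.norm_map, Complex.norm_polarCoord_symm, sq_abs,
        mul_one]]
  simp
  ring

/-- The source of the constant 4/(3π). The transverse component vanishes by symmetry, and the cosine
integrates to 2 over the half-turn. An arbitrary test vector `e` is kept because the drift is also
needed in the radial direction of the area. -/
theorem integral_halfDisk_inner (hR : 0 ≤ R) (h : p ≠ z) (e : Plane) :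
    ∫ y in halfDisk R p z, inner ℝ (y - p) e =
      2 / 3 * R ^ 3 * (inner ℝ (z - p) e / dist p z) := by
  have hzp : 0 < ‖z - p‖ := norm_pos_iff.2 (sub_ne_zero.2 h.symm)
  obtain ⟨L, hL⟩ := exists_isometry_complex (u := ‖z - p‖⁻¹ • (z - p))
    (by rw [norm_smul, norm_inv, norm_norm]; field_simp)
  rw [setIntegral_halfDisk hzp (by rw [smul_smul, mul_inv_cancel₀ hzp.ne']; simp) hL,
    integral_rightHalfDisk hR 1
      (fun θ => Real.cos θ * (L.symm e).re + Real.sin θ * (L.symm e).im) fun r θ => by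
      have hflip : ∀ w, inner ℝ (L w) e = inner ℝ w (L.symm e) := fun w => by
        rw [← L.inner_map_map w, L.apply_symm_apply]
      rw [add_sub_cancel_left, hflip, Complex.polarCoord_symm_apply, Complex.inner]
      simp only [map_mul, Complex.conj_ofReal, map_add, Complex.conj_I, Complex.mul_re,
        Complex.mul_im, Complex.add_re, Complex.add_im, Complex.ofReal_re, Complex.ofReal_im,
        Complex.neg_re, Complex.neg_im, Complex.I_re, Complex.I_im]
      ring]
  have hre : (L.symm e).re = inner ℝ (z - p) e / dist p z := by
    rw [← inner_isometry_complex hL, L.apply_symm_apply, real_inner_comm, inner_smul_left,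
      dist_comm, dist_eq_norm]
    simp
    ring
  rw [intervalIntegral.integral_add, intervalIntegral.integral_mul_const,
    intervalIntegral.integral_mul_const, integral_cos, integral_sin, hre]
  · simp
    ring
  · exact (Continuous.intervalIntegrable (by fun_prop) _ _)
  · exact (Continuous.intervalIntegrable (by fun_prop) _ _)

/-- The area of a thin strip within a disk. -/
theorem volume_real_strip_le {u : Plane} (hu : ‖u‖ = 1) {ϱ κ : ℝ} (hϱ : 0 ≤ ϱ) (hκ : 0 ≤ κ) :
    volume.real {y : Plane | dist y p ≤ ϱ ∧ |inner ℝ (y - p) u| ≤ κ} ≤ 4 * κ * ϱ := by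
  obtain ⟨L, hL⟩ := exists_isometry_complex hu
  have hmp : MeasurePreserving (fun w : ℂ => p + L w) volume volume :=
    (measurePreserving_add_left volume p).comp L.measurePreserving
  have hme : MeasurableEmbedding fun w : ℂ => p + L w :=
    (MeasurableEquiv.addLeft p).measurableEmbedding.comp L.toMeasurableEquiv.measurableEmbedding
  rw [measureReal_def, ← hmp.measure_preimage_emb hme]
  refine ENNReal.toReal_le_of_le_ofReal (by positivity) ?_
  calc volume ((fun w : ℂ => p + L w) ⁻¹'
        {y : Plane | dist y p ≤ ϱ ∧ |inner ℝ (y - p) u| ≤ κ})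
      ≤ volume (Complex.measurableEquivRealProd ⁻¹' (Set.Icc (-κ) κ ×ˢ Set.Icc (-ϱ) ϱ)) := by
        refine measure_mono fun w hw => ?_
        simp only [Set.mem_preimage, Set.mem_ofPred_eq, dist_eq_norm, add_sub_cancel_left,
          L.norm_map, inner_isometry_complex hL] at hw
        simp only [Set.mem_preimage, Complex.measurableEquivRealProd_apply, Set.mem_prod,
          Set.mem_Icc]
        exact ⟨abs_le.1 hw.2, abs_le.1 ((Complex.abs_im_le_norm w).trans hw.1)⟩
    _ = ENNReal.ofReal (4 * κ * ϱ) := by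
        rw [Complex.volume_preserving_equiv_real_prod.measure_preimage_equiv,
          Measure.volume_eq_prod, Measure.prod_prod, Real.volume_Icc, Real.volume_Icc,
          ← ENNReal.ofReal_mul (by linarith)]
        congr 1
        ring

/-- The area of a thin annulus. -/
theorem volume_real_annulus_le {ϱ κ : ℝ} (hϱ : 0 ≤ ϱ) (hκ : 0 ≤ κ) :
    volume.real {y : Plane | ϱ - κ < dist y p ∧ dist y p ≤ ϱ + κ} ≤
      Real.pi * (4 * κ * ϱ + κ ^ 2) := by
  have hpi := Real.pi_pos
  have hfin : ∀ r, volume (Metric.closedBall p r) ≠ ⊤ := fun r => by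
    rw [EuclideanSpace.volume_closedBall_fin_two]; exact ENNReal.mul_ne_top (by simp) (by simp)
  rcases le_total κ ϱ with h | h
  · have : {y : Plane | ϱ - κ < dist y p ∧ dist y p ≤ ϱ + κ} =
        Metric.closedBall p (ϱ + κ) \ Metric.closedBall p (ϱ - κ) := by
      ext y; simp [and_comm]
    rw [this, measureReal_sdiff (Metric.closedBall_subset_closedBall (by linarith))
      Metric.isClosed_closedBall.measurableSet (hfin _), volume_real_closedBall _ (by linarith),
      volume_real_closedBall _ (by linarith)]
    nlinarith [mul_nonneg hpi.le (sq_nonneg κ)]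
  · calc _ ≤ volume.real (Metric.closedBall p (ϱ + κ)) :=
          measureReal_mono (fun y hy => hy.2) (hfin _)
      _ ≤ _ := by
          rw [volume_real_closedBall _ (by linarith)]
          nlinarith [mul_nonneg hpi.le (mul_nonneg hϱ (sub_nonneg.2 h)), mul_nonneg hpi.le
            (mul_nonneg hϱ hκ)]

end HalfDisk

end Network

namespace Network

/-! ### Grids of squares and Riemann sums over the nodes -/

section Cells

/-- The index of the square of side `a` which contains `y`. -/
noncomputable def cellIdx (a : ℝ) (y : Plane) : ℤ × ℤ := (⌊y 0 / a⌋, ⌊y 1 / a⌋)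

/-- The squares of the grid of side `a`. -/
def cell (a : ℝ) (w : ℤ × ℤ) : Set Plane := {y | cellIdx a y = w}

/-- The number of nodes in a square of the grid. -/
noncomputable def cellCount {n : ℕ} (a : ℝ) (x : Fin n → Plane) (w : ℤ × ℤ) : ℝ :=
  ∑ j, if cellIdx a (x j) = w then 1 else 0

variable {a : ℝ} {w : ℤ × ℤ}

theorem measurable_cellIdx (a : ℝ) : Measurable (cellIdx a) := by
  unfold cellIdx
  exact (Int.measurable_floor.comp (by fun_prop)).prodMk (Int.measurable_floor.comp (by fun_prop))

theorem measurableSet_cell (a : ℝ) (w : ℤ × ℤ) : MeasurableSet (cell a w) :=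
  measurable_cellIdx a (measurableSet_singleton w)

theorem mem_cell_iff (ha : 0 < a) {y : Plane} : y ∈ cell a w ↔
    (w.1 * a ≤ y 0 ∧ y 0 < (w.1 + 1) * a) ∧ (w.2 * a ≤ y 1 ∧ y 1 < (w.2 + 1) * a) := by
  show cellIdx a y = w ↔ _
  rw [cellIdx, Prod.ext_iff, Int.floor_eq_iff, Int.floor_eq_iff, le_div_iff₀ ha, div_lt_iff₀ ha,
    le_div_iff₀ ha, div_lt_iff₀ ha]

theorem volume_real_cell (ha : 0 < a) (w : ℤ × ℤ) : volume.real (cell a w) = a ^ 2 := by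
  have h : cell a w = (fun y : Plane => (WithLp.ofLp y : Fin 2 → ℝ)) ⁻¹'
      (Set.univ.pi fun i : Fin 2 => Set.Ico ((![(w.1 : ℝ), w.2] i) * a)
        ((![(w.1 : ℝ), w.2] i + 1) * a)) := by
    ext y
    rw [mem_cell_iff ha]
    simp [Set.mem_pi, Fin.forall_fin_two]
  rw [measureReal_def, h, (PiLp.volume_preserving_ofLp (Fin 2)).measure_preimage
    (MeasurableSet.univ_pi fun _ => measurableSet_Ico).nullMeasurableSet, Real.volume_pi_Ico]
  have e : ∀ t : ℝ, (t + 1) * a - t * a = a := fun t => by ring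
  simp only [Fin.prod_univ_two, e]
  rw [ENNReal.toReal_mul, ENNReal.toReal_ofReal ha.le, sq]

theorem abs_coord_sub_le (y y' : Plane) (i : Fin 2) : |y i - y' i| ≤ dist y y' := by
  rw [dist_eq_norm]
  exact PiLp.norm_apply_le (y - y') i

theorem dist_le_add_coord (y y' : Plane) : dist y y' ≤ |y 0 - y' 0| + |y 1 - y' 1| := by
  rw [EuclideanSpace.dist_eq, Fin.sum_univ_two, Real.sqrt_le_iff]
  refine ⟨by positivity, ?_⟩
  rw [Real.dist_eq, Real.dist_eq]
  nlinarith [mul_nonneg (abs_nonneg (y 0 - y' 0)) (abs_nonneg (y 1 - y' 1))]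

theorem dist_le_of_mem_cell (ha : 0 < a) {y y' : Plane} (hy : y ∈ cell a w) (hy' : y' ∈ cell a w) :
    dist y y' ≤ 2 * a := by
  rw [mem_cell_iff ha] at hy hy'
  refine (dist_le_add_coord y y').trans ?_
  have h0 : |y 0 - y' 0| ≤ a := by rw [abs_le]; constructor <;> nlinarith [hy.1, hy'.1]
  have h1 : |y 1 - y' 1| ≤ a := by rw [abs_le]; constructor <;> nlinarith [hy.2, hy'.2]
  linarith

theorem finite_cells_near (ha : 0 < a) (p : Plane) (ϱ : ℝ) :
    {w : ℤ × ℤ | ∃ y ∈ cell a w, dist y p ≤ ϱ}.Finite := by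
  refine ((Set.finite_Icc (⌊(p 0 - ϱ) / a⌋) (⌊(p 0 + ϱ) / a⌋)).prod
    (Set.finite_Icc (⌊(p 1 - ϱ) / a⌋) (⌊(p 1 + ϱ) / a⌋))).subset ?_
  rintro w ⟨y, rfl, hy⟩
  have h0 := abs_le.1 ((abs_coord_sub_le y p 0).trans hy)
  have h1 := abs_le.1 ((abs_coord_sub_le y p 1).trans hy)
  refine ⟨⟨Int.floor_le_floor ?_, Int.floor_le_floor ?_⟩,
    ⟨Int.floor_le_floor ?_, Int.floor_le_floor ?_⟩⟩ <;> gcongr <;> linarith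

theorem volume_closedBall_ne_top (p : Plane) (r : ℝ) : volume (Metric.closedBall p r) ≠ ⊤ := by
  rw [EuclideanSpace.volume_closedBall_fin_two]; exact ENNReal.mul_ne_top (by simp) (by simp)

/-- A packing bound: distinct squares are disjoint. -/
theorem sum_area_cells_le (ha : 0 < a) (K : Finset (ℤ × ℤ)) {S : Set Plane}
    (hS : volume S ≠ ⊤) (h : ∀ w ∈ K, cell a w ⊆ S) : ∑ _w ∈ K, a ^ 2 ≤ volume.real S := by
  have hfin : ∀ w ∈ K, volume (cell a w) ≠ ⊤ := fun w hw =>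
    ne_top_of_le_ne_top hS (measure_mono (h w hw))
  rw [← Finset.sum_congr rfl fun w _ => volume_real_cell ha w,
    ← measureReal_biUnion_finset (fun w _ w' _ hne => ?_) (fun w _ => measurableSet_cell a w) hfin]
  · exact measureReal_mono (Set.iUnion₂_subset h) hS
  · rw [Function.onFun, Set.disjoint_left]
    rintro y rfl h'
    exact hne h'

/-- The sum of a function over the nodes is close to its integral if the number of nodes in each of
the squares is close to its mean and the function is nearly constant on most squares. -/
theorem abs_sum_sub_integral_le {n : ℕ} (x : Fin n → Plane) {lam ε ω ϱ : ℝ} {p : Plane}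
    {G : Plane → ℝ} {S : Set Plane} (ha : 0 < a) (hlam : 0 ≤ lam) (hε : 0 ≤ ε) (hε1 : ε ≤ 1)
    (hω : 0 ≤ ω) (hϱ : 0 ≤ ϱ) (hGm : Measurable G) (hG : ∀ y, |G y| ≤ 1)
    (hsupp : ∀ y, ϱ < dist y p → G y = 0)
    (hcnt : ∀ w, (∃ y ∈ cell a w, dist y p ≤ ϱ) →
      |cellCount a x w - lam * a ^ 2| ≤ ε * (lam * a ^ 2))
    (hS : volume S ≠ ⊤)
    (hosc : ∀ w, (∀ y ∈ cell a w, ∀ y' ∈ cell a w, |G y - G y'| ≤ ω) ∨ cell a w ⊆ S) :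
    |∑ j, G (x j) - lam * ∫ y, G y| ≤
      lam * ((ε + 3 * ω) * (Real.pi * (ϱ + 2 * a) ^ 2) + 6 * volume.real S) := by
  classical
  set K := (finite_cells_near ha p ϱ).toFinset with hK
  have hmemK : ∀ w, w ∈ K ↔ ∃ y ∈ cell a w, dist y p ≤ ϱ := fun w => by simp [hK]
  have hsub : ∀ w ∈ K, cell a w ⊆ Metric.closedBall p (ϱ + 2 * a) := by
    intro w hw y' hy'
    obtain ⟨y, hy, hyp⟩ := (hmemK w).1 hw
    rw [Metric.mem_closedBall]
    linarith [dist_triangle y' y p, dist_le_of_mem_cell ha hy' hy]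
  have hdisj : ∀ w w', w ≠ w' → Disjoint (cell a w) (cell a w') := by
    intro w w' hne
    rw [Set.disjoint_left]
    rintro y rfl h'
    exact hne h'
  have hint : Integrable G := by
    have : G = Set.indicator (Metric.closedBall p ϱ) G := by
      funext y
      by_cases hy : y ∈ Metric.closedBall p ϱ
      · rw [Set.indicator_of_mem hy]
      · rw [Set.indicator_of_notMem hy, hsupp y (not_le.1 hy)]
    rw [this, integrable_indicator_iff Metric.isClosed_closedBall.measurableSet]
    exact Measure.integrableOn_of_bounded (volume_closedBall_ne_top p ϱ) hGm.aestronglyMeasurable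
      (M := 1) (ae_of_all _ hG)
  have hsum : ∑ j, G (x j) = ∑ w ∈ K, ∑ j, if cellIdx a (x j) = w then G (x j) else 0 := by
    rw [Finset.sum_comm]
    refine Finset.sum_congr rfl fun j _ => ?_
    rw [Finset.sum_ite_eq]
    split_ifs with h
    · rfl
    · refine hsupp _ (not_le.1 fun hle => h ((hmemK _).2 ⟨x j, rfl, hle⟩))
  have hintK : ∫ y, G y = ∑ w ∈ K, ∫ y in cell a w, G y := by
    rw [← integral_biUnion_finset K (fun w _ => measurableSet_cell a w)
      (fun w _ w' _ hne => hdisj w w' hne) fun w _ => hint.integrableOn]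
    symm
    refine setIntegral_eq_integral_of_forall_compl_eq_zero fun y hy => hsupp y (not_le.1 fun hle => ?_)
    exact hy (Set.mem_iUnion₂.2 ⟨cellIdx a y, (hmemK _).2 ⟨y, rfl, hle⟩, rfl⟩)
  have hla : 0 ≤ lam * a ^ 2 := by positivity
  -- Freeze `G` at one point of the square. This costs `o` per node in the sum (at most twice the
  -- mean count, as ε ≤ 1) and `o` per unit of mean count in the integral, whence 3o; `ε` compares
  -- the count with its mean.
  have hcell : ∀ w ∈ K, ∀ o, 0 ≤ o → (∀ y ∈ cell a w, ∀ y' ∈ cell a w, |G y - G y'| ≤ o) →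
      |(∑ j, if cellIdx a (x j) = w then G (x j) else 0) - lam * ∫ y in cell a w, G y| ≤
        lam * a ^ 2 * (ε + 3 * o) := by
    intro w hw o ho hosc
    obtain ⟨y₀, hy₀, hy₀p⟩ := (hmemK w).1 hw
    have hc := hcnt w ⟨y₀, hy₀, hy₀p⟩
    have hvfin : volume (cell a w) ≠ ⊤ :=
      ne_top_of_le_ne_top (volume_closedBall_ne_top p (ϱ + 2 * a)) (measure_mono (hsub w hw))
    have h1 : |(∑ j, if cellIdx a (x j) = w then G (x j) else 0) - cellCount a x w * G y₀| ≤
        cellCount a x w * o := by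
      unfold cellCount
      rw [Finset.sum_mul, Finset.sum_mul, ← Finset.sum_sub_distrib]
      refine (Finset.abs_sum_le_sum_abs _ _).trans (Finset.sum_le_sum fun j _ => ?_)
      split_ifs with h
      · simpa using hosc _ h y₀ hy₀
      · simp
    have h2 : |cellCount a x w * G y₀ - lam * a ^ 2 * G y₀| ≤ ε * (lam * a ^ 2) := by
      rw [← sub_mul, abs_mul]
      calc _ ≤ |cellCount a x w - lam * a ^ 2| * 1 := by gcongr; exact hG y₀
        _ ≤ _ := by linarith
    have h3 : |lam * a ^ 2 * G y₀ - lam * ∫ y in cell a w, G y| ≤ lam * a ^ 2 * o := by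
      have e : lam * a ^ 2 * G y₀ - lam * ∫ y in cell a w, G y =
          lam * ∫ y in cell a w, (G y₀ - G y) := by
        have hc0 : IntegrableOn (fun _ => G y₀) (cell a w) := integrableOn_const hvfin (by simp)
        rw [integral_sub hc0 hint.integrableOn, setIntegral_const,
          volume_real_cell ha, smul_eq_mul]
        ring
      rw [e, abs_mul, abs_of_nonneg hlam, mul_assoc]
      refine mul_le_mul_of_nonneg_left ?_ hlam
      have := norm_setIntegral_le_of_norm_le_const (lt_top_iff_ne_top.2 hvfin)
        (f := fun y => G y₀ - G y) (C := o) (fun y hy => hosc y₀ hy₀ y hy)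
      rw [volume_real_cell ha, Real.norm_eq_abs] at this
      linarith
    have h4 : cellCount a x w ≤ 2 * (lam * a ^ 2) := by
      have := (abs_le.1 hc).2
      nlinarith
    calc _ ≤ _ := abs_sub_le _ (cellCount a x w * G y₀) _
      _ ≤ cellCount a x w * o + (ε * (lam * a ^ 2) + lam * a ^ 2 * o) :=
        add_le_add h1 ((abs_sub_le _ (lam * a ^ 2 * G y₀) _).trans (add_le_add h2 h3))
      _ ≤ _ := by nlinarith
  set K' := K.filter fun w => cell a w ⊆ S with hK'
  have hdiff : ∀ w ∈ K, |(∑ j, if cellIdx a (x j) = w then G (x j) else 0) -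
      lam * ∫ y in cell a w, G y| ≤
        lam * (ε + 3 * ω) * a ^ 2 + if cell a w ⊆ S then 6 * lam * a ^ 2 else 0 := by
    intro w hw
    rcases hosc w with h | h
    · refine (hcell w hw ω hω h).trans ?_
      have : 0 ≤ 6 * lam * a ^ 2 := by positivity
      split_ifs <;> linarith
    -- On the exceptional squares the trivial oscillation 2 is used, which explains the factor 6 = 3
    -- · 2.
    · refine (hcell w hw 2 zero_le_two fun y _ y' _ => ?_).trans ?_
      · have h1 := abs_le.1 (hG y)
        have h2 := abs_le.1 (hG y')
        rw [abs_le]; constructor <;> linarith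
      · rw [if_pos h]
        have : 0 ≤ lam * a ^ 2 * ω := by positivity
        linarith
  rw [hsum, hintK, Finset.mul_sum, ← Finset.sum_sub_distrib]
  calc _ ≤ _ := Finset.abs_sum_le_sum_abs _ _
    _ ≤ _ := Finset.sum_le_sum hdiff
    _ = lam * (ε + 3 * ω) * ∑ _w ∈ K, a ^ 2 + 6 * lam * ∑ _w ∈ K', a ^ 2 := by
        rw [Finset.sum_add_distrib, ← Finset.sum_filter]
        simp only [Finset.mul_sum, hK']
    _ ≤ lam * (ε + 3 * ω) * (Real.pi * (ϱ + 2 * a) ^ 2) + 6 * lam * volume.real S := by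
        have h1 := sum_area_cells_le ha K (volume_closedBall_ne_top p (ϱ + 2 * a)) hsub
        have h2 := sum_area_cells_le ha K' hS fun w hw => (Finset.mem_filter.1 hw).2
        rw [volume_real_closedBall _ (by positivity)] at h1
        gcongr
    _ = _ := by ring

end Cells

end Network

namespace Network

/-! ### Node sums over disks and half-disks on regular squares -/

section LocalEstimates

/-- The number of nodes in a square of the grid is within a factor `1 ± ε` of its mean. -/
def RegularCell {n : ℕ} (ε lam a : ℝ) (x : Fin n → Plane) (w : ℤ × ℤ) : Prop :=
  |cellCount a x w - lam * a ^ 2| ≤ ε * (lam * a ^ 2)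

variable {n : ℕ} {x : Fin n → Plane} {lam ε a c R : ℝ} {p z : Plane}

/-- The indicator of the disk is constant on every square except those crossing the circle, and
these lie in an annulus of half-width 2a. -/
theorem abs_card_ball_sub_le (ha : 0 < a) (hlam : 0 ≤ lam) (hε : 0 ≤ ε) (hε1 : ε ≤ 1)
    (hR : 0 ≤ R) (hcell : ∀ w, (∃ y ∈ cell a w, dist y p ≤ R) → RegularCell ε lam a x w) :
    |(Finset.card {j | dist (x j) p ≤ R} : ℝ) - lam * (Real.pi * R ^ 2)| ≤
      lam * (ε * (Real.pi * (R + 2 * a) ^ 2) + 6 * (Real.pi * (8 * a * R + 4 * a ^ 2))) := by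
  classical
  set G : Plane → ℝ := Set.indicator (Metric.closedBall p R) 1 with hG
  have hGv : ∀ y, G y = if dist y p ≤ R then 1 else 0 := fun y => by
    simp [hG, Set.indicator]
  have hfin : volume {y : Plane | R - 2 * a < dist y p ∧ dist y p ≤ R + 2 * a} ≠ ⊤ :=
    ne_top_of_le_ne_top (volume_closedBall_ne_top p (R + 2 * a)) (measure_mono fun y hy => hy.2)
  have key := abs_sum_sub_integral_le x (a := a) (lam := lam) (ε := ε) (ω := 0) (ϱ := R) (p := p)
    (G := G) (S := {y : Plane | R - 2 * a < dist y p ∧ dist y p ≤ R + 2 * a}) ha hlam hε hε1 le_rfl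
    hR (measurable_one.indicator Metric.isClosed_closedBall.measurableSet)
    (fun y => by rw [hGv]; split_ifs <;> simp)
    (fun y hy => by rw [hGv, if_neg (not_le.2 hy)]) hcell hfin fun w => by
      by_cases h : ∃ y ∈ cell a w, ∃ y' ∈ cell a w, dist y p ≤ R ∧ R < dist y' p
      · right
        obtain ⟨y, hy, y', hy', h1, h2⟩ := h
        intro y₀ hy₀
        have h3 := dist_triangle y₀ y p
        have h4 := dist_triangle y' y₀ p
        have h5 := dist_le_of_mem_cell ha hy₀ hy
        have h6 := dist_le_of_mem_cell ha hy' hy₀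
        exact ⟨by linarith, by linarith⟩
      · left
        push Not at h
        intro y hy y' hy'
        rw [hGv, hGv]
        have h1 := h y hy y' hy'
        have h2 := h y' hy' y hy
        by_cases h3 : dist y p ≤ R
        · simp [h3, h1 h3]
        · have : ¬ dist y' p ≤ R := fun h4 => h3 (h2 h4)
          simp [h3, this]
  have e1 : ∑ j, G (x j) = (Finset.card {j | dist (x j) p ≤ R} : ℝ) := by
    simp [hGv]
  have e2 : ∫ y, G y = Real.pi * R ^ 2 := by
    rw [hG, integral_indicator_one Metric.isClosed_closedBall.measurableSet,
      volume_real_closedBall p hR]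
  rw [e1, e2] at key
  refine key.trans (mul_le_mul_of_nonneg_left ?_ hlam)
  have := volume_real_annulus_le (p := p) hR (κ := 2 * a) (by positivity)
  linarith

/-- Squares crossing the boundary lie in an annulus around the circle or in a strip around the
diameter, both of half-width 2a. On the others `g` oscillates by at most 4a/R. The Lipschitz
constant 2/R is what the squared distance, divided by R², requires. -/
theorem abs_sum_halfDisk_sub_le (ha : 0 < a) (hlam : 0 ≤ lam) (hε : 0 ≤ ε) (hε1 : ε ≤ 1)
    (hR : 0 < R) (hz : p ≠ z)
    (hcell : ∀ w, (∃ y ∈ cell a w, dist y p ≤ R) → RegularCell ε lam a x w)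
    {g : Plane → ℝ} (hgm : Measurable g) (hg : ∀ y ∈ halfDisk R p z, |g y| ≤ 1)
    (hgl : ∀ y ∈ halfDisk R p z, ∀ y' ∈ halfDisk R p z, |g y - g y'| ≤ 2 * dist y y' / R) :
    |∑ j, Set.indicator (halfDisk R p z) g (x j) - lam * ∫ y in halfDisk R p z, g y| ≤
      lam * ((ε + 12 * a / R) * (Real.pi * (R + 2 * a) ^ 2) +
        6 * (Real.pi * (8 * a * R + 4 * a ^ 2) + 8 * a * (R + 2 * a))) := by
  classical
  have hzp : 0 < ‖z - p‖ := norm_pos_iff.2 (sub_ne_zero.2 hz.symm)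
  set u := ‖z - p‖⁻¹ • (z - p) with hu
  have hu1 : ‖u‖ = 1 := by rw [hu, norm_smul, norm_inv, norm_norm]; field_simp
  have hzu : z - p = ‖z - p‖ • u := by rw [hu, smul_smul, mul_inv_cancel₀ hzp.ne', one_smul]
  have hmem : ∀ y, y ∈ halfDisk R p z ↔ dist y p ≤ R ∧ 0 ≤ inner ℝ (y - p) u := fun y => by
    show (_ ∧ _) ↔ _
    rw [hzu, inner_smul_right, mul_nonneg_iff_of_pos_left hzp]
  set G : Plane → ℝ := Set.indicator (halfDisk R p z) g with hG
  set S₁ := {y : Plane | R - 2 * a < dist y p ∧ dist y p ≤ R + 2 * a}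
  set S₂ := {y : Plane | dist y p ≤ R + 2 * a ∧ |inner ℝ (y - p) u| ≤ 2 * a}
  have hfin : volume (S₁ ∪ S₂) ≠ ⊤ :=
    ne_top_of_le_ne_top (volume_closedBall_ne_top p (R + 2 * a))
      (measure_mono (Set.union_subset (fun y hy => hy.2) fun y hy => hy.1))
  have key := abs_sum_sub_integral_le x (a := a) (lam := lam) (ε := ε) (ω := 4 * a / R) (ϱ := R)
    (p := p) (G := G) (S := S₁ ∪ S₂) ha hlam hε hε1 (by positivity)
    hR.le (hgm.indicator measurableSet_halfDisk)
    (fun y => by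
      by_cases hy : y ∈ halfDisk R p z
      · rw [hG, Set.indicator_of_mem hy]; exact hg y hy
      · rw [hG, Set.indicator_of_notMem hy]; simp)
    (fun y hy => Set.indicator_of_notMem (fun h => not_le.2 hy ((hmem y).1 h).1) g)
    hcell hfin fun w => by
      by_cases h : ∃ y ∈ cell a w, ∃ y' ∈ cell a w, y ∈ halfDisk R p z ∧ y' ∉ halfDisk R p z
      · right
        obtain ⟨y, hy, y', hy', h1, h2⟩ := h
        rw [hmem] at h1 h2
        intro y₀ hy₀
        have h3 := dist_triangle y₀ y p
        have h4 := dist_triangle y' y₀ p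
        have h5 := dist_le_of_mem_cell ha hy₀ hy
        have h6 := dist_le_of_mem_cell ha hy' hy₀
        have hin : ∀ v v' : Plane, inner ℝ (v - p) u ≤ inner ℝ (v' - p) u + dist v v' := by
          intro v v'
          have e : inner ℝ (v - p) u = inner ℝ (v' - p) u + inner ℝ (v - v') u := by
            rw [← inner_add_left]; congr 1; abel
          have := real_inner_le_norm (v - v') u
          rw [hu1, mul_one, ← dist_eq_norm] at this
          linarith
        have h7 : dist y₀ p ≤ R + 2 * a := by linarith [h1.1]
        by_cases h8 : dist y' p ≤ R
        · right
          have h9 : inner ℝ (y' - p) u < 0 := not_le.1 fun h9 => h2 ⟨h8, h9⟩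
          refine ⟨h7, abs_le.2 ⟨?_, ?_⟩⟩
          · have := hin y y₀
            rw [dist_comm] at this
            linarith [h1.2]
          · have := hin y₀ y'
            rw [dist_comm] at this
            linarith
        · left
          exact ⟨by linarith, h7⟩
      · left
        push Not at h
        intro y hy y' hy'
        by_cases h3 : y ∈ halfDisk R p z
        · have h4 := h y hy y' hy' h3
          rw [hG, Set.indicator_of_mem h3, Set.indicator_of_mem h4]
          refine (hgl y h3 y' h4).trans ?_
          rw [div_le_div_iff_of_pos_right hR]
          linarith [dist_le_of_mem_cell ha hy hy']
        · have h4 : y' ∉ halfDisk R p z := fun h4 => h3 (h y' hy' y hy h4)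
          rw [hG, Set.indicator_of_notMem h3, Set.indicator_of_notMem h4]
          simp only [sub_self, abs_zero]
          positivity
  rw [hG, integral_indicator measurableSet_halfDisk] at key
  refine key.trans (mul_le_mul_of_nonneg_left ?_ hlam)
  have h1 := volume_real_annulus_le (p := p) hR.le (κ := 2 * a) (by positivity)
  have h2 := volume_real_strip_le (p := p) hu1 (ϱ := R + 2 * a) (κ := 2 * a) (by positivity)
    (by positivity)
  have h3 := measureReal_union_le (μ := (volume : Measure Plane)) S₁ S₂
  have h4 : 3 * (4 * a / R) = 12 * a / R := by ring
  rw [h4]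
  have h5 : volume.real (S₁ ∪ S₂) ≤ Real.pi * (8 * a * R + 4 * a ^ 2) + 8 * a * (R + 2 * a) := by
    refine h3.trans ((add_le_add h1 h2).trans (le_of_eq ?_))
    ring
  linarith

/-- On a sufficiently fine grid of regular squares, the number of nodes in a disk and the sums over
the nodes in a half-disk are close to their means. -/
theorem exists_grid (hc : 1 ≤ c) {δ : ℝ} (hδ : 0 < δ) :
    ∃ ε : ℝ, 0 < ε ∧ ε ≤ 1 ∧ ∃ M : ℕ, 1 ≤ M ∧ ∀ (n : ℕ) (x : Fin n → Plane) (R lam : ℝ) (p : Plane),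
      0 < R → 0 ≤ lam →
      (∀ w, (∃ y ∈ cell (R / M) w, dist y p ≤ c * R) → RegularCell ε lam (R / M) x w) →
      |(Finset.card {j | dist (x j) p ≤ c * R} : ℝ) - lam * (Real.pi * (c * R) ^ 2)| ≤
        δ * (lam * R ^ 2) ∧
      ∀ z, p ≠ z → ∀ g : Plane → ℝ, Measurable g → (∀ y ∈ halfDisk R p z, |g y| ≤ 1) →
        (∀ y ∈ halfDisk R p z, ∀ y' ∈ halfDisk R p z, |g y - g y'| ≤ 2 * dist y y' / R) →
        |∑ j, Set.indicator (halfDisk R p z) g (x j) - lam * ∫ y in halfDisk R p z, g y| ≤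
          δ * (lam * R ^ 2) := by
  -- Large enough that both relative errors are at most C(ε + 1/M); `ε` and `M` then each use up
  -- half of `δ`.
  set C := 1000 * (c + 2) ^ 2 with hC
  have hC0 : 0 < C := by positivity
  obtain ⟨M, hM⟩ := exists_nat_gt (2 * C / δ + 1)
  have hM1 : (1 : ℝ) ≤ M := by
    have : 0 ≤ 2 * C / δ := by positivity
    linarith
  have hM0 : (0 : ℝ) < M := by linarith
  set ε := min 1 (δ / (2 * C)) with hε
  have hε0 : 0 < ε := lt_min one_pos (by positivity)
  have hε1 : ε ≤ 1 := min_le_left _ _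
  have hsmall : C * (ε + 1 / M) ≤ δ := by
    have h1 : C * ε ≤ δ / 2 := by
      calc C * ε ≤ C * (δ / (2 * C)) := by gcongr; exact min_le_right _ _
        _ = δ / 2 := by field_simp
    have h2 : C * (1 / M) ≤ δ / 2 := by
      have h3 : 2 * C / δ ≤ M := by linarith
      rw [div_le_iff₀ hδ] at h3
      rw [mul_one_div, div_le_iff₀ hM0]
      linarith
    linarith
  refine ⟨ε, hε0, hε1, M, by exact_mod_cast hM1, fun n x R lam p hR hlam hcell => ?_⟩
  set t : ℝ := 1 / M with ht
  have ht0 : 0 < t := by positivity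
  have ht1 : t ≤ 1 := by rw [ht, div_le_one hM0]; exact hM1
  have hat : R / M = t * R := by rw [ht]; ring
  rw [hat] at hcell
  have ha : 0 < t * R := by positivity
  have hpi := Real.pi_pos
  have hpi4 := Real.pi_le_four
  have ht2 : t ^ 2 ≤ t := by nlinarith
  constructor
  · refine (abs_card_ball_sub_le ha hlam hε0.le hε1 (by positivity) hcell).trans ?_
    calc _ = lam * R ^ 2 * (Real.pi * (ε * (c + 2 * t) ^ 2 + 6 * (8 * t * c + 4 * t ^ 2))) := by ring
      _ ≤ lam * R ^ 2 * (C * (ε + t)) := by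
          refine mul_le_mul_of_nonneg_left ?_ (by positivity)
          calc _ ≤ 4 * (ε * (c + 2 * 1) ^ 2 + 6 * (8 * t * c + 4 * t)) := by gcongr
            _ ≤ C * (ε + t) := by
              rw [hC]
              nlinarith [mul_pos ht0 (by linarith : 0 < c), mul_nonneg hε0.le (sq_nonneg (c + 2)),
                mul_nonneg ht0.le (sq_nonneg c)]
      _ ≤ lam * R ^ 2 * δ := by gcongr
      _ = _ := by ring
  · intro z hz g hgm hg hgl
    refine (abs_sum_halfDisk_sub_le ha hlam hε0.le hε1 hR hz (fun w hw => hcell w ?_) hgm hg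
      hgl).trans ?_
    · obtain ⟨y, hy, hyp⟩ := hw
      exact ⟨y, hy, hyp.trans (by nlinarith)⟩
    calc _ = lam * R ^ 2 * (Real.pi * ((ε + 12 * t) * (1 + 2 * t) ^ 2 + 6 * (8 * t + 4 * t ^ 2)) +
          6 * (8 * t * (1 + 2 * t))) := by field_simp; ring
      _ ≤ lam * R ^ 2 * (C * (ε + t)) := by
          refine mul_le_mul_of_nonneg_left ?_ (by positivity)
          calc _ ≤ 4 * ((ε + 12 * t) * (1 + 2 * 1) ^ 2 + 6 * (8 * t + 4 * t)) +
                6 * (8 * t * (1 + 2 * 1)) := by gcongr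
            _ ≤ C * (ε + t) := by
              have : 9000 ≤ C := by rw [hC]; nlinarith
              nlinarith [mul_pos ht0 hC0, mul_pos hε0 hC0]
      _ ≤ lam * R ^ 2 * δ := by gcongr
      _ = _ := by ring

end LocalEstimates

end Network

namespace Network

/-! ### Large deviations of the square counts and sparsity of irregular squares -/

section Deviations

variable {ρ lam ε a : ℝ}

theorem measurable_cellCount {n : ℕ} (a : ℝ) (w : ℤ × ℤ) :
    Measurable fun x : Fin n → Plane => cellCount a x w := by
  unfold cellCount
  exact Finset.measurable_sum _ fun j _ => Measurable.ite
    ((measurable_cellIdx a).comp (measurable_pi_apply j) (measurableSet_singleton w))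
    measurable_const measurable_const

theorem measurable_regularCell {n : ℕ} (ε lam a : ℝ) (w : ℤ × ℤ) :
    Measurable fun x : Fin n → Plane => RegularCell ε lam a x w :=
  measurableSet_setOfPred.1 (measurableSet_le (((measurable_cellCount a w).sub_const _).abs)
    measurable_const)

theorem sum_apply_cellIdx {n : ℕ} (S : Finset (ℤ × ℤ)) (θ : ℤ × ℤ → ℝ) (x : Fin n → Plane) :
    ∑ j, (if cellIdx a (x j) ∈ S then θ (cellIdx a (x j)) else 0) =
      ∑ w ∈ S, θ w * cellCount a x w := by
  simp only [cellCount, Finset.mul_sum]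
  rw [Finset.sum_comm]
  refine Finset.sum_congr rfl fun j _ => ?_
  simp only [mul_ite, mul_one, mul_zero, Finset.sum_ite_eq]

theorem exp_sum_cellCount {n : ℕ} (S : Finset (ℤ × ℤ)) (θ : ℤ × ℤ → ℝ) (x : Fin n → Plane) :
    Real.exp (∑ w ∈ S, θ w * cellCount a x w) =
      ∏ j, Real.exp (if cellIdx a (x j) ∈ S then θ (cellIdx a (x j)) else 0) := by
  rw [← sum_apply_cellIdx, Real.exp_sum]

theorem measurable_exp_cellIdx (S : Finset (ℤ × ℤ)) (θ : ℤ × ℤ → ℝ) :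
    Measurable fun y : Plane => Real.exp (if cellIdx a y ∈ S then θ (cellIdx a y) else 0) :=
  (Measurable.of_discrete (f := fun w => Real.exp (if w ∈ S then θ w else 0))).comp
    (measurable_cellIdx a)

theorem abs_exp_cellIdx_le (S : Finset (ℤ × ℤ)) (θ : ℤ × ℤ → ℝ) (y : Plane) :
    |Real.exp (if cellIdx a y ∈ S then θ (cellIdx a y) else 0)| ≤
      Real.exp (∑ w ∈ S, |θ w|) := by
  rw [abs_of_pos (Real.exp_pos _), Real.exp_le_exp]
  split_ifs with h
  · exact (le_abs_self _).trans
      (Finset.single_le_sum (f := fun w => |θ w|) (fun w _ => abs_nonneg _) h)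
  · exact Finset.sum_nonneg fun _ _ => abs_nonneg _

theorem admissible_exp_cellCount (S : Finset (ℤ × ℤ)) (θ : ℤ × ℤ → ℝ) :
    Admissible fun _ x => Real.exp (∑ w ∈ S, θ w * cellCount a x w) := by
  simp only [exp_sum_cellCount]
  exact admissible_prod (measurable_exp_cellIdx S θ) (abs_exp_cellIdx_le S θ)

/-- The joint Laplace transform of the numbers of nodes in finitely many squares. -/
theorem networkExpect_exp_cellCount (hρ : 0 < ρ) (hlam : 0 ≤ lam) (ha : 0 < a)
    (S : Finset (ℤ × ℤ)) (hS : ∀ w ∈ S, cell a w ⊆ area ρ) (θ : ℤ × ℤ → ℝ) :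
    networkExpect ρ lam (fun _ x => Real.exp (∑ w ∈ S, θ w * cellCount a x w)) =
      Real.exp (∑ w ∈ S, lam * a ^ 2 * (Real.exp (θ w) - 1)) := by
  simp only [exp_sum_cellCount]
  set h : Plane → ℝ := fun y => Real.exp (if cellIdx a y ∈ S then θ (cellIdx a y) else 0) with hh
  rw [networkExpect_prod hρ hlam h]
  congr 1
  have hA : volume (area ρ) ≠ ⊤ := volume_closedBall_ne_top 0 ρ
  have hi : IntegrableOn h (area ρ) :=
    Measure.integrableOn_of_bounded hA (measurable_exp_cellIdx S θ).aestronglyMeasurable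
      (ae_of_all _ fun y => abs_exp_cellIdx_le S θ y)
  have h1 : IntegrableOn (fun _ : Plane => (1 : ℝ)) (area ρ) := integrableOn_const hA (by simp)
  have h2 : IntegrableOn (fun y => h y - 1) (area ρ) := hi.sub h1
  -- Subtracting 1 localises the integral: h - 1 vanishes off the squares of `S` and is constant on
  -- each of them.
  have e1 : lam * ∫ y in area ρ, h y = lam * (∫ y in area ρ, (h y - 1)) +
      lam * volume.real (area ρ) := by
    rw [integral_sub hi h1, setIntegral_const, smul_eq_mul]
    ring
  have e2 : ∫ y in area ρ, (h y - 1) = ∫ y in ⋃ w ∈ S, cell a w, (h y - 1) := by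
    refine setIntegral_eq_of_subset_of_forall_sdiff_eq_zero (measurableSet_area ρ)
      (Set.iUnion₂_subset hS) fun y hy => ?_
    have : cellIdx a y ∉ S := fun hm => hy.2 (Set.mem_iUnion₂.2 ⟨cellIdx a y, hm, rfl⟩)
    simp [hh, this]
  rw [e1, e2, add_sub_cancel_right, integral_biUnion_finset S (fun w _ => measurableSet_cell a w)
    (fun w _ w' _ hne => ?_) fun w hw => h2.mono_set (hS w hw), Finset.mul_sum]
  · refine Finset.sum_congr rfl fun w hw => ?_
    rw [setIntegral_congr_fun (g := fun _ => Real.exp (θ w) - 1) (measurableSet_cell a w)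
      fun y hy => ?_, setIntegral_const, volume_real_cell ha, smul_eq_mul]
    · ring
    · have hy' : cellIdx a y = w := hy
      simp only [hh, hy', hw, if_true]
  · rw [Function.onFun, Set.disjoint_left]
    rintro y rfl h'
    exact hne h'

open scoped Classical in
/-- Chernoff bound: it is unlikely that all squares of a given finite set are irregular. -/
theorem networkExpect_irregular_le (hρ : 0 < ρ) (hlam : 0 ≤ lam) (ha : 0 < a) (hε : 0 ≤ ε)
    (hε1 : ε ≤ 1) (S : Finset (ℤ × ℤ)) (hS : ∀ w ∈ S, cell a w ⊆ area ρ) :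
    networkExpect ρ lam (fun _ x => if ∀ w ∈ S, ¬ RegularCell ε lam a x w then 1 else 0) ≤
      (2 * Real.exp (-(ε ^ 2 * (lam * a ^ 2) / 4))) ^ S.card := by
  set v := lam * a ^ 2 with hv
  have hv0 : 0 ≤ v := by positivity
  -- The minimiser of t² - tε, the exponent per unit of mean count after e^θ - 1 - θ ≤ θ². It gives
  -- -ε²/4.
  set t := ε / 2 with ht
  let θ : Finset (ℤ × ℤ) → ℤ × ℤ → ℝ := fun T w => if w ∈ T then t else -t
  let c : Finset (ℤ × ℤ) → ℝ := fun T => Real.exp (∑ w ∈ S, (-(θ T w) * v - t * ε * v))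
  have hm : ∀ n, Measurable fun x : Fin n → Plane =>
      if ∀ w ∈ S, ¬ RegularCell ε lam a x w then (1 : ℝ) else 0 := fun n => by
    refine Measurable.ite (measurableSet_setOfPred.2 ?_) measurable_const measurable_const
    exact Measurable.forall fun w => Measurable.imp measurable_const
      (measurable_regularCell ε lam a w).not
  have hadm : ∀ T ∈ S.powerset, Admissible fun _ x =>
      c T * Real.exp (∑ w ∈ S, θ T w * cellCount a x w) := fun T _ =>
    (admissible_exp_cellCount S (θ T)).const_mul (c T)
  calc _ ≤ networkExpect ρ lam (fun _ x => ∑ T ∈ S.powerset,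
          c T * Real.exp (∑ w ∈ S, θ T w * cellCount a x w)) := by
        refine networkExpect_mono hρ (Admissible.of_abs_le_const (B := 1) hm zero_le_one
          fun n x => by split_ifs <;> simp) (Admissible.sum _ hadm) fun n x => ?_
        -- The set `T` lists the squares with an upward deviation. Summed over `T`, these products
        -- recombine to a product over `S` of an upper plus a lower exponential, and each factor is
        -- at least 1 at an irregular square.
        have e1 : ∀ T ∈ S.powerset, c T * Real.exp (∑ w ∈ S, θ T w * cellCount a x w) =
            (∏ w ∈ T, Real.exp (t * (cellCount a x w - v) - t * ε * v)) *
              ∏ w ∈ S \ T, Real.exp (-(t * (cellCount a x w - v)) - t * ε * v) := by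
          intro T hT
          rw [← Real.exp_add, ← Finset.sum_add_distrib, Real.exp_sum,
            ← Finset.prod_sdiff (Finset.mem_powerset.1 hT), mul_comm]
          congr 1
          · refine Finset.prod_congr rfl fun w hw => ?_
            simp only [θ, hw, if_true]
            congr 1; ring
          · refine Finset.prod_congr rfl fun w hw => ?_
            simp only [θ, (Finset.mem_sdiff.1 hw).2, if_false]
            congr 1; ring
        rw [Finset.sum_congr rfl e1, ← Finset.prod_add]
        split_ifs with h
        · rw [← Finset.prod_const_one (s := S)]
          refine Finset.prod_le_prod (fun _ _ => zero_le_one) fun w hw => ?_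
          have h1 := h w hw
          rw [RegularCell, not_le] at h1
          have ht0 : 0 ≤ t := by positivity
          rcases le_total 0 (cellCount a x w - v) with h2 | h2
          · rw [abs_of_nonneg h2] at h1
            have : 0 ≤ t * (cellCount a x w - v) - t * ε * v := by nlinarith
            linarith [Real.one_le_exp this, Real.exp_pos (-(t * (cellCount a x w - v)) - t * ε * v)]
          · rw [abs_of_nonpos h2] at h1
            have : 0 ≤ -(t * (cellCount a x w - v)) - t * ε * v := by nlinarith
            linarith [Real.one_le_exp this, Real.exp_pos (t * (cellCount a x w - v) - t * ε * v)]
        · exact Finset.prod_nonneg fun w _ => by positivity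
    _ = ∑ T ∈ S.powerset, c T * Real.exp (∑ w ∈ S, v * (Real.exp (θ T w) - 1)) := by
        rw [networkExpect_sum hρ _ hadm]
        refine Finset.sum_congr rfl fun T _ => ?_
        rw [networkExpect_const_mul, networkExpect_exp_cellCount hρ hlam ha S hS]
    _ ≤ ∑ _T ∈ S.powerset, Real.exp (-(ε ^ 2 * v / 4)) ^ S.card := by
        refine Finset.sum_le_sum fun T _ => ?_
        rw [← Real.exp_add, ← Finset.sum_add_distrib, ← Real.exp_nat_mul, Real.exp_le_exp,
          ← nsmul_eq_mul]
        refine Finset.sum_le_card_nsmul _ _ _ fun w _ => ?_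
        have hθ : |θ T w| ≤ 1 ∧ (θ T w) ^ 2 = t ^ 2 := by
          have : |t| ≤ 1 := by rw [ht, abs_le]; constructor <;> linarith
          simp only [θ]
          split_ifs <;> simp [this]
        have h1 := (abs_le.1 (Real.abs_exp_sub_one_sub_id_le hθ.1)).2
        rw [hθ.2] at h1
        have h2 : v * (Real.exp (θ T w) - 1 - θ T w) ≤ v * t ^ 2 := mul_le_mul_of_nonneg_left h1 hv0
        have h3 : v * t ^ 2 - t * ε * v = -(ε ^ 2 * v / 4) := by rw [ht]; ring
        linarith
    _ = _ := by
        rw [Finset.sum_const, Finset.card_powerset, nsmul_eq_mul, mul_pow]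
        push_cast
        ring

/-- The squares whose index differs by at most `V` from `w`. -/
noncomputable def neighbours (V : ℕ) (w : ℤ × ℤ) : Finset (ℤ × ℤ) :=
  Finset.Icc (w.1 - V) (w.1 + V) ×ˢ Finset.Icc (w.2 - V) (w.2 + V)

theorem card_neighbours (V : ℕ) (w : ℤ × ℤ) : (neighbours V w).card = (2 * V + 1) ^ 2 := by
  rw [neighbours, Finset.card_product, Int.card_Icc, Int.card_Icc, sq]
  congr 1 <;> omega

/-- There are fewer than `k` irregular squares in any neighbourhood of an irregular square. -/
def Sparse {n : ℕ} (ρ lam a ε : ℝ) (k V : ℕ) (x : Fin n → Plane) : Prop :=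
  ∀ w, ∀ S ⊆ neighbours V w, w ∈ S →
    (∀ w' ∈ S, cell a w' ⊆ area ρ ∧ ¬ RegularCell ε lam a x w') → S.card < k

theorem measurableSet_not_sparse {n : ℕ} (ρ lam a ε : ℝ) (k V : ℕ) :
    MeasurableSet {x : Fin n → Plane | ¬ Sparse ρ lam a ε k V x} := by
  refine measurableSet_setOfPred.2 (Measurable.not ?_)
  unfold Sparse
  refine Measurable.forall fun w => Measurable.forall fun S => Measurable.imp measurable_const
    (Measurable.imp measurable_const (Measurable.imp ?_ measurable_const))
  exact Measurable.forall fun w' => Measurable.imp measurable_const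
    (Measurable.and measurable_const (measurable_regularCell ε lam a w').not)

/-- A corner of the square belongs to it, hence to the area, which bounds both indices by ρ/a. This
makes the union bound over squares finite. -/
theorem mem_box_of_cell_subset (ha : 0 < a) {w : ℤ × ℤ} (h : cell a w ⊆ area ρ) :
    w ∈ neighbours ⌈ρ / a⌉₊ 0 := by
  have hmem : (!₂[(w.1 : ℝ) * a, (w.2 : ℝ) * a] : Plane) ∈ cell a w := by
    rw [mem_cell_iff ha]
    constructor <;> constructor <;> simp <;> nlinarith
  have hA := h hmem
  rw [area, Metric.mem_closedBall] at hA
  have h0 := (abs_coord_sub_le _ _ 0).trans hA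
  have h1 := (abs_coord_sub_le _ _ 1).trans hA
  have key : ∀ z : ℤ, |(z : ℝ) * a| ≤ ρ → z ∈ Finset.Icc (0 - (⌈ρ / a⌉₊ : ℤ)) (0 + ⌈ρ / a⌉₊) := by
    intro z hz
    rw [abs_mul, abs_of_pos ha, ← le_div_iff₀ ha] at hz
    have h2 := abs_le.1 (hz.trans (Nat.le_ceil (ρ / a)))
    rw [Finset.mem_Icc]
    constructor
    · have : ((0 - (⌈ρ / a⌉₊ : ℤ) : ℤ) : ℝ) ≤ z := by push_cast; linarith [h2.1]
      exact_mod_cast this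
    · have : (z : ℝ) ≤ ((0 + (⌈ρ / a⌉₊ : ℤ) : ℤ) : ℝ) := by push_cast; linarith [h2.2]
      exact_mod_cast this
  exact Finset.mem_product.2 ⟨key _ (by simpa using h0), key _ (by simpa using h1)⟩

-- A union bound over the centre of a window and over the k-element sets of squares inside the
-- window, each of which is entirely irregular with the probability estimated in
-- `networkExpect_irregular_le`.
open scoped Classical in
theorem networkExpect_not_sparse_le (hρ : 0 < ρ) (hlam : 0 ≤ lam) (ha : 0 < a) (hε : 0 ≤ ε)
    (hε1 : ε ≤ 1) (k V : ℕ) :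
    networkExpect ρ lam (fun _ x => if ¬ Sparse ρ lam a ε k V x then 1 else 0) ≤
      (2 * ρ / a + 3) ^ 2 * (2 ^ ((2 * V + 1) ^ 2) *
        (2 * Real.exp (-(ε ^ 2 * (lam * a ^ 2) / 4))) ^ k) := by
  set b := ⌈ρ / a⌉₊ with hb
  let fam : ℤ × ℤ → Finset (Finset (ℤ × ℤ)) := fun w =>
    ((neighbours V w).powerset.filter fun S => S.card = k ∧ ∀ w' ∈ S, cell a w' ⊆ area ρ)
  have hadm : ∀ S : Finset (ℤ × ℤ), Admissible fun _ x =>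
      if ∀ w ∈ S, ¬ RegularCell ε lam a x w then (1 : ℝ) else 0 := fun S => by
    refine Admissible.of_abs_le_const (B := 1) (fun n => Measurable.ite (measurableSet_setOfPred.2 ?_)
      measurable_const measurable_const) zero_le_one fun n x => by split_ifs <;> simp
    exact Measurable.forall fun w => Measurable.imp measurable_const
      (measurable_regularCell ε lam a w).not
  calc _ ≤ networkExpect ρ lam (fun _ x => ∑ w ∈ neighbours b 0, ∑ S ∈ fam w,
          if ∀ w ∈ S, ¬ RegularCell ε lam a x w then (1 : ℝ) else 0) := by
        refine networkExpect_mono hρ (Admissible.of_abs_le_const (B := 1)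
          (fun n => Measurable.ite (measurableSet_not_sparse ρ lam a ε k V) measurable_const
          measurable_const) zero_le_one fun n x => by split_ifs <;> simp)
          (Admissible.sum _ fun w _ => Admissible.sum _ fun S _ => hadm S) fun n x => ?_
        have hnn : ∀ w ∈ neighbours b 0, 0 ≤ ∑ S ∈ fam w,
            if ∀ w ∈ S, ¬ RegularCell ε lam a x w then (1 : ℝ) else 0 := fun w _ =>
          Finset.sum_nonneg fun S _ => by split_ifs <;> simp
        by_cases h : Sparse ρ lam a ε k V x
        · rw [if_neg (not_not.2 h)]
          exact Finset.sum_nonneg hnn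
        · rw [if_pos h]
          unfold Sparse at h
          push Not at h
          obtain ⟨w, S, hSV, hwS, hS, hk⟩ := h
          -- A larger irregular set may be cut down to exactly `k` squares. The centre `w` need not
          -- survive, as only the window is used afterwards.
          obtain ⟨S', hS'S, hS'k⟩ := Finset.exists_subset_card_eq hk
          refine le_trans ?_ (Finset.single_le_sum hnn (mem_box_of_cell_subset ha (hS w hwS).1))
          have hmem : S' ∈ fam w := by
            simp only [fam, Finset.mem_filter, Finset.mem_powerset]
            exact ⟨hS'S.trans hSV, hS'k, fun w' hw' => (hS w' (hS'S hw')).1⟩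
          refine le_trans ?_ (Finset.single_le_sum (f := fun S : Finset (ℤ × ℤ) =>
            if ∀ w ∈ S, ¬ RegularCell ε lam a x w then (1 : ℝ) else 0)
            (fun S _ => by split_ifs <;> simp) hmem)
          rw [if_pos fun w' hw' => (hS w' (hS'S hw')).2]
    _ = ∑ w ∈ neighbours b 0, ∑ S ∈ fam w, networkExpect ρ lam
          (fun _ x => if ∀ w ∈ S, ¬ RegularCell ε lam a x w then (1 : ℝ) else 0) := by
        rw [networkExpect_sum hρ _ fun w _ => Admissible.sum _ fun S _ => hadm S]
        exact Finset.sum_congr rfl fun w _ => networkExpect_sum hρ _ fun S _ => hadm S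
    _ ≤ ∑ w ∈ neighbours b 0, ∑ S ∈ fam w,
          (2 * Real.exp (-(ε ^ 2 * (lam * a ^ 2) / 4))) ^ k := by
        refine Finset.sum_le_sum fun w _ => Finset.sum_le_sum fun S hS => ?_
        simp only [fam, Finset.mem_filter, Finset.mem_powerset] at hS
        rw [← hS.2.1]
        exact networkExpect_irregular_le hρ hlam ha hε hε1 S hS.2.2
    _ ≤ ∑ w ∈ neighbours b 0, 2 ^ ((2 * V + 1) ^ 2) *
          (2 * Real.exp (-(ε ^ 2 * (lam * a ^ 2) / 4))) ^ k := by
        refine Finset.sum_le_sum fun w _ => ?_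
        rw [Finset.sum_const, nsmul_eq_mul]
        gcongr
        have h1 : (fam w).card ≤ 2 ^ ((2 * V + 1) ^ 2) := by
          refine (Finset.card_filter_le _ _).trans ?_
          rw [Finset.card_powerset, card_neighbours]
        exact_mod_cast h1
    _ ≤ _ := by
        rw [Finset.sum_const, nsmul_eq_mul, card_neighbours]
        push_cast
        have h1 : (b : ℝ) ≤ ρ / a + 1 := (Nat.ceil_lt_add_one (by positivity)).le
        have h2 : 2 * (b : ℝ) + 1 ≤ 2 * ρ / a + 3 := by
          have : 2 * ρ / a = 2 * (ρ / a) := by ring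
          linarith
        refine mul_le_mul_of_nonneg_right (pow_le_pow_left₀ (by positivity) h2 2) (by positivity)

open scoped Classical in
/-- With high probability, irregular squares are sparse. -/
theorem tendsto_not_sparse (hρ : 0 < ρ) (hε : 0 ≤ ε) (hε1 : ε ≤ 1) {K₀ : ℝ} (hK₀ : 0 < K₀)
    {R : ℝ → ℝ} (hR : ∀ᶠ lam in atTop, K₀ * √(Real.log lam / lam) ≤ R lam) {M : ℕ} (hM : 1 ≤ M)
    {k : ℕ} (hk : 8 * (M : ℝ) ^ 2 ≤ k * ε ^ 2 * K₀ ^ 2) (V : ℕ) :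
    Tendsto (fun lam => networkExpect ρ lam
      (fun _ x => if ¬ Sparse ρ lam (R lam / M) ε k V x then 1 else 0)) atTop (𝓝 0) := by
  have hM0 : (0 : ℝ) < M := by exact_mod_cast hM
  set C := (2 * ρ * M + 3) ^ 2 * (2 ^ ((2 * V + 1) ^ 2) * 2 ^ k) with hC
  have hlim : Tendsto (fun lam : ℝ => C * lam⁻¹) atTop (𝓝 0) := by
    simpa using tendsto_inv_atTop_zero.const_mul C
  refine squeeze_zero' ?_ ?_ hlim
  · exact Eventually.of_forall fun lam => integral_nonneg fun n => integral_nonneg fun x => by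
      dsimp only; split_ifs <;> simp
  filter_upwards [hR, eventually_ge_atTop (Real.exp 1), eventually_ge_atTop (Real.exp (1 / K₀ ^ 2))]
    with lam hRl hlam hlamK
  have hlam1 : 1 ≤ lam := le_trans (by simp) hlam
  have hlam0 : 0 < lam := by linarith
  have hlog : 1 ≤ Real.log lam := by rwa [Real.le_log_iff_exp_le hlam0]
  have hlogK : 1 / K₀ ^ 2 ≤ Real.log lam := by rwa [Real.le_log_iff_exp_le hlam0]
  have hs : 0 < √(Real.log lam / lam) := Real.sqrt_pos.2 (by positivity)
  have hR0 : 0 < R lam := lt_of_lt_of_le (by positivity) hRl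
  have hR2 : K₀ ^ 2 * Real.log lam ≤ lam * R lam ^ 2 := by
    have : (K₀ * √(Real.log lam / lam)) ^ 2 ≤ R lam ^ 2 := by gcongr
    rw [mul_pow, Real.sq_sqrt (by positivity)] at this
    calc K₀ ^ 2 * Real.log lam = lam * (K₀ ^ 2 * (Real.log lam / lam)) := by field_simp
      _ ≤ _ := by gcongr
  have ha : 0 < R lam / M := by positivity
  refine (networkExpect_not_sparse_le hρ hlam0.le ha hε hε1 k V).trans ?_
  -- There are only O(λ) windows, since λR² is eventually at least 1.
  have h1 : (2 * ρ / (R lam / M) + 3) ^ 2 ≤ (2 * ρ * M + 3) ^ 2 * lam := by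
    have h2 : 1 ≤ lam * R lam ^ 2 := by
      refine le_trans ?_ hR2
      rwa [div_le_iff₀ (by positivity), mul_comm] at hlogK
    have h3 : 1 / R lam ≤ √lam := by
      rw [div_le_iff₀ hR0, ← Real.sqrt_sq hR0.le, ← Real.sqrt_mul hlam0.le]
      rwa [Real.one_le_sqrt]
    have h4 : 1 ≤ √lam := by rwa [Real.one_le_sqrt]
    calc (2 * ρ / (R lam / M) + 3) ^ 2 = (2 * ρ * M * (1 / R lam) + 3) ^ 2 := by
          congr 1; field_simp
      _ ≤ (2 * ρ * M * √lam + 3 * √lam) ^ 2 := by gcongr; linarith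
      _ = (2 * ρ * M + 3) ^ 2 * √lam ^ 2 := by ring
      _ = _ := by rw [Real.sq_sqrt hlam0.le]
  -- By λR² ≥ K₀² log λ the exponent is at least kε²K₀²/(4M²) times log λ, and `hk` makes this
  -- factor at least 2. One power of λ is left after the union bound.
  have h5 : Real.exp (-(ε ^ 2 * (lam * (R lam / M) ^ 2) / 4)) ^ k ≤ lam⁻¹ ^ 2 := by
    rw [← Real.exp_nat_mul]
    have : lam⁻¹ ^ 2 = Real.exp (-(2 * Real.log lam)) := by
      rw [neg_mul_eq_mul_neg, mul_comm, Real.exp_mul, Real.exp_neg, Real.exp_log hlam0]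
      norm_num
    rw [this, Real.exp_le_exp]
    have h6 : (k : ℝ) * ε ^ 2 * (K₀ ^ 2 * Real.log lam) ≤ k * ε ^ 2 * (lam * R lam ^ 2) := by gcongr
    have h7 : 8 * (M : ℝ) ^ 2 * Real.log lam ≤ k * ε ^ 2 * K₀ ^ 2 * Real.log lam := by gcongr
    have h8 : (k : ℝ) * -(ε ^ 2 * (lam * (R lam / M) ^ 2) / 4) =
        -((k * ε ^ 2 * (lam * R lam ^ 2)) / (4 * M ^ 2)) := by field_simp
    rw [h8, neg_le_neg_iff, le_div_iff₀ (by positivity)]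
    linarith
  calc _ ≤ ((2 * ρ * M + 3) ^ 2 * lam) * (2 ^ ((2 * V + 1) ^ 2) * (2 ^ k * lam⁻¹ ^ 2)) := by
        rw [mul_pow]; gcongr
    _ = C * lam⁻¹ := by rw [hC]; field_simp

end Deviations

end Network

namespace Network

/-! ### Mean displacement and mean progress of one hop -/

section Drift

variable {n : ℕ} {x : Fin n → Plane} {lam R δ : ℝ} {d i : Fin n}

/-- The component of `y - p` in the direction from `p` to `z`. -/
noncomputable def forward (p z y : Plane) : ℝ := inner ℝ (z - p) (y - p) / dist p z

/-- Cauchy–Schwarz: the projection of z - y onto the direction of the destination is no longer than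
z - y. -/
theorem sub_forward_le_dist {p z : Plane} (h : 0 < dist p z) (y : Plane) :
    dist p z - forward p z y ≤ dist y z := by
  have h1 := real_inner_le_norm (z - p) (z - y)
  rw [← dist_eq_norm, ← dist_eq_norm, dist_comm z p, dist_comm z y] at h1
  have h2 : inner ℝ (z - p) (z - y) = dist p z ^ 2 - inner ℝ (z - p) (y - p) := by
    rw [dist_comm, dist_eq_norm, ← real_inner_self_eq_norm_sq, ← inner_sub_right]
    congr 1; abel
  rw [forward, sub_le_iff_le_add, ← sub_le_iff_le_add', le_div_iff₀ h]
  nlinarith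

/-- The right-hand side equals (D² + d²)/(2D), where D and d are the distances of `p` and `y` to
`z`, so the claim is 2Dd ≤ D² + d². The last term is the curvature correction. -/
theorem dist_le_sub_forward {p z : Plane} (h : 0 < dist p z) (y : Plane) :
    dist y z ≤ dist p z - forward p z y + dist y p ^ 2 / (2 * dist p z) := by
  have h2 : dist y z ^ 2 = dist p z ^ 2 - 2 * inner ℝ (z - p) (y - p) + dist y p ^ 2 := by
    have e : z - y = (z - p) - (y - p) := by abel
    rw [dist_comm y z, dist_eq_norm, e, norm_sub_sq_real, ← dist_eq_norm, ← dist_eq_norm,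
      dist_comm z p]
  have h3 : dist p z - forward p z y + dist y p ^ 2 / (2 * dist p z) =
      (dist p z ^ 2 + dist y z ^ 2) / (2 * dist p z) := by
    rw [h2, forward]; field_simp; ring
  rw [h3, le_div_iff₀ (by positivity)]
  nlinarith [sq_nonneg (dist p z - dist y z)]

/-- The node itself lies in its closed half-disk but is not a relay, and its term has to be removed.
-/
theorem sum_relays_eq (hR : 0 ≤ R) (g : Plane → ℝ) :
    ∑ j ∈ relays R x d i, g (x j) =
      ∑ j, Set.indicator (halfDisk R (x i) (x d)) g (x j) - g (x i) := by
  classical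
  have h1 : ∀ j ∈ Finset.univ.erase i, Set.indicator (halfDisk R (x i) (x d)) g (x j) =
      if j ∈ relays R x d i then g (x j) else 0 := by
    intro j hj
    have : x j ∈ halfDisk R (x i) (x d) ↔ j ∈ relays R x d i := by
      rw [mem_relays]
      exact ⟨fun h => ⟨Finset.ne_of_mem_erase hj, h⟩, fun h => h.2⟩
    simp only [Set.indicator, this]
  have hi : x i ∈ halfDisk R (x i) (x d) := by
    refine ⟨by simpa using hR, by simp⟩
  rw [← Finset.add_sum_erase _ _ (Finset.mem_univ i), Set.indicator_of_mem hi,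
    Finset.sum_congr rfl h1, add_sub_cancel_left, ← Finset.sum_filter]
  refine Finset.sum_congr ?_ fun _ _ => rfl
  ext j
  simp only [Finset.mem_filter, Finset.mem_erase, Finset.mem_univ, and_true]
  exact ⟨fun h => ⟨ne_of_mem_relays h, h⟩, fun h => h.2⟩

/-- The mean displacement of a hop and its mean progress, for a node in whose half-disk sums over
the nodes are close to their means. -/
theorem drift_of_sum_estimates (hδ : 0 < δ) (hδ1 : δ ≤ 1 / 100) (hR : 0 < R)
    (hv : 1 ≤ δ * (lam * R ^ 2)) (hD : R < dist (x i) (x d))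
    (hest : ∀ g : Plane → ℝ, Measurable g → (∀ y ∈ halfDisk R (x i) (x d), |g y| ≤ 1) →
      (∀ y ∈ halfDisk R (x i) (x d), ∀ y' ∈ halfDisk R (x i) (x d),
        |g y - g y'| ≤ 2 * dist y y' / R) →
      |∑ j, Set.indicator (halfDisk R (x i) (x d)) g (x j) -
        lam * ∫ y in halfDisk R (x i) (x d), g y| ≤ δ * (lam * R ^ 2)) :
    (relays R x d i).Nonempty ∧
    (∀ e : Plane, ‖e‖ ≤ 1 → |∑ j, hopProb R x d i j * inner ℝ (x j - x i) e -
      4 / (3 * Real.pi) * R * (inner ℝ (x d - x i) e / dist (x i) (x d))| ≤ 2 * δ * R) ∧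
    ∑ j, hopProb R x d i j * (dist (x j) (x d) - dist (x i) (x d)) ≤ -(R / 10) := by
  have hpi3 := Real.pi_gt_d2
  have hpi4 := Real.pi_lt_d2
  have hD0 : 0 < dist (x i) (x d) := hR.trans hD
  have hne : x i ≠ x d := dist_pos.1 hD0
  set v := lam * R ^ 2 with hvdef
  have hv0 : 0 < v := by by_contra h; nlinarith
  set N : ℝ := ((relays R x d i).card : ℝ) with hN
  -- the number of relays
  have hcard : |N - v * (Real.pi / 2)| ≤ 2 * δ * v := by
    have h1 := hest (fun _ => 1) measurable_const (by simp) (fun y _ y' _ => by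
      simp only [sub_self, abs_zero]; positivity)
    rw [integral_halfDisk_one hR.le hne] at h1
    have h2 := sum_relays_eq (x := x) (d := d) (i := i) hR.le fun _ => (1 : ℝ)
    simp only [Finset.sum_const, nsmul_eq_mul, mul_one] at h2
    have h3 := abs_le.1 h1
    -- Removing the node itself changes the count by 1, which `hv` absorbs; hence 2δ instead of δ.
    rw [abs_le, hvdef, hN]
    constructor <;> nlinarith
  have hc := abs_le.1 hcard
  have hNv : v * 1.54 ≤ N := by nlinarith
  have hN0 : 0 < N := by nlinarith
  have hnonempty : (relays R x d i).Nonempty := by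
    rw [hN] at hN0
    exact Finset.card_pos.1 (by exact_mod_cast hN0)
  -- the sum of the displacements
  have hinner : ∀ e : Plane, ‖e‖ ≤ 1 → |∑ j ∈ relays R x d i, inner ℝ (x j - x i) e -
      v * R * (2 / 3 * (inner ℝ (x d - x i) e / dist (x i) (x d)))| ≤ δ * v * R := by
    intro e he
    have hle : ∀ w : Plane, |inner ℝ w e| ≤ ‖w‖ := fun w =>
      (abs_real_inner_le_norm w e).trans (mul_le_of_le_one_right (norm_nonneg _) he)
    have h1 := hest (fun y => inner ℝ (y - x i) e / R) (by fun_prop) (fun y hy => by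
        rw [abs_div, abs_of_pos hR, div_le_one hR]
        exact (hle _).trans (by rw [← dist_eq_norm]; exact hy.1))
      (fun y _ y' _ => by
        have e1 : inner ℝ (y - x i) e / R - inner ℝ (y' - x i) e / R = inner ℝ (y - y') e / R := by
          rw [← sub_div, ← inner_sub_left]; congr 2; abel
        rw [e1, abs_div, abs_of_pos hR, div_le_div_iff_of_pos_right hR]
        have := hle (y - y')
        rw [← dist_eq_norm] at this
        linarith [dist_nonneg (x := y) (y := y')])
    rw [integral_div, integral_halfDisk_inner hR.le hne] at h1
    have h2 := sum_relays_eq (x := x) (d := d) (i := i) hR.le fun y => inner ℝ (y - x i) e / R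
    rw [sub_self, inner_zero_left, zero_div, sub_zero, ← Finset.sum_div] at h2
    rw [← h2] at h1
    have h3 : ∑ j ∈ relays R x d i, inner ℝ (x j - x i) e -
        v * R * (2 / 3 * (inner ℝ (x d - x i) e / dist (x i) (x d))) =
        R * ((∑ j ∈ relays R x d i, inner ℝ (x j - x i) e) / R -
          lam * (2 / 3 * R ^ 3 * (inner ℝ (x d - x i) e / dist (x i) (x d)) / R)) := by
      rw [hvdef]; field_simp
    rw [h3, abs_mul, abs_of_pos hR]
    calc _ ≤ R * (δ * v) := by gcongr
      _ = _ := by ring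
  -- the sum of the squared lengths
  have hsq : ∑ j ∈ relays R x d i, dist (x j) (x i) ^ 2 ≤ v * R ^ 2 * (Real.pi / 4 + δ) := by
    have h1 := hest (fun y => dist y (x i) ^ 2 / R ^ 2) (by fun_prop) (fun y hy => by
        rw [abs_of_nonneg (by positivity), div_le_one (by positivity)]
        have := hy.1
        gcongr)
      (fun y hy y' hy' => by
        have e1 : dist y (x i) ^ 2 / R ^ 2 - dist y' (x i) ^ 2 / R ^ 2 =
            (dist y (x i) - dist y' (x i)) * (dist y (x i) + dist y' (x i)) / R ^ 2 := by ring
        rw [e1, abs_div, abs_mul, abs_of_nonneg (by positivity : (0 : ℝ) ≤ R ^ 2),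
          abs_of_nonneg (by positivity : (0 : ℝ) ≤ dist y (x i) + dist y' (x i)),
          div_le_div_iff₀ (by positivity) hR]
        have h2 := abs_dist_sub_le y y' (x i)
        have h3 : dist y (x i) + dist y' (x i) ≤ 2 * R := by
          have := hy.1; have := hy'.1; linarith
        calc _ ≤ dist y y' * (2 * R) * R := by gcongr
          _ = _ := by ring)
    rw [integral_div, integral_halfDisk_sq hR.le hne] at h1
    have h2 := sum_relays_eq (x := x) (d := d) (i := i) hR.le fun y => dist y (x i) ^ 2 / R ^ 2
    rw [dist_self, zero_pow two_ne_zero, zero_div, sub_zero, ← Finset.sum_div] at h2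
    rw [← h2] at h1
    have h3 := (abs_le.1 h1).2
    have h4 : (∑ j ∈ relays R x d i, dist (x j) (x i) ^ 2) / R ^ 2 ≤
        v * (Real.pi / 4 + δ) := by
      have : lam * (Real.pi / 4 * R ^ 4 / R ^ 2) = v * (Real.pi / 4) := by
        rw [hvdef]; field_simp
      linarith
    rw [div_le_iff₀ (by positivity)] at h4
    linarith
  have hmean : ∀ e : Plane, ‖e‖ ≤ 1 → |∑ j, hopProb R x d i j * inner ℝ (x j - x i) e -
      4 / (3 * Real.pi) * R * (inner ℝ (x d - x i) e / dist (x i) (x d))| ≤ 2 * δ * R := by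
    intro e he
    have h1 := hinner e he
    rw [sum_hopProb_mul]
    set s := inner ℝ (x d - x i) e / dist (x i) (x d) with hs
    have hs1 : |s| ≤ 1 := by
      rw [hs, abs_div, abs_of_pos hD0, div_le_one hD0, dist_comm, dist_eq_norm]
      exact (abs_real_inner_le_norm _ _).trans (mul_le_of_le_one_right (norm_nonneg _) he)
    set S := ∑ j ∈ relays R x d i, inner ℝ (x j - x i) e
    have hμ : 0 < 4 / (3 * Real.pi) ∧ 4 / (3 * Real.pi) ≤ 1 / 2 := by
      constructor
      · positivity
      · rw [div_le_iff₀ (by positivity)]; linarith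
    -- The ratio of the limiting sums is (2/3)/(π/2) = 4/(3π). The numerator separates the error of
    -- the sum from the error of the count.
    have e1 : S / N - 4 / (3 * Real.pi) * R * s =
        ((S - v * R * (2 / 3 * s)) - 4 / (3 * Real.pi) * R * s * (N - v * (Real.pi / 2))) / N := by
      field_simp
      ring
    rw [e1, abs_div, abs_of_pos hN0, div_le_iff₀ hN0]
    have h2 : |4 / (3 * Real.pi) * R * s * (N - v * (Real.pi / 2))| ≤
        1 / 2 * R * 1 * (2 * δ * v) := by
      rw [abs_mul, abs_mul, abs_mul, abs_of_pos hμ.1, abs_of_pos hR]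
      exact mul_le_mul (mul_le_mul (mul_le_mul_of_nonneg_right hμ.2 hR.le) hs1 (abs_nonneg _)
        (by positivity)) hcard (abs_nonneg _) (by positivity)
    calc _ ≤ _ := abs_sub _ _
      _ ≤ δ * v * R + 1 / 2 * R * 1 * (2 * δ * v) := add_le_add h1 h2
      _ ≤ 2 * δ * R * N := by nlinarith [mul_pos hδ hR]
  refine ⟨hnonempty, hmean, ?_⟩
  -- the mean progress
  set u : Plane := (dist (x i) (x d))⁻¹ • (x d - x i) with hu
  have hu1 : ‖u‖ = 1 := by
    rw [hu, norm_smul, norm_inv, Real.norm_of_nonneg hD0.le, dist_comm, dist_eq_norm]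
    have : ‖x d - x i‖ ≠ 0 := norm_ne_zero_iff.2 (sub_ne_zero.2 hne.symm)
    field_simp
  have hfu : ∀ j, forward (x i) (x d) (x j) = inner ℝ (x j - x i) u := by
    intro j
    rw [forward, hu, inner_smul_right, real_inner_comm]
    ring
  have h1 := (abs_le.1 (hmean u hu1.le)).1
  have h2 : inner ℝ (x d - x i) u / dist (x i) (x d) = 1 := by
    rw [hu, inner_smul_right, real_inner_self_eq_norm_sq, ← dist_eq_norm, dist_comm (x d)]
    field_simp
  rw [h2, mul_one] at h1
  -- Numerically the drift is at most (-0.42 + 0.02 + 0.27)R: mean advance, error 2δR, and curvature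
  -- correction with the distance to the destination bounded below by `R`. This lies below -R/10.
  have hμ : 0.42 ≤ 4 / (3 * Real.pi) := by
    rw [le_div_iff₀ (by positivity)]; linarith
  have h3 : ∑ j, hopProb R x d i j * (dist (x j) (x d) - dist (x i) (x d)) ≤
      ∑ j, hopProb R x d i j * (-(inner ℝ (x j - x i) u) + dist (x j) (x i) ^ 2 / (2 * R)) := by
    refine Finset.sum_le_sum fun j _ => mul_le_mul_of_nonneg_left ?_ (hopProb_nonneg _ _)
    have h4 := dist_le_sub_forward hD0 (x j)
    rw [hfu] at h4
    have h5 : dist (x j) (x i) ^ 2 / (2 * dist (x i) (x d)) ≤ dist (x j) (x i) ^ 2 / (2 * R) := by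
      gcongr
    linarith
  refine h3.trans ?_
  have h4 : ∑ j, hopProb R x d i j * (-(inner ℝ (x j - x i) u) + dist (x j) (x i) ^ 2 / (2 * R)) =
      -(∑ j, hopProb R x d i j * inner ℝ (x j - x i) u) +
        (∑ j, hopProb R x d i j * dist (x j) (x i) ^ 2) / (2 * R) := by
    rw [← Finset.sum_neg_distrib, Finset.sum_div, ← Finset.sum_add_distrib]
    exact Finset.sum_congr rfl fun j _ => by ring
  rw [h4]
  have h5 : (∑ j, hopProb R x d i j * dist (x j) (x i) ^ 2) / (2 * R) ≤ 0.27 * R := by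
    rw [sum_hopProb_mul, div_div, div_le_iff₀ (by positivity)]
    refine hsq.trans ?_
    have h6 : v * (Real.pi / 4 + δ) ≤ 0.54 * N := by nlinarith
    nlinarith [mul_pos hR hR]
  nlinarith

end Drift

end Network

namespace Network

/-! ### Exponential supermartingales and a potential for bad places -/

section Potential

variable {n : ℕ} {x : Fin n → Plane} {R : ℝ} {d i : Fin n}

/-- The mean of `g` at the next relay of a packet for `d` at the node `i`. -/
noncomputable def hopMean (R : ℝ) (x : Fin n → Plane) (d i : Fin n) (g : Fin n → ℝ) : ℝ :=
  ∑ j, hopProb R x d i j * g j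

theorem hopMean_mono {f g : Fin n → ℝ} (h : ∀ j ∈ relays R x d i, f j ≤ g j) :
    hopMean R x d i f ≤ hopMean R x d i g := by
  refine Finset.sum_le_sum fun j _ => ?_
  by_cases h0 : hopProb R x d i j = 0
  · simp [h0]
  · exact mul_le_mul_of_nonneg_left (h j (mem_relays_of_hopProb_ne_zero h0)) (hopProb_nonneg _ _)

theorem hopMean_add (f g : Fin n → ℝ) :
    hopMean R x d i (fun j => f j + g j) = hopMean R x d i f + hopMean R x d i g := by
  simp [hopMean, mul_add, Finset.sum_add_distrib]

theorem hopMean_const_mul (c : ℝ) (f : Fin n → ℝ) :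
    hopMean R x d i (fun j => c * f j) = c * hopMean R x d i f := by
  simp only [hopMean, Finset.mul_sum]
  exact Finset.sum_congr rfl fun _ _ => by ring

theorem hopMean_sum {ι : Type*} (S : Finset ι) (f : ι → Fin n → ℝ) :
    hopMean R x d i (fun j => ∑ q ∈ S, f q j) = ∑ q ∈ S, hopMean R x d i (f q) := by
  simp only [hopMean, Finset.mul_sum]
  exact Finset.sum_comm

theorem hopMean_const (h : (relays R x d i).Nonempty) (c : ℝ) :
    hopMean R x d i (fun _ => c) = c := by
  rw [hopMean, ← Finset.sum_mul, sum_hopProb_of_nonempty h, one_mul]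

theorem abs_dist_sub_le_of_mem_relays {j : Fin n} (h : j ∈ relays R x d i) (q : Plane) :
    |dist (x j) q - dist (x i) q| ≤ R :=
  (abs_dist_sub_le _ _ _).trans (dist_le_of_mem_relays h)

/-- An exponential of the distance to the destination, capped at the value for a distance which
exceeds the one of the point `q` by `(C + 1) * R`. -/
noncomputable def cappedExp (R C : ℝ) (x : Fin n → Plane) (d : Fin n) (q : Plane) (i : Fin n) : ℝ :=
  min (Real.exp ((dist (x i) (x d) - dist q (x d)) / (20 * R))) (Real.exp ((C + 1) / 20))

theorem cappedExp_nonneg (C : ℝ) (q : Plane) : 0 ≤ cappedExp R C x d q i :=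
  le_min (Real.exp_pos _).le (Real.exp_pos _).le

theorem cappedExp_le (C : ℝ) (q : Plane) : cappedExp R C x d q i ≤ Real.exp ((C + 1) / 20) :=
  min_le_right _ _

/-- With τ the change of distance divided by 20R, |τ| ≤ 1/20 and e^τ ≤ 1 + τ + τ². The drift gives a
mean of τ of at most -1/200, and the square costs at most 1/400. -/
theorem hopMean_exp_le (hR : 0 < R) (hne : (relays R x d i).Nonempty)
    (hdrift : hopMean R x d i (fun j => dist (x j) (x d) - dist (x i) (x d)) ≤ -(R / 10))
    (t : ℝ) :
    hopMean R x d i (fun j => Real.exp ((dist (x j) (x d) - t) / (20 * R))) ≤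
      (1 - 1 / 400) * Real.exp ((dist (x i) (x d) - t) / (20 * R)) := by
  set E := Real.exp ((dist (x i) (x d) - t) / (20 * R)) with hE
  have hE0 : 0 < E := Real.exp_pos _
  calc hopMean R x d i (fun j => Real.exp ((dist (x j) (x d) - t) / (20 * R)))
      ≤ hopMean R x d i fun j => (E / (20 * R)) * (dist (x j) (x d) - dist (x i) (x d)) +
          E * (1 + 1 / 400) := by
        refine hopMean_mono fun j hj => ?_
        set τ := (dist (x j) (x d) - dist (x i) (x d)) / (20 * R) with hτ
        have h1 : |τ| ≤ 1 / 20 := by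
          rw [hτ, abs_div, abs_of_pos (by positivity : 0 < 20 * R), div_le_iff₀ (by positivity)]
          linarith [abs_dist_sub_le_of_mem_relays hj (x d)]
        have h2 := (abs_le.1 (Real.abs_exp_sub_one_sub_id_le (x := τ) (by linarith))).2
        have h3 : τ ^ 2 ≤ 1 / 400 := by
          rw [← sq_abs]; nlinarith [abs_nonneg τ]
        have h4 : Real.exp ((dist (x j) (x d) - t) / (20 * R)) = E * Real.exp τ := by
          rw [hE, ← Real.exp_add, hτ]; congr 1; ring
        have h5 : E / (20 * R) * (dist (x j) (x d) - dist (x i) (x d)) = E * τ := by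
          rw [hτ]; ring
        rw [h4, h5]
        nlinarith
    _ = E / (20 * R) * hopMean R x d i (fun j => dist (x j) (x d) - dist (x i) (x d)) +
          E * (1 + 1 / 400) := by
        rw [hopMean_add, hopMean_const_mul, hopMean_const hne]
    _ ≤ E / (20 * R) * (-(R / 10)) + E * (1 + 1 / 400) := by gcongr
    _ = (1 - 1 / 400) * E := by field_simp; ring

/-- A minimum of a supermartingale and a constant is again a supermartingale. The cap keeps the
potential bounded. -/
theorem hopMean_cappedExp_le (hR : 0 < R) (hne : (relays R x d i).Nonempty)
    (hdrift : hopMean R x d i (fun j => dist (x j) (x d) - dist (x i) (x d)) ≤ -(R / 10))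
    {C : ℝ} (q : Plane) :
    hopMean R x d i (cappedExp R C x d q) ≤ cappedExp R C x d q i := by
  refine le_min ?_ ?_
  · refine (hopMean_mono fun j _ => min_le_left _ _).trans
      ((hopMean_exp_le hR hne hdrift (dist q (x d))).trans ?_)
    have := Real.exp_pos ((dist (x i) (x d) - dist q (x d)) / (20 * R))
    linarith
  · exact (hopMean_mono fun j _ => min_le_right _ _).trans (hopMean_const hne _).le

/-- Within C·R of `q` the exponent lies between -C/20 and C/20, below the cap, so the full
contraction by 1/400 acts on a value of at least exp(-C/20). -/
theorem hopMean_cappedExp_le_sub (hR : 0 < R) (hne : (relays R x d i).Nonempty)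
    (hdrift : hopMean R x d i (fun j => dist (x j) (x d) - dist (x i) (x d)) ≤ -(R / 10))
    {C : ℝ} {q : Plane} (hq : dist (x i) q ≤ C * R) :
    hopMean R x d i (cappedExp R C x d q) ≤
      cappedExp R C x d q i - Real.exp (-(C / 20)) / 400 := by
  have h1 := abs_le.1 ((abs_dist_sub_le (x i) q (x d)).trans hq)
  have h2 : (dist (x i) (x d) - dist q (x d)) / (20 * R) ≤ (C + 1) / 20 := by
    rw [div_le_div_iff₀ (by positivity) (by norm_num)]; nlinarith
  have h3 : -(C / 20) ≤ (dist (x i) (x d) - dist q (x d)) / (20 * R) := by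
    rw [le_div_iff₀ (by positivity)]; nlinarith
  have h4 : cappedExp R C x d q i =
      Real.exp ((dist (x i) (x d) - dist q (x d)) / (20 * R)) :=
    min_eq_left (Real.exp_le_exp.2 h2)
  rw [h4]
  refine (hopMean_mono fun j _ => min_le_left _ _).trans
    ((hopMean_exp_le hR hne hdrift (dist q (x d))).trans ?_)
  have := Real.exp_le_exp.2 h3
  linarith

/-- A cutoff function around the point `q`. -/
noncomputable def cutoff (R T : ℝ) (x : Fin n → Plane) (q : Plane) (i : Fin n) : ℝ :=
  max 0 (1 - dist (x i) q / (T * R))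

-- The cutoff varies by at most 1/T per hop, so localising the supermartingale costs at most the cap
-- divided by `T`, and only within (T + 1)R of `q`. Near `q` the cutoff is at least 1/2 because 2C ≤
-- T, which turns the drop over 400 into a drop over 800.
open scoped Classical in
theorem hopMean_cutoff_le (hR : 0 < R) (hne : (relays R x d i).Nonempty)
    (hdrift : hopMean R x d i (fun j => dist (x j) (x d) - dist (x i) (x d)) ≤ -(R / 10))
    {C T : ℝ} (hC : 0 < C) (hT : 2 * C ≤ T) (q : Plane) :
    hopMean R x d i (fun j => cutoff R T x q j * cappedExp R C x d q j) ≤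
      cutoff R T x q i * cappedExp R C x d q i -
        (if dist (x i) q ≤ C * R then Real.exp (-(C / 20)) / 800 else 0) +
        (if dist (x i) q ≤ (T + 1) * R then Real.exp ((C + 1) / 20) / T else 0) := by
  have hT0 : 0 < T := by linarith
  have hcn : ∀ j, 0 ≤ cutoff R T x q j := fun j => le_max_left _ _
  by_cases hfar : dist (x i) q ≤ (T + 1) * R
  · rw [if_pos hfar]
    have h1 : hopMean R x d i (fun j => cutoff R T x q j * cappedExp R C x d q j) ≤
        cutoff R T x q i * hopMean R x d i (cappedExp R C x d q) +
          Real.exp ((C + 1) / 20) / T := by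
      calc _ ≤ hopMean R x d i fun j => cutoff R T x q i * cappedExp R C x d q j +
            Real.exp ((C + 1) / 20) / T := by
            refine hopMean_mono fun j hj => ?_
            have h2 : cutoff R T x q j ≤ cutoff R T x q i + 1 / T := by
              refine max_le (by have := hcn i; positivity) ?_
              have h3 := (abs_le.1 (abs_dist_sub_le_of_mem_relays hj q)).1
              have h4 : dist (x i) q / (T * R) ≤ dist (x j) q / (T * R) + 1 / T := by
                have : 1 / T = R / (T * R) := by field_simp
                rw [this, ← add_div]; gcongr; linarith
              have := le_max_right 0 (1 - dist (x i) q / (T * R))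
              unfold cutoff
              linarith
            calc _ ≤ (cutoff R T x q i + 1 / T) * cappedExp R C x d q j :=
                  mul_le_mul_of_nonneg_right h2 (cappedExp_nonneg C q)
              _ = cutoff R T x q i * cappedExp R C x d q j + cappedExp R C x d q j / T := by ring
              _ ≤ _ := by gcongr; exact cappedExp_le C q
        _ = _ := by rw [hopMean_add, hopMean_const_mul, hopMean_const hne]
    split_ifs with hnear
    · have h2 := hopMean_cappedExp_le_sub hR hne hdrift hnear
      have h3 : 1 / 2 ≤ cutoff R T x q i := by
        refine le_max_of_le_right ?_
        have : dist (x i) q / (T * R) ≤ 1 / 2 := by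
          rw [div_le_iff₀ (by positivity)]; nlinarith
        linarith
      have h4 := mul_le_mul_of_nonneg_left h2 (hcn i)
      have h5 := Real.exp_pos (-(C / 20))
      nlinarith
    · have h2 := mul_le_mul_of_nonneg_left
        (hopMean_cappedExp_le (C := C) hR hne hdrift q) (hcn i)
      linarith
  · have hnear : ¬ dist (x i) q ≤ C * R := fun h => hfar (h.trans (by nlinarith))
    rw [if_neg hfar, if_neg hnear]
    have h0 : ∀ j, T * R ≤ dist (x j) q → cutoff R T x q j = 0 := fun j hj =>
      max_eq_left (by rw [sub_nonpos, le_div_iff₀ (by positivity)]; linarith)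
    calc _ ≤ hopMean R x d i fun _ => 0 := by
          refine hopMean_mono fun j hj => ?_
          have h3 := (abs_le.1 (abs_dist_sub_le_of_mem_relays hj q)).1
          rw [h0 j (by linarith [not_le.1 hfar]), zero_mul]
      _ = 0 := hopMean_const hne 0
      _ ≤ _ := by
          have := mul_nonneg (hcn i) (cappedExp_nonneg (R := R) (x := x) (d := d) (i := i) C q)
          linarith

open scoped Classical in
/-- If the points `pt q`, `q ∈ I`, are sparse, there is a bounded potential which decreases by `1`
at the nodes close to one of these points or to the destination, and does not increase much at
the other nodes. -/
theorem exists_potential (hR : 0 < R) {ι : Type*} (I : Finset ι) (pt : ι → Plane) {C L T : ℝ}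
    (hC : 0 < C) (hT : 2 * C ≤ T) {k : ℕ}
    (hsparse : ∀ i, ((I.filter fun q => dist (x i) (pt q) ≤ (T + 1) * R).card : ℝ) ≤ k)
    {U : Set (Fin n)} (hne : ∀ i ∈ U, (relays R x d i).Nonempty)
    (hdrift : ∀ i ∈ U,
      hopMean R x d i (fun j => dist (x j) (x d) - dist (x i) (x d)) ≤ -(R / 10)) :
    ∃ Ψ : Fin n → ℝ, (∀ i, 0 ≤ Ψ i) ∧
      (∀ i, Ψ i ≤ k * Real.exp ((C + 1) / 20) * (800 * Real.exp (C / 20)) +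
        400 * Real.exp ((2 * L + 1) / 20)) ∧
      ∀ i ∈ U, hopMean R x d i Ψ ≤ Ψ i -
        (if (∃ q ∈ I, dist (x i) (pt q) ≤ C * R) ∨ dist (x i) (x d) ≤ L * R then 1 else 0) +
        k * Real.exp ((C + 1) / 20) * (800 * Real.exp (C / 20)) / T := by
  have hT0 : 0 < T := by linarith
  -- `A` and `B` normalise to 1 the drops at the points `pt q` and at the destination. The
  -- destination is a single point and needs no cutoff.
  set A := 800 * Real.exp (C / 20) with hA
  have hA0 : 0 < A := by positivity
  have hAe : A * (Real.exp (-(C / 20)) / 800) = 1 := by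
    rw [hA, Real.exp_neg]
    have := Real.exp_pos (C / 20)
    field_simp
  set B := 400 * Real.exp (L / 20) with hB
  have hB0 : 0 < B := by positivity
  have hBe : B * (Real.exp (-(L / 20)) / 400) = 1 := by
    rw [hB, Real.exp_neg]
    have := Real.exp_pos (L / 20)
    field_simp
  set E := Real.exp ((C + 1) / 20) with hE
  have hE0 : 0 < E := Real.exp_pos _
  have hcn : ∀ q j, 0 ≤ cutoff R T x q j := fun q j => le_max_left _ _
  have hc1 : ∀ q j, cutoff R T x q j ≤ 1 := fun q j =>
    max_le zero_le_one (by have : 0 ≤ dist (x j) q / (T * R) := by positivity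
                           linarith)
  let Ψ : Fin n → ℝ := fun j =>
    A * (∑ q ∈ I, cutoff R T x (pt q) j * cappedExp R C x d (pt q) j) +
      B * cappedExp R L x d (x d) j
  refine ⟨Ψ, fun i => ?_, fun i => ?_, fun i hi => ?_⟩
  · have : 0 ≤ ∑ q ∈ I, cutoff R T x (pt q) i * cappedExp R C x d (pt q) i :=
      Finset.sum_nonneg fun q _ => mul_nonneg (hcn _ _) (cappedExp_nonneg _ _)
    have := cappedExp_nonneg (R := R) (x := x) (d := d) (i := i) L (x d)
    positivity
  · have h1 : ∑ q ∈ I, cutoff R T x (pt q) i * cappedExp R C x d (pt q) i ≤ k * E := by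
      calc _ = ∑ q ∈ I.filter fun q => dist (x i) (pt q) ≤ (T + 1) * R,
            cutoff R T x (pt q) i * cappedExp R C x d (pt q) i := by
            symm
            refine Finset.sum_filter_of_ne fun q _ hq => ?_
            by_contra hfar
            apply hq
            have : cutoff R T x (pt q) i = 0 :=
              max_eq_left (by rw [sub_nonpos, le_div_iff₀ (by positivity)]; nlinarith)
            rw [this, zero_mul]
        _ ≤ ∑ q ∈ I.filter fun q => dist (x i) (pt q) ≤ (T + 1) * R, E := by
            refine Finset.sum_le_sum fun q _ => ?_
            calc _ ≤ 1 * E := mul_le_mul (hc1 _ _) (cappedExp_le _ _) (cappedExp_nonneg _ _)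
                  zero_le_one
              _ = E := one_mul E
        _ ≤ k * E := by
            rw [Finset.sum_const, nsmul_eq_mul]
            exact mul_le_mul_of_nonneg_right (hsparse i) hE0.le
    have h2 := cappedExp_le (R := R) (x := x) (d := d) (i := i) L (x d)
    have h3 : B * Real.exp ((L + 1) / 20) = 400 * Real.exp ((2 * L + 1) / 20) := by
      rw [hB, mul_assoc, ← Real.exp_add]; congr 2; ring
    have h4 := mul_le_mul_of_nonneg_left h1 hA0.le
    have h5 := mul_le_mul_of_nonneg_left h2 hB0.le
    simp only [Ψ]
    linarith
  · have hsum : hopMean R x d i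
        (fun j => ∑ q ∈ I, cutoff R T x (pt q) j * cappedExp R C x d (pt q) j) ≤
        ∑ q ∈ I, cutoff R T x (pt q) i * cappedExp R C x d (pt q) i -
        (if ∃ q ∈ I, dist (x i) (pt q) ≤ C * R then Real.exp (-(C / 20)) / 800 else 0) +
        k * E / T := by
      rw [hopMean_sum]
      refine (Finset.sum_le_sum fun q _ =>
        hopMean_cutoff_le hR (hne i hi) (hdrift i hi) hC hT (pt q)).trans ?_
      rw [Finset.sum_add_distrib, Finset.sum_sub_distrib]
      refine add_le_add (sub_le_sub_left ?_ _) ?_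
      · have hnn : ∀ q ∈ I, 0 ≤ if dist (x i) (pt q) ≤ C * R then
            Real.exp (-(C / 20)) / 800 else 0 := fun q _ => by
          split_ifs <;> positivity
        split_ifs with h
        · obtain ⟨q, hq, hqd⟩ := h
          refine le_trans ?_ (Finset.single_le_sum hnn hq)
          rw [if_pos hqd]
        · exact Finset.sum_nonneg hnn
      · rw [← Finset.sum_filter, Finset.sum_const, nsmul_eq_mul, mul_div_assoc]
        exact mul_le_mul_of_nonneg_right (hsparse i) (by positivity)
    have hdest : hopMean R x d i (cappedExp R L x d (x d)) ≤ cappedExp R L x d (x d) i -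
        (if dist (x i) (x d) ≤ L * R then Real.exp (-(L / 20)) / 400 else 0) := by
      split_ifs with h
      · exact hopMean_cappedExp_le_sub hR (hne i hi) (hdrift i hi) h
      · rw [sub_zero]
        exact hopMean_cappedExp_le hR (hne i hi) (hdrift i hi) _
    have h4 := mul_le_mul_of_nonneg_left hsum hA0.le
    have h5 := mul_le_mul_of_nonneg_left hdest hB0.le
    simp only [Ψ, hopMean_add, hopMean_const_mul]
    have h6 : A * (if ∃ q ∈ I, dist (x i) (pt q) ≤ C * R then Real.exp (-(C / 20)) / 800 else 0) =
        if ∃ q ∈ I, dist (x i) (pt q) ≤ C * R then 1 else 0 := by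
      rw [mul_ite, hAe, mul_zero]
    have h7 : B * (if dist (x i) (x d) ≤ L * R then Real.exp (-(L / 20)) / 400 else 0) =
        if dist (x i) (x d) ≤ L * R then 1 else 0 := by
      rw [mul_ite, hBe, mul_zero]
    have h8 : (if (∃ q ∈ I, dist (x i) (pt q) ≤ C * R) ∨ dist (x i) (x d) ≤ L * R then (1 : ℝ)
        else 0) ≤ (if ∃ q ∈ I, dist (x i) (pt q) ≤ C * R then 1 else 0) +
          if dist (x i) (x d) ≤ L * R then 1 else 0 := by
      by_cases ha : ∃ q ∈ I, dist (x i) (pt q) ≤ C * R <;>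
        by_cases hb : dist (x i) (x d) ≤ L * R <;> simp [ha, hb]
    have h9 : k * E * A / T = A * (k * E / T) := by ring
    rw [h9]
    rw [mul_add, mul_sub, h6] at h4
    rw [mul_sub, h7] at h5
    linarith

end Potential

end Network

namespace Network

/-! ### Deviation bounds for routes in a fixed configuration -/

section Quenched

variable {n : ℕ} {x : Fin n → Plane} {R : ℝ} {s d i : Fin n}

/-- The mean change of the distance to the destination at a node with a regular half-disk which is
far from the destination. -/
theorem abs_hopMean_dist_add_le {μ ε : ℝ} (hR : 0 < R) (hε : 0 < ε)
    (hne : (relays R x d i).Nonempty) (hD : R ≤ ε * dist (x i) (x d))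
    (hmean : ∀ e : Plane, ‖e‖ ≤ 1 → |hopMean R x d i (fun j => inner ℝ (x j - x i) e) -
      μ * R * (inner ℝ (x d - x i) e / dist (x i) (x d))| ≤ ε * R) :
    |hopMean R x d i fun j => dist (x j) (x d) - dist (x i) (x d) + μ * R| ≤ 2 * ε * R := by
  have hD0 : 0 < dist (x i) (x d) := by
    by_contra h
    nlinarith [not_lt.1 h]
  set D := dist (x i) (x d) with hDdef
  set u : Plane := D⁻¹ • (x d - x i) with hu
  have hxd : ‖x d - x i‖ = D := by rw [hDdef, dist_comm, dist_eq_norm]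
  have hu1 : ‖u‖ = 1 := by
    rw [hu, norm_smul, norm_inv, Real.norm_of_nonneg hD0.le, hxd]
    field_simp
  have hfu : ∀ j, forward (x i) (x d) (x j) = inner ℝ (x j - x i) u := by
    intro j
    rw [forward, hu, inner_smul_right, real_inner_comm]
    ring
  have h1 := abs_le.1 (hmean u hu1.le)
  have h2 : inner ℝ (x d - x i) u / D = 1 := by
    rw [hu, inner_smul_right, real_inner_self_eq_norm_sq, hxd]
    field_simp
  rw [h2, mul_one] at h1
  have hup : hopMean R x d i (fun j => dist (x j) (x d) - D + μ * R) ≤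
      -hopMean R x d i (fun j => inner ℝ (x j - x i) u) + (ε * R / 2 + μ * R) := by
    calc _ ≤ hopMean R x d i fun j => (-1) * inner ℝ (x j - x i) u + (ε * R / 2 + μ * R) := by
          refine hopMean_mono fun j hj => ?_
          have h4 := dist_le_sub_forward hD0 (x j)
          rw [hfu] at h4
          have h5 : dist (x j) (x i) ^ 2 / (2 * D) ≤ ε * R / 2 := by
            rw [div_le_iff₀ (by positivity)]
            have h6 := dist_le_of_mem_relays hj
            have h7 : dist (x j) (x i) ^ 2 ≤ R ^ 2 := by gcongr
            nlinarith
          linarith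
      _ = _ := by rw [hopMean_add, hopMean_const_mul, hopMean_const hne]; ring
  have hlo : -hopMean R x d i (fun j => inner ℝ (x j - x i) u) + μ * R ≤
      hopMean R x d i (fun j => dist (x j) (x d) - D + μ * R) := by
    calc _ = hopMean R x d i fun j => (-1) * inner ℝ (x j - x i) u + μ * R := by
          rw [hopMean_add, hopMean_const_mul, hopMean_const hne]; ring
      _ ≤ _ := by
          refine hopMean_mono fun j hj => ?_
          have h4 := sub_forward_le_dist hD0 (x j)
          rw [hfu] at h4
          linarith
  have : 0 < ε * R := by positivity
  rw [abs_le]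
  constructor <;> linarith

/-- The excess of the squared norm over `r ^ 2`, squared. -/
noncomputable def excess (r : ℝ) (y : Plane) : ℝ := max 0 (‖y‖ ^ 2 - r ^ 2) ^ 2

theorem excess_nonneg (r : ℝ) (y : Plane) : 0 ≤ excess r y := sq_nonneg _

/-- A second-order expansion: the square of the positive part has the derivative 2t₊, which is
2-Lipschitz. -/
theorem excess_le_add (r : ℝ) (y y' : Plane) :
    excess r y' ≤ excess r y + 2 * max 0 (‖y‖ ^ 2 - r ^ 2) * (‖y'‖ ^ 2 - ‖y‖ ^ 2) +
      (‖y'‖ ^ 2 - ‖y‖ ^ 2) ^ 2 := by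
  unfold excess
  rcases le_total 0 (‖y‖ ^ 2 - r ^ 2) with h | h
  · rw [max_eq_right h]
    rcases le_total 0 (‖y'‖ ^ 2 - r ^ 2) with h' | h'
    · rw [max_eq_right h']; nlinarith
    · rw [max_eq_left h']
      nlinarith [sq_nonneg ((‖y‖ ^ 2 - r ^ 2) + (‖y'‖ ^ 2 - ‖y‖ ^ 2))]
  · rw [max_eq_left h]
    rcases le_total 0 (‖y'‖ ^ 2 - r ^ 2) with h' | h'
    · rw [max_eq_right h']; nlinarith
    · rw [max_eq_left h']; nlinarith [sq_nonneg (‖y'‖ ^ 2 - ‖y‖ ^ 2)]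

theorem abs_norm_sq_sub_le {ρ : ℝ} (hRρ : R ≤ ρ) (hi : ‖x i‖ ≤ ρ) {j : Fin n}
    (hj : j ∈ relays R x d i) : |‖x j‖ ^ 2 - ‖x i‖ ^ 2| ≤ 3 * ρ * R := by
  have h1 := dist_le_of_mem_relays hj
  have h2 : |‖x j‖ - ‖x i‖| ≤ R := by
    rw [dist_eq_norm] at h1
    exact (abs_norm_sub_norm_le _ _).trans h1
  have hR0 : 0 ≤ R := dist_nonneg.trans h1
  have h3 : ‖x j‖ ^ 2 - ‖x i‖ ^ 2 = (‖x j‖ - ‖x i‖) * (‖x j‖ + ‖x i‖) := by ring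
  rw [h3, abs_mul, abs_of_nonneg (by positivity : 0 ≤ ‖x j‖ + ‖x i‖)]
  have h4 : ‖x j‖ + ‖x i‖ ≤ 3 * ρ := by linarith [(abs_le.1 h2).2]
  calc _ ≤ R * (3 * ρ) := by gcongr
    _ = _ := by ring

/-- The mean change of the excess is of smaller order than `R` at a node with a regular half-disk,
for a destination of norm at most `r`. -/
theorem hopMean_excess_le {ρ r μ ε : ℝ} (hR : 0 < R) (hRρ : R ≤ ρ) (hr : 0 ≤ r) (hμ : 0 ≤ μ)
    (hε : 0 ≤ ε) (hne : (relays R x d i).Nonempty) (hi : ‖x i‖ ≤ ρ) (hd : ‖x d‖ ≤ r)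
    {good : Prop} [Decidable good]
    (hmean : good → ∀ e : Plane, ‖e‖ ≤ 1 → |hopMean R x d i (fun j => inner ℝ (x j - x i) e) -
      μ * R * (inner ℝ (x d - x i) e / dist (x i) (x d))| ≤ ε * R) :
    hopMean R x d i (fun j => excess r (x j)) ≤ excess r (x i) +
      R * (4 * ρ ^ 3 * ε + 11 * ρ ^ 2 * R + if good then 0 else 6 * ρ ^ 3) := by
  have hρ : 0 < ρ := hR.trans_le hRρ
  set P := max 0 (‖x i‖ ^ 2 - r ^ 2) with hP
  have hP0 : 0 ≤ P := le_max_left _ _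
  have hPρ : P ≤ ρ ^ 2 := by
    refine max_le (by positivity) ?_
    have : ‖x i‖ ^ 2 ≤ ρ ^ 2 := by gcongr
    nlinarith [sq_nonneg r]
  have h1 : hopMean R x d i (fun j => excess r (x j)) ≤ excess r (x i) +
      2 * P * hopMean R x d i (fun j => ‖x j‖ ^ 2 - ‖x i‖ ^ 2) + (3 * ρ * R) ^ 2 := by
    calc _ ≤ hopMean R x d i fun j => (excess r (x i) + (2 * P) * (‖x j‖ ^ 2 - ‖x i‖ ^ 2)) +
          (3 * ρ * R) ^ 2 := by
          refine hopMean_mono fun j hj => (excess_le_add r (x i) (x j)).trans ?_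
          have h2 : (‖x j‖ ^ 2 - ‖x i‖ ^ 2) ^ 2 ≤ (3 * ρ * R) ^ 2 := by
            rw [← sq_abs]
            have := abs_norm_sq_sub_le hRρ hi hj
            gcongr
          linarith
      _ = _ := by
          rw [hopMean_add, hopMean_add, hopMean_const_mul, hopMean_const hne, hopMean_const hne]
  have h2 : P * hopMean R x d i (fun j => ‖x j‖ ^ 2 - ‖x i‖ ^ 2) ≤
      ρ ^ 2 * (2 * ρ * ε * R + R ^ 2 + if good then 0 else 3 * ρ * R) := by
    split_ifs with hg
    · have h3 : hopMean R x d i (fun j => ‖x j‖ ^ 2 - ‖x i‖ ^ 2) ≤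
          2 * ρ * hopMean R x d i (fun j => inner ℝ (x j - x i) (ρ⁻¹ • x i)) + R ^ 2 := by
        calc _ ≤ hopMean R x d i fun j =>
              (2 * ρ) * inner ℝ (x j - x i) (ρ⁻¹ • x i) + R ^ 2 := by
              refine hopMean_mono fun j hj => ?_
              have h4 := dist_le_of_mem_relays hj
              rw [dist_eq_norm] at h4
              have h5 : ‖x j‖ ^ 2 = ‖x j - x i‖ ^ 2 + 2 * inner ℝ (x j - x i) (x i) +
                  ‖x i‖ ^ 2 := by
                rw [← norm_add_sq_real, sub_add_cancel]
              have h6 : ‖x j - x i‖ ^ 2 ≤ R ^ 2 := by gcongr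
              have h7 : 2 * ρ * inner ℝ (x j - x i) (ρ⁻¹ • x i) =
                  2 * inner ℝ (x j - x i) (x i) := by
                rw [inner_smul_right]; field_simp
              linarith
          _ = _ := by rw [hopMean_add, hopMean_const_mul, hopMean_const hne]
      rcases le_or_gt (‖x i‖ ^ 2 - r ^ 2) 0 with hneg | hpos
      · have : P = 0 := max_eq_left hneg
        rw [this, zero_mul]
        positivity
      · have hri : r ≤ ‖x i‖ := by
          by_contra h
          nlinarith [norm_nonneg (x i)]
        have h8 := (abs_le.1 (hmean hg (ρ⁻¹ • x i) (by
          rw [norm_smul, norm_inv, Real.norm_of_nonneg hρ.le, inv_mul_le_iff₀ hρ]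
          linarith))).2
        -- When the excess is positive, the node is further out than the destination, so the mean
        -- displacement points inwards. The route is thus kept away from the boundary, where
        -- half-disks are cut off by the area.
        have h9 : inner ℝ (x d - x i) (ρ⁻¹ • x i) / dist (x i) (x d) ≤ 0 := by
          refine div_nonpos_of_nonpos_of_nonneg ?_ dist_nonneg
          rw [inner_smul_right, inner_sub_left, real_inner_self_eq_norm_sq]
          have h10 := real_inner_le_norm (x d) (x i)
          have h11 : inner ℝ (x d) (x i) - ‖x i‖ ^ 2 ≤ 0 := by
            nlinarith [norm_nonneg (x i), norm_nonneg (x d)]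
          exact mul_nonpos_of_nonneg_of_nonpos (by positivity) h11
        have h10 : μ * R * (inner ℝ (x d - x i) (ρ⁻¹ • x i) / dist (x i) (x d)) ≤ 0 :=
          mul_nonpos_of_nonneg_of_nonpos (by positivity) h9
        have h11 : hopMean R x d i (fun j => ‖x j‖ ^ 2 - ‖x i‖ ^ 2) ≤
            2 * ρ * ε * R + R ^ 2 := by nlinarith
        calc _ ≤ P * (2 * ρ * ε * R + R ^ 2) := by gcongr
          _ ≤ ρ ^ 2 * (2 * ρ * ε * R + R ^ 2) := by gcongr
          _ = _ := by ring
    · have h3 : hopMean R x d i (fun j => ‖x j‖ ^ 2 - ‖x i‖ ^ 2) ≤ 3 * ρ * R := by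
        refine (hopMean_mono fun j hj =>
          (abs_le.1 (abs_norm_sq_sub_le hRρ hi hj)).2).trans (hopMean_const hne _).le
      calc _ ≤ P * (3 * ρ * R) := by gcongr
        _ ≤ ρ ^ 2 * (3 * ρ * R) := by gcongr
        _ ≤ _ := by
          have : 0 ≤ 2 * ρ * ε * R + R ^ 2 := by positivity
          gcongr
          linarith
  have h3 : R * (4 * ρ ^ 3 * ε + 11 * ρ ^ 2 * R + if good then 0 else 6 * ρ ^ 3) =
      2 * (ρ ^ 2 * (2 * ρ * ε * R + R ^ 2 + if good then 0 else 3 * ρ * R)) +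
        (3 * ρ * R) ^ 2 := by
    split_ifs <;> ring
  rw [h3]
  linarith

set_option maxHeartbeats 1000000 in
open scoped Classical in
/-- In a configuration with few irregular places, most routes progress nearly by `μ * R` per hop,
and few of their hops start at bad places. -/
theorem one_sub_le_routeExpect_of_regular {ρ r₁ r₂ μ ε θ A₂ A₃ Ψmax β : ℝ} {N : ℕ}
    (hR : 0 < R) (hRρ : R ≤ ρ) (hr₁ : 0 ≤ r₁) (hr₂ : r₂ ≤ ρ) (hμ : 0 ≤ μ) (hμ1 : μ ≤ 1)
    (hε : 0 < ε) (hθ : 0 < θ) (hθ1 : θ ≤ 1)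
    (hθr : ∀ y : Plane, r₂ < ‖y‖ → θ ≤ excess r₁ y)
    (hN : 2 * ρ + 1 ≤ μ * R * N) (hN' : μ * R * N ≤ 2 * ρ + 2)
    (hA₃0 : 0 ≤ A₃) (hA₂ : 4 * (4 * ρ + 2) + 6 * ρ ^ 3 ≤ A₂)
    (hA₃ : (4 * (4 * ρ + 2) + 4 * ρ ^ 3) * ε + (4 + 11 * ρ ^ 2) * R + 2 * A₂ * β ≤ A₃)
    (hs : ‖x s‖ ≤ r₁) (hd : ‖x d‖ ≤ r₁) (hr₁ρ : r₁ ≤ ρ)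
    (bad : Fin n → Prop) {Ψ : Fin n → ℝ} (hΨ0 : ∀ i, 0 ≤ Ψ i) (hΨs : Ψ s ≤ Ψmax)
    (hΨ : ∀ i, ‖x i‖ ≤ r₂ → R < dist (x i) (x d) →
      hopMean R x d i Ψ ≤ Ψ i - (if bad i then 1 else 0) + β)
    (hne : ∀ i, ‖x i‖ ≤ r₂ → R < dist (x i) (x d) → (relays R x d i).Nonempty)
    (hfar : ∀ i, ¬ bad i → R ≤ ε * dist (x i) (x d))
    (hmean : ∀ i, ‖x i‖ ≤ r₂ → R < dist (x i) (x d) → ¬ bad i → ∀ e : Plane, ‖e‖ ≤ 1 →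
      |hopMean R x d i (fun j => inner ℝ (x j - x i) e) -
        μ * R * (inner ℝ (x d - x i) e / dist (x i) (x d))| ≤ ε * R) :
    1 - θ⁻¹ * (2 * A₂ * R * Ψmax + A₃ * (R * N)) ≤ routeExpect R x s d fun m p =>
      if (dist (x (p (Fin.last m))) (x d) + μ * R * m - dist (x s) (x d)) ^ 2 ≤ θ ∧
        A₂ * R * ((∑ k : Fin m, if bad (p k.castSucc) then 1 else 0 : ℕ) : ℝ) ≤ θ
      then 1 else 0 := by
  have hρ : 0 < ρ := hR.trans_le hRρ
  have hA₂0 : 0 ≤ A₂ := le_trans (by positivity) hA₂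
  set h := dist (x s) (x d) with hh
  have hnorm : ∀ y y' : Plane, ‖y‖ ≤ ρ → ‖y'‖ ≤ ρ → dist y y' ≤ 2 * ρ := fun y y' h1 h2 => by
    rw [dist_eq_norm]; linarith [norm_sub_le y y']
  have hh2 : h ≤ 2 * ρ := hnorm _ _ (hs.trans hr₁ρ) (hd.trans hr₁ρ)
  let c : Fin n → ℕ := fun i => if bad i then 1 else 0
  -- The first two terms measure the deviation from linear decrease and the approach to the
  -- boundary. At a bad node 2Ψ falls by 2, up to 2β, while the visit count `a` rises by 1; the net
  -- fall of 1 pays for the uncontrolled hop. The last term is the budget for the small errors of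
  -- the remaining hops.
  let W : ℕ → ℕ → Fin n → ℝ := fun k a i =>
    θ⁻¹ * ((dist (x i) (x d) + μ * R * k - h) ^ 2 + excess r₁ (x i) +
      A₂ * R * (2 * Ψ i + a) + A₃ * (R * (N - k : ℕ)))
  have hterms : ∀ (k a : ℕ) (i : Fin n), 0 ≤ A₂ * R * (2 * Ψ i + a) ∧
      0 ≤ A₃ * (R * (N - k : ℕ)) := fun k a i => by
    have := hΨ0 i
    exact ⟨by positivity, by positivity⟩
  have hge : ∀ (k a : ℕ) (i : Fin n) (t : ℝ), θ ≤ t → t ≤ (dist (x i) (x d) + μ * R * k - h) ^ 2 +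
      excess r₁ (x i) + A₂ * R * (2 * Ψ i + a) + A₃ * (R * (N - k : ℕ)) → 1 ≤ W k a i := by
    intro k a i t h1 h2
    calc (1 : ℝ) = θ⁻¹ * θ := (inv_mul_cancel₀ hθ.ne').symm
      _ ≤ _ := by
        refine mul_le_mul_of_nonneg_left (h1.trans h2) (by positivity)
  have key := one_sub_le_routeExpect (R := R) (x := x) (d := d) (s := s) W c N
    (fun m a i => (dist (x i) (x d) + μ * R * m - h) ^ 2 ≤ θ ∧ A₂ * R * (a : ℝ) ≤ θ)
    ?_ ?_ ?_ ?_
  · refine le_trans ?_ key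
    have h1 : excess r₁ (x s) = 0 := by
      unfold excess
      rw [max_eq_left, zero_pow two_ne_zero]
      have : ‖x s‖ ^ 2 ≤ r₁ ^ 2 := by gcongr
      linarith
    have h2 : W 0 0 s ≤ θ⁻¹ * (2 * A₂ * R * Ψmax + A₃ * (R * N)) := by
      refine mul_le_mul_of_nonneg_left ?_ (by positivity)
      rw [h1]
      have : A₂ * R * Ψ s ≤ A₂ * R * Ψmax := by gcongr
      simp only [Nat.cast_zero, mul_zero, add_zero, Nat.sub_zero, hh, sub_self]
      rw [zero_pow two_ne_zero]
      linarith
    linarith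
  · intro k a i
    have := hterms k a i
    have := excess_nonneg r₁ (x i)
    have := sq_nonneg (dist (x i) (x d) + μ * R * k - h)
    refine mul_nonneg (by positivity) (by linarith)
  · intro k a i _ hQ
    have h1 := hterms k a i
    have h2 := excess_nonneg r₁ (x i)
    have h3 := sq_nonneg (dist (x i) (x d) + μ * R * k - h)
    have h4 := hΨ0 i
    by_cases hq : (dist (x i) (x d) + μ * R * k - h) ^ 2 ≤ θ
    · have h5 : θ < A₂ * R * a := not_le.1 fun h5 => hQ ⟨hq, h5⟩
      refine hge k a i _ h5.le ?_
      have : 0 ≤ A₂ * R * (2 * Ψ i) := by positivity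
      linarith [h1.2]
    · refine hge k a i _ (not_le.1 hq).le ?_
      linarith [h1.1, h1.2]
  -- After `N` hops without arrival the deviation is at least 1, since μRN exceeds every possible
  -- distance by 1.
  · intro a i hi
    have h1 := hterms N a i
    have h2 := excess_nonneg r₁ (x i)
    refine hge N a i 1 hθ1 ?_
    have h3 : 1 ≤ dist (x i) (x d) + μ * R * N - h := by linarith
    nlinarith [h1.1, h1.2]
  · intro k a i hk hi hW
    -- Outside radius `r₂` the excess alone brings the potential to 1, so no step estimate is needed
    -- there.
    have hir : ‖x i‖ ≤ r₂ := by
      by_contra hout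
      have h1 := hterms k a i
      have h3 := sq_nonneg (dist (x i) (x d) + μ * R * k - h)
      have := hge k a i _ (hθr (x i) (not_le.1 hout)) (by linarith [h1.1, h1.2])
      linarith
    have hnei := hne i hir hi
    refine ⟨hnei, ?_⟩
    have hiρ := hir.trans hr₂
    set D := dist (x i) (x d) with hDdef
    have hD2 : D ≤ 2 * ρ := hnorm _ _ hiρ (hd.trans hr₁ρ)
    set b : ℝ := if bad i then 1 else 0 with hb
    have hcb : ((a + c i : ℕ) : ℝ) = a + b := by
      simp only [c, hb]; split_ifs <;> simp
    set a₀ := D + μ * R * k - h with ha₀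
    have ha₀C : |a₀| ≤ 4 * ρ + 2 := by
      have h1 : μ * R * k ≤ μ * R * N := by gcongr
      have h2 : 0 ≤ μ * R * k := by positivity
      have h3 : 0 ≤ D := dist_nonneg
      have h4 : 0 ≤ h := dist_nonneg
      rw [abs_le]; constructor <;> linarith
    have hζ : ∀ j ∈ relays R x d i, |dist (x j) (x d) - D + μ * R| ≤ 2 * R := fun j hj => by
      have h1 := abs_le.1 (abs_dist_sub_le_of_mem_relays hj (x d))
      have h2 : μ * R ≤ R := mul_le_of_le_one_left hR.le hμ1
      have h3 : 0 ≤ μ * R := by positivity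
      rw [abs_le]; constructor <;> linarith
    have hm1 : |hopMean R x d i fun j => dist (x j) (x d) - D + μ * R| ≤
        2 * ε * R + 2 * R * b := by
      by_cases hbad : bad i
      · simp only [hb, hbad, if_true, mul_one]
        have h1 : hopMean R x d i (fun j => dist (x j) (x d) - D + μ * R) ≤ 2 * R :=
          (hopMean_mono fun j hj => (abs_le.1 (hζ j hj)).2).trans (hopMean_const hnei _).le
        have h2 : -(2 * R) ≤ hopMean R x d i (fun j => dist (x j) (x d) - D + μ * R) :=
          (hopMean_const hnei _).ge.trans (hopMean_mono fun j hj => (abs_le.1 (hζ j hj)).1)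
        have : 0 ≤ 2 * ε * R := by positivity
        rw [abs_le]; constructor <;> linarith
      · simp only [hb, hbad, if_false, mul_zero, add_zero]
        exact abs_hopMean_dist_add_le hR hε hnei (hfar i hbad) (hmean i hir hi hbad)
    have hsq : hopMean R x d i (fun j => (dist (x j) (x d) + μ * R * (k + 1 : ℕ) - h) ^ 2) ≤
        a₀ ^ 2 + R * (4 * (4 * ρ + 2) * ε + 4 * (4 * ρ + 2) * b + 4 * R) := by
      calc _ ≤ hopMean R x d i fun j =>
            (2 * a₀) * (dist (x j) (x d) - D + μ * R) + (a₀ ^ 2 + (2 * R) ^ 2) := by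
            refine hopMean_mono fun j hj => ?_
            have h1 : (dist (x j) (x d) - D + μ * R) ^ 2 ≤ (2 * R) ^ 2 := by
              rw [← sq_abs]; have := hζ j hj; gcongr
            have h2 : dist (x j) (x d) + μ * R * (k + 1 : ℕ) - h =
                a₀ + (dist (x j) (x d) - D + μ * R) := by
              rw [ha₀]; push_cast; ring
            rw [h2]
            nlinarith
        _ = 2 * a₀ * (hopMean R x d i fun j => dist (x j) (x d) - D + μ * R) +
              (a₀ ^ 2 + (2 * R) ^ 2) := by
            rw [hopMean_add, hopMean_const_mul, hopMean_const hnei]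
        _ ≤ 2 * ((4 * ρ + 2) * (2 * ε * R + 2 * R * b)) + (a₀ ^ 2 + (2 * R) ^ 2) := by
            have h1 : a₀ * (hopMean R x d i fun j => dist (x j) (x d) - D + μ * R) ≤
                (4 * ρ + 2) * (2 * ε * R + 2 * R * b) := by
              refine (le_abs_self _).trans ?_
              rw [abs_mul]
              exact mul_le_mul ha₀C hm1 (abs_nonneg _) (by positivity)
            linarith
        _ = _ := by ring
    have hex := hopMean_excess_le (good := ¬ bad i) hR hRρ hr₁ hμ hε.le hnei hiρ hd
      (hmean i hir hi)
    have hexb : (if ¬ bad i then 0 else 6 * ρ ^ 3) = 6 * ρ ^ 3 * b := by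
      by_cases hbad : bad i <;> simp [hb, hbad]
    rw [hexb] at hex
    have hΨi := hΨ i hir hi
    have hNk : ((N - k : ℕ) : ℝ) = (N - (k + 1) : ℕ) + 1 := by
      have : N - k = (N - (k + 1)) + 1 := by omega
      rw [this]; push_cast; ring
    have hb0 : 0 ≤ b := by simp only [hb]; split_ifs <;> simp
    -- All terms proportional to the bad-place indicator `b` are covered by A₂Rb. The rest, of size
    -- A₃R, is exactly what one hop releases from the budget.
    have hstep : hopMean R x d i (fun j =>
        (dist (x j) (x d) + μ * R * (k + 1 : ℕ) - h) ^ 2 + excess r₁ (x j) +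
          A₂ * R * (2 * Ψ j + (a + c i : ℕ)) + A₃ * (R * (N - (k + 1) : ℕ))) ≤
        a₀ ^ 2 + excess r₁ (x i) + A₂ * R * (2 * Ψ i + a) + A₃ * (R * (N - k : ℕ)) := by
      have e1 : hopMean R x d i (fun j => A₂ * R * (2 * Ψ j + (a + c i : ℕ))) =
          A₂ * R * (2 * hopMean R x d i Ψ + (a + b)) := by
        rw [hopMean_const_mul, hopMean_add, hopMean_const_mul, hopMean_const hnei, hcb]
      rw [hopMean_add, hopMean_add, hopMean_add, e1, hopMean_const hnei, hNk]
      have h1 : A₂ * R * (2 * hopMean R x d i Ψ + (a + b)) ≤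
          A₂ * R * (2 * (Ψ i - b + β) + (a + b)) := by gcongr
      have h2 : R * ((4 * (4 * ρ + 2) + 6 * ρ ^ 3) * b) ≤ R * (A₂ * b) := by gcongr
      have h3 := mul_le_mul_of_nonneg_left hA₃ hR.le
      linarith
    have hWeq : ∀ j, W (k + 1) (a + c i) j = θ⁻¹ *
        ((dist (x j) (x d) + μ * R * (k + 1 : ℕ) - h) ^ 2 + excess r₁ (x j) +
          A₂ * R * (2 * Ψ j + (a + c i : ℕ)) + A₃ * (R * (N - (k + 1) : ℕ))) := fun j => rfl
    show hopMean R x d i (W (k + 1) (a + c i)) ≤ W k a i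
    rw [funext hWeq, hopMean_const_mul]
    exact mul_le_mul_of_nonneg_left hstep (by positivity)

end Quenched

end Network

namespace Network

/-! ### Irregular squares near a route and the notion of a nice route -/

section NiceRoutes

variable {n : ℕ} {x : Fin n → Plane} {ρ lam a ε R c δ μ : ℝ} {s d : Fin n}

/-- The grid of side `R / M` resolves sums over nodes in disks and half-disks up to a relative error
`δ`, as long as the relevant squares have a number of nodes within a factor `1 ± ε` of its mean. -/
def ResolvesDisks (c δ ε : ℝ) (M : ℕ) : Prop :=
  ∀ (n : ℕ) (x : Fin n → Plane) (R lam : ℝ) (p : Plane), 0 < R → 0 ≤ lam →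
    (∀ w, (∃ y ∈ cell (R / M) w, dist y p ≤ c * R) → RegularCell ε lam (R / M) x w) →
    |(Finset.card {j | dist (x j) p ≤ c * R} : ℝ) - lam * (Real.pi * (c * R) ^ 2)| ≤
      δ * (lam * R ^ 2) ∧
    ∀ z, p ≠ z → ∀ g : Plane → ℝ, Measurable g → (∀ y ∈ halfDisk R p z, |g y| ≤ 1) →
      (∀ y ∈ halfDisk R p z, ∀ y' ∈ halfDisk R p z, |g y - g y'| ≤ 2 * dist y y' / R) →
      |∑ j, Set.indicator (halfDisk R p z) g (x j) - lam * ∫ y in halfDisk R p z, g y| ≤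
        δ * (lam * R ^ 2)

/-- A corner of a square of the grid. -/
noncomputable def corner (a : ℝ) (w : ℤ × ℤ) : Plane := !₂[(w.1 : ℝ) * a, (w.2 : ℝ) * a]

theorem corner_mem_cell (ha : 0 < a) (w : ℤ × ℤ) : corner a w ∈ cell a w := by
  rw [corner, mem_cell_iff ha]
  constructor <;> constructor <;> simp <;> nlinarith

theorem cell_subset_area {ϱ : ℝ} {p : Plane} (ha : 0 < a) (hp : ‖p‖ + ϱ + 2 * a ≤ ρ) {w : ℤ × ℤ}
    (hw : ∃ y ∈ cell a w, dist y p ≤ ϱ) : cell a w ⊆ area ρ := by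
  obtain ⟨y, hy, hyp⟩ := hw
  intro y' hy'
  rw [area, mem_closedBall_zero_iff]
  have h1 := dist_le_of_mem_cell ha hy' hy
  have h2 := dist_triangle y' y p
  rw [dist_eq_norm] at h2
  have h3 : ‖y'‖ ≤ ‖p‖ + ‖y' - p‖ := by
    simpa using norm_add_le p (y' - p)
  linarith

theorem dist_corner_le {ϱ : ℝ} {p : Plane} (ha : 0 < a) {w : ℤ × ℤ}
    (hw : ∃ y ∈ cell a w, dist y p ≤ ϱ) : dist p (corner a w) ≤ ϱ + 2 * a := by
  obtain ⟨y, hy, hyp⟩ := hw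
  have h1 := dist_le_of_mem_cell ha hy (corner_mem_cell ha w)
  have h2 := dist_triangle p y (corner a w)
  rw [dist_comm p y] at h2
  linarith

/-- With k = 1 and windows consisting of a single square, sparsity means that there is no irregular
square at all. The coarse grid is used in this form. -/
theorem Sparse.regularCell (h : Sparse ρ lam a ε 1 0 x) {w : ℤ × ℤ} (hw : cell a w ⊆ area ρ) :
    RegularCell ε lam a x w := by
  by_contra hr
  have := h w {w} (by simp [neighbours]) (by simp) (by simpa using ⟨hw, hr⟩)
  simp at this

open scoped Classical in
/-- The squares of the grid inside the area with an irregular number of nodes. -/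
noncomputable def irregularCells (ρ ε lam a : ℝ) (x : Fin n → Plane) : Finset (ℤ × ℤ) :=
  (neighbours ⌈ρ / a⌉₊ 0).filter fun w => cell a w ⊆ area ρ ∧ ¬ RegularCell ε lam a x w

open scoped Classical in
theorem mem_irregularCells (ha : 0 < a) {w : ℤ × ℤ} : w ∈ irregularCells ρ ε lam a x ↔
    cell a w ⊆ area ρ ∧ ¬ RegularCell ε lam a x w := by
  refine Finset.mem_filter.trans (and_iff_right_iff_imp.2 ?_)
  exact fun h => mem_box_of_cell_subset ha h.1

-- Corners within `r` of the same point are within 2r ≤ V·a of each other, so all these squares lie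
-- in the window around any one of them.
open scoped Classical in
theorem Sparse.card_irregularCells_le {k V : ℕ} {r : ℝ} (ha : 0 < a) (h : Sparse ρ lam a ε k V x)
    (hr : 2 * r ≤ V * a) (p : Plane) :
    ((irregularCells ρ ε lam a x).filter fun w => dist p (corner a w) ≤ r).card ≤ k := by
  set S := (irregularCells ρ ε lam a x).filter fun w => dist p (corner a w) ≤ r with hS
  rcases S.eq_empty_or_nonempty with h0 | ⟨w, hw⟩
  · simp [h0]
  refine (h w S (fun w' hw' => ?_) hw fun w' hw' =>
    (mem_irregularCells ha).1 (Finset.mem_filter.1 hw').1).le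
  have h1 := (Finset.mem_filter.1 hw).2
  have h2 := (Finset.mem_filter.1 hw').2
  have h3 : dist (corner a w') (corner a w) ≤ V * a := by
    have := dist_triangle (corner a w') p (corner a w)
    rw [dist_comm (corner a w') p] at this
    linarith
  have key : ∀ u v : ℤ, |(u : ℝ) * a - v * a| ≤ V * a → v - V ≤ u ∧ u ≤ v + V := by
    intro u v huv
    have h4 : |((u - v : ℤ) : ℝ)| ≤ V := by
      rw [← sub_mul, abs_mul, abs_of_pos ha] at huv
      push_cast
      exact le_of_mul_le_mul_right huv ha
    have h5 : |u - v| ≤ (V : ℤ) := by exact_mod_cast h4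
    have := abs_le.1 h5
    omega
  have c0 := key w'.1 w.1 (by
    have := (abs_coord_sub_le (corner a w') (corner a w) 0).trans h3
    simpa [corner] using this)
  have c1 := key w'.2 w.2 (by
    have := (abs_coord_sub_le (corner a w') (corner a w) 1).trans h3
    simpa [corner] using this)
  rw [neighbours, Finset.mem_product, Finset.mem_Icc, Finset.mem_Icc]
  exact ⟨c0, c1⟩

/-- The number of nodes within distance `c * R` of the node `j` is close to its mean. -/
def RegularCount (δ lam c R : ℝ) (x : Fin n → Plane) (j : Fin n) : Prop :=
  |(Finset.card {k | dist (x k) (x j) ≤ c * R} : ℝ) - lam * (Real.pi * (c * R) ^ 2)| ≤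
    δ * (lam * R ^ 2)

open scoped Classical in
/-- The average progress of a route is close to `μ * R`, the route is long, and most of its
receivers have a regular number of nodes in their interference disk. -/
def NiceRoute (μ δ lam c R : ℝ) (x : Fin n → Plane) (d : Fin n) (m : ℕ)
    (p : Fin (m + 1) → Fin n) : Prop :=
  |hopAverage p (fun i j => progress x d i j) - μ * R| ≤ δ * R ∧ 1 ≤ δ * m ∧
    ((∑ k : Fin m, if RegularCount δ lam c R x (p k.succ) then 0 else 1 : ℕ) : ℝ) ≤ δ * m

-- The receiver of a hop is the sender of the next one. Only the last receiver is not a sender, and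
-- it accounts for the 1.
open scoped Classical in
theorem sum_irregular_receivers_le {m : ℕ} (p : Fin (m + 1) → Fin n) {bad : Fin n → Prop}
    (hbad : ∀ j, ¬ bad j → RegularCount δ lam c R x j) :
    (∑ k : Fin m, if RegularCount δ lam c R x (p k.succ) then 0 else 1 : ℕ) ≤
      (∑ k : Fin m, if bad (p k.castSucc) then 1 else 0 : ℕ) + 1 := by
  have h1 : (∑ k : Fin m, if RegularCount δ lam c R x (p k.succ) then 0 else 1 : ℕ) ≤
      ∑ k : Fin m, if bad (p k.succ) then 1 else 0 := by
    refine Finset.sum_le_sum fun k _ => ?_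
    by_cases hb : bad (p k.succ)
    · simp only [hb, if_true]; split_ifs <;> simp
    · simp [hbad _ hb]
  have h2 := Fin.sum_univ_succ fun k : Fin (m + 1) => if bad (p k) then 1 else 0
  have h3 := Fin.sum_univ_castSucc fun k : Fin (m + 1) => if bad (p k) then 1 else 0
  have h4 : (if bad (p (Fin.last m)) then 1 else 0) ≤ 1 := by split_ifs <;> simp
  omega

-- At the end of the route the remaining distance is at most `R`, so a small deviation forces μRm to
-- be at least η/2. The route is therefore long, and dividing the deviation and the number of bad
-- visits by `m` yields the relative errors.
open scoped Classical in
theorem niceRoute_of_deviation_le {m : ℕ} {p : Fin (m + 1) → Fin n} {η θ A : ℝ}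
    {bad : Fin n → Prop} (hR : 0 < R) (hδ : 0 < δ) (hμ1 : μ ≤ 1)
    (hη : 0 < η) (hθ1 : θ ≤ (δ * η / 2) ^ 2) (hθ2 : θ ≤ (η / 4) ^ 2) (hA : 1 ≤ A)
    (hθ3 : θ ≤ δ * η / 4) (hRη : R ≤ η / 4) (hRδ : 4 * R ≤ δ * η)
    (hp : IsRoute R x s d m p) (hsd : η ≤ dist (x s) (x d))
    (hbad : ∀ j, ¬ bad j → RegularCount δ lam c R x j)
    (hdev : (dist (x (p (Fin.last m))) (x d) + μ * R * m - dist (x s) (x d)) ^ 2 ≤ θ)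
    (hcount : A * R * ((∑ k : Fin m, if bad (p k.castSucc) then 1 else 0 : ℕ) : ℝ) ≤ θ) :
    NiceRoute μ δ lam c R x d m p := by
  set h := dist (x s) (x d)
  set D := dist (x (p (Fin.last m))) (x d) with hD
  have hD0 : 0 ≤ D := dist_nonneg
  have hDR : D ≤ R := hp.2.2
  have e1 : |D + μ * R * m - h| ≤ δ * η / 2 := abs_le_of_sq_le_sq (hdev.trans hθ1) (by positivity)
  have e2 : |D + μ * R * m - h| ≤ η / 4 := abs_le_of_sq_le_sq (hdev.trans hθ2) (by positivity)
  have hm : η / 2 ≤ μ * (R * m) := by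
    have := (abs_le.1 e2).1
    linarith
  have hm' : η / 2 ≤ R * m := hm.trans (mul_le_of_le_one_left (by positivity) hμ1)
  have hm0 : (0 : ℝ) < m := by
    by_contra hm0
    have : (m : ℝ) = 0 := le_antisymm (not_lt.1 hm0) (Nat.cast_nonneg m)
    rw [this, mul_zero] at hm'
    linarith
  have hlong : 2 * R ≤ R * (δ * m) := by
    have : δ * (η / 2) ≤ δ * (R * m) := by gcongr
    linarith
  have hlong' : 2 ≤ δ * m := by
    rw [mul_comm] at hlong
    exact le_of_mul_le_mul_left hlong hR
  refine ⟨?_, by linarith, ?_⟩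
  · have e3 : hopAverage p (fun i j => progress x d i j) - μ * R = -(D + μ * R * m - h) / m := by
      rw [hopAverage, sum_progress, hp.1, ← hD]
      field_simp
      ring
    rw [e3, abs_div, abs_neg, abs_of_pos hm0, div_le_iff₀ hm0]
    have : δ * (η / 2) ≤ δ * (R * m) := by gcongr
    linarith
  · have e3 : ((∑ k : Fin m, if RegularCount δ lam c R x (p k.succ) then 0 else 1 : ℕ) : ℝ) ≤
        ((∑ k : Fin m, if bad (p k.castSucc) then 1 else 0 : ℕ) : ℝ) + 1 := by
      exact_mod_cast sum_irregular_receivers_le p hbad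
    set b : ℝ := ((∑ k : Fin m, if bad (p k.castSucc) then 1 else 0 : ℕ) : ℝ)
    have hb : 0 ≤ b := Nat.cast_nonneg _
    have e4 : R * b ≤ R * (δ * m / 2) := by
      have h1 : 1 * (R * b) ≤ A * (R * b) := by gcongr
      have h2 : δ * (η / 2) ≤ δ * (R * m) := by gcongr
      nlinarith
    have := le_of_mul_le_mul_left e4 hR
    linarith

end NiceRoutes

end Network

namespace Network

/-! ### Choice of constants: nice routes in sparse configurations -/

section Quenched

theorem eventually_mul_le (K : ℝ) {b : ℝ} (hb : 0 < b) : ∀ᶠ R in 𝓝[>] (0 : ℝ), K * R ≤ b := by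
  have h : Tendsto (fun R : ℝ => K * R) (𝓝[>] 0) (𝓝 0) := by
    have : Tendsto (fun R : ℝ => K * R) (𝓝 0) (𝓝 (K * 0)) := tendsto_id.const_mul K
    rw [mul_zero] at this
    exact this.mono_left nhdsWithin_le_nhds
  exact (h.eventually (gt_mem_nhds hb)).mono fun R hR => hR.le

/-- The gap between the radius ρ - η of allowed endpoints and the radius ρ - η/2 beyond which the
route counts as lost. -/
theorem le_excess {ρ η : ℝ} (hη : 0 < η) (hηρ : η ≤ ρ) {y : Plane} (hy : ρ - η / 2 < ‖y‖) :
    (η * ρ / 4) ^ 2 ≤ excess (ρ - η) y := by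
  unfold excess
  have h1 : (ρ - η / 2) ^ 2 ≤ ‖y‖ ^ 2 := by
    have : 0 ≤ ρ - η / 2 := by linarith
    gcongr
  have h2 : η * ρ / 4 ≤ ‖y‖ ^ 2 - (ρ - η) ^ 2 := by nlinarith
  have h3 : 0 ≤ η * ρ / 4 := by
    have : 0 < ρ := hη.trans_le hηρ
    positivity
  gcongr
  exact h2.trans (le_max_right _ _)

theorem four_div_pi_bounds : 1 / 3 ≤ 4 / (3 * Real.pi) ∧ 4 / (3 * Real.pi) ≤ 1 := by
  have := Real.pi_gt_three
  have := Real.pi_le_four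
  constructor
  · rw [le_div_iff₀ (by positivity)]; linarith
  · rw [div_le_iff₀ (by positivity)]; linarith

set_option maxHeartbeats 1000000 in
open scoped Classical in
/-- For a configuration with sparse irregular squares, most routes are nice. -/
theorem one_sub_le_routeExpect_niceRoute {ε₀ : ℝ} {M₀ : ℕ} (hM₀ : 1 ≤ M₀)
    (hgrid₀ : ResolvesDisks 1 (1 / 100) ε₀ M₀) {ρ c η δ : ℝ} (hc : 1 ≤ c) (hη : 0 < η)
    (hηρ : η ≤ ρ) (hδ : 0 < δ) :
    ∃ ε : ℝ, 0 < ε ∧ ε ≤ 1 ∧ ∃ M : ℕ, 1 ≤ M ∧ ∀ k : ℕ, ∃ (V : ℕ) (v : ℝ),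
      ∀ᶠ R in 𝓝[>] (0 : ℝ), ∀ (lam : ℝ) (n : ℕ) (x : Fin n → Plane) (s d : Fin n),
        0 ≤ lam → v ≤ lam * R ^ 2 → Sparse ρ lam (R / M₀) ε₀ 1 0 x →
        Sparse ρ lam (R / M) ε k V x → ‖x s‖ ≤ ρ - η → ‖x d‖ ≤ ρ - η → η ≤ dist (x s) (x d) →
        1 - δ ≤ routeExpect R x s d fun m p =>
          if NiceRoute (4 / (3 * Real.pi)) δ lam c R x d m p then 1 else 0 := by
  obtain ⟨hμ3, hμ1⟩ := four_div_pi_bounds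
  set μ := 4 / (3 * Real.pi) with hμ
  have hμ0 : 0 < μ := by linarith
  have hρ : 0 < ρ := hη.trans_le hηρ
  set θ := min (min ((δ * η / 2) ^ 2) ((η / 4) ^ 2)) (min (δ * η / 4) (min 1 ((η * ρ / 4) ^ 2)))
    with hθdef
  have hθ : 0 < θ := by simp only [hθdef, lt_min_iff]; refine ⟨⟨?_, ?_⟩, ?_, ?_, ?_⟩ <;> positivity
  obtain ⟨⟨hθa, hθb⟩, hθc, hθd, hθe⟩ : ((θ ≤ (δ * η / 2) ^ 2) ∧ (θ ≤ (η / 4) ^ 2)) ∧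
      (θ ≤ δ * η / 4) ∧ θ ≤ 1 ∧ θ ≤ (η * ρ / 4) ^ 2 := by
    simpa only [le_min_iff] using hθdef.le
  set A₂ := 4 * (4 * ρ + 2) + 6 * ρ ^ 3 with hA₂
  have hA₂1 : 1 ≤ A₂ := by have : 0 < ρ ^ 3 := by positivity
                           linarith
  -- As RN ≤ 3(2ρ + 2), the whole budget A₃RN is at most θδ/2. The other half of θδ covers the
  -- initial value of the bad-place potential for small `R`.
  set A₃ := θ * δ / (6 * (2 * ρ + 2)) with hA₃
  have hA₃0 : 0 < A₃ := by positivity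
  set ε' := A₃ / (3 * (4 * (4 * ρ + 2) + 4 * ρ ^ 3)) with hε'
  have hε'0 : 0 < ε' := by positivity
  -- The accuracy of the fine grid: ε'/2 for the mean displacement, 1/100 for
  -- `drift_of_sum_estimates`, `δ` for the counts at receivers.
  set δ' := min (min (ε' / 2) (1 / 100)) δ with hδ'def
  have hδ' : 0 < δ' := by simp only [hδ'def, lt_min_iff]; refine ⟨⟨?_, ?_⟩, ?_⟩ <;> positivity
  obtain ⟨⟨hδ'a, hδ'b⟩, hδ'c⟩ : (δ' ≤ ε' / 2 ∧ δ' ≤ 1 / 100) ∧ δ' ≤ δ := by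
    simpa only [le_min_iff] using hδ'def.le
  obtain ⟨ε, hε, hε1, M, hM, hgrid⟩ := exists_grid hc hδ'
  refine ⟨ε, hε, hε1, M, hM, fun k => ?_⟩
  -- An irregular square which meets the disk of radius cR has its corner within cR + 2R of the
  -- centre.
  set C := c + 2 with hC
  set L := 1 / ε' with hL
  set B := k * Real.exp ((C + 1) / 20) * (800 * Real.exp (C / 20)) with hB
  have hB0 : 0 ≤ B := by positivity
  -- `B` depends on `k` but not on `T`, so a wide cutoff makes the spurious increase B/T of the
  -- potential small. The window size `V` is chosen after `T`; hence `k` comes before `V` in the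
  -- statement.
  set T := 2 * C + 6 * A₂ * B / A₃ with hT
  have hC0 : 0 < C := by linarith
  have hT2 : 2 * C ≤ T := by
    have : 0 ≤ 6 * A₂ * B / A₃ := by positivity
    linarith
  have hT0 : 0 < T := by linarith
  have hβ : 2 * A₂ * (B / T) ≤ A₃ / 3 := by
    have h1 : 6 * A₂ * B / A₃ ≤ T := by linarith
    rw [div_le_iff₀ hA₃0] at h1
    rw [← mul_div_assoc, div_le_iff₀ hT0]
    linarith
  set Ψmax := B + 400 * Real.exp ((2 * L + 1) / 20) with hΨmax
  refine ⟨⌈2 * (T + 1) * M⌉₊, 1 / δ', ?_⟩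
  filter_upwards [self_mem_nhdsWithin, eventually_mul_le C (by positivity : 0 < η / 2),
    eventually_mul_le (4 + 11 * ρ ^ 2) (by positivity : 0 < A₃ / 3),
    eventually_mul_le 4 (by positivity : 0 < δ * η), eventually_mul_le 1 one_pos,
    eventually_mul_le (2 * A₂ * Ψmax) (by positivity : 0 < θ * δ / 2)]
    with R hR hR1 hR2 hR3 hR4 hR5 lam n x s d hlam hv hS₀ hS hs hd hsd
  replace hR : 0 < R := hR
  have hCR : 3 * R ≤ C * R := by
    have : 3 ≤ C := by linarith
    gcongr
  have hRη : R ≤ η / 6 := by linarith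
  have hM' : (1 : ℝ) ≤ M := by exact_mod_cast hM
  have hM₀' : (1 : ℝ) ≤ M₀ := by exact_mod_cast hM₀
  have ha : 0 < R / M := by positivity
  have ha₀ : 0 < R / M₀ := by positivity
  have haR : R / M ≤ R := div_le_self hR.le hM'
  have ha₀R : R / M₀ ≤ R := div_le_self hR.le hM₀'
  have hv' : 1 ≤ δ' * (lam * R ^ 2) := by
    rw [div_le_iff₀ hδ'] at hv
    linarith
  have hv0 : 0 ≤ lam * R ^ 2 := by positivity
  set r₂ := ρ - η / 2 with hr₂
  set I := irregularCells ρ ε lam (R / M) x with hI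
  set near : Fin n → Prop := fun i =>
    (∃ w ∈ I, dist (x i) (corner (R / M) w) ≤ C * R) ∨ dist (x i) (x d) ≤ L * R with hnear
  -- Nodes beyond `r₂` are included because disks around them may leave the area, where squares are
  -- not controlled. A receiver of a nice route may lie there.
  set bad : Fin n → Prop := fun i => near i ∨ r₂ < ‖x i‖ with hbaddef
  -- The coarse grid supplies the crude drift even at bad places, which is what makes the potential
  -- work there.
  have hdrift₀ : ∀ i, ‖x i‖ ≤ r₂ → R < dist (x i) (x d) → (relays R x d i).Nonempty ∧
      hopMean R x d i (fun j => dist (x j) (x d) - dist (x i) (x d)) ≤ -(R / 10) := by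
    intro i hi hid
    have h1 := hgrid₀ n x R lam (x i) hR hlam fun w hw => hS₀.regularCell
      (cell_subset_area ha₀ (by linarith) hw)
    have h2 := drift_of_sum_estimates (by norm_num : (0 : ℝ) < 1 / 100) le_rfl hR
      (hv'.trans (by gcongr))
      hid (h1.2 (x d) (dist_pos.1 (hR.trans hid)))
    exact ⟨h2.1, h2.2.2⟩
  have hgood : ∀ i, ¬ bad i → |(Finset.card {j | dist (x j) (x i) ≤ c * R} : ℝ) -
      lam * (Real.pi * (c * R) ^ 2)| ≤ δ' * (lam * R ^ 2) ∧
      ∀ z, x i ≠ z → ∀ g : Plane → ℝ, Measurable g → (∀ y ∈ halfDisk R (x i) z, |g y| ≤ 1) →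
        (∀ y ∈ halfDisk R (x i) z, ∀ y' ∈ halfDisk R (x i) z, |g y - g y'| ≤ 2 * dist y y' / R) →
        |∑ j, Set.indicator (halfDisk R (x i) z) g (x j) - lam * ∫ y in halfDisk R (x i) z, g y| ≤
          δ' * (lam * R ^ 2) := by
    intro i hi
    simp only [hbaddef, hnear, not_or, not_exists, not_and, not_le, not_lt] at hi
    refine hgrid n x R lam (x i) hR hlam fun w hw => ?_
    by_contra hreg
    have h1 := cell_subset_area (ρ := ρ) ha (by linarith) hw
    have h2 := hi.1.1 w ((mem_irregularCells ha).2 ⟨h1, hreg⟩)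
    have h3 := dist_corner_le ha hw
    linarith
  obtain ⟨Ψ, hΨ0, hΨle, hΨ⟩ := exists_potential (d := d) hR I (corner (R / M)) (L := L) (k := k) hC0 hT2
    (fun i => by
      have hV : 2 * ((T + 1) * R) ≤ (⌈2 * (T + 1) * M⌉₊ : ℝ) * (R / M) := by
        have h1 := Nat.le_ceil (2 * (T + 1) * M)
        calc 2 * ((T + 1) * R) = (2 * (T + 1) * M) * (R / M) := by field_simp
          _ ≤ _ := by gcongr
      have := hS.card_irregularCells_le ha hV (x i)
      exact_mod_cast this)
    (U := {i | ‖x i‖ ≤ r₂ ∧ R < dist (x i) (x d)})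
    (fun i hi => (hdrift₀ i hi.1 hi.2).1) (fun i hi => (hdrift₀ i hi.1 hi.2).2)
  have hμR : 0 < μ * R := by positivity
  obtain ⟨N, hN, hN'⟩ : ∃ N : ℕ, 2 * ρ + 1 ≤ μ * R * N ∧ μ * R * N ≤ 2 * ρ + 2 := by
    refine ⟨⌈(2 * ρ + 1) / (μ * R)⌉₊, ?_, ?_⟩
    · rw [mul_comm (μ * R), ← div_le_iff₀ hμR]
      exact Nat.le_ceil _
    · have h1 := (Nat.ceil_lt_add_one (by positivity : 0 ≤ (2 * ρ + 1) / (μ * R))).le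
      have h2 : μ * R ≤ 1 := mul_le_one₀ hμ1 hR.le (by linarith)
      calc _ ≤ μ * R * ((2 * ρ + 1) / (μ * R) + 1) := by gcongr
        _ = 2 * ρ + 1 + μ * R := by field_simp
        _ ≤ _ := by linarith
  have key := one_sub_le_routeExpect_of_regular (x := x) (s := s) (d := d) (ρ := ρ) (r₁ := ρ - η)
    (r₂ := r₂) (μ := μ) (ε := ε') (θ := θ) (A₂ := A₂) (A₃ := A₃) (Ψmax := Ψmax) (β := B / T)
    (N := N) hR (by linarith) (by linarith) (by linarith) hμ0.le hμ1 hε'0 hθ hθd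
    (fun y hy => hθe.trans (le_excess hη hηρ hy)) hN hN' hA₃0.le le_rfl
    (by
      have h1 : (4 * (4 * ρ + 2) + 4 * ρ ^ 3) * ε' = A₃ / 3 := by rw [hε']; field_simp
      linarith)
    hs hd (by linarith) bad hΨ0 (hΨle s)
    (fun i hi hid => by
      have h1 := hΨ i ⟨hi, hid⟩
      have h2 : bad i ↔ near i := by simp [hbaddef, hi]
      simp only [h2]
      exact h1)
    (fun i hi hid => (hdrift₀ i hi hid).1)
    (fun i hi => by
      simp only [hbaddef, hnear, not_or, not_le] at hi
      have h1 := hi.1.2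
      rw [hL, div_mul_eq_mul_div, one_mul, div_lt_iff₀ hε'0] at h1
      linarith)
    (fun i hi hid hb e he => by
      have h1 := (drift_of_sum_estimates hδ' hδ'b hR hv' hid
        ((hgood i hb).2 (x d) (dist_pos.1 (hR.trans hid)))).2.1 e he
      refine h1.trans ?_
      gcongr
      linarith)
  have hfin : θ⁻¹ * (2 * A₂ * R * Ψmax + A₃ * (R * N)) ≤ δ := by
    rw [inv_mul_le_iff₀ hθ]
    have h1 : R * N ≤ 3 * (2 * ρ + 2) := by
      have : 1 / 3 * (R * N) ≤ μ * (R * N) := by gcongr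
      linarith
    have h2 : A₃ * (R * N) ≤ A₃ * (3 * (2 * ρ + 2)) := by gcongr
    have h3 : A₃ * (3 * (2 * ρ + 2)) = θ * δ / 2 := by rw [hA₃]; field_simp; ring
    linarith
  refine le_trans (by linarith) (key.trans (routeExpect_mono (B := 1) ?_ ?_ ?_))
  · intro m p _ _; dsimp only; split_ifs <;> simp
  · intro m p _ _; dsimp only; split_ifs <;> simp
  · intro m p hp _
    split_ifs with h1 h2 h2
    · exact le_rfl
    · refine absurd (niceRoute_of_deviation_le hR hδ hμ1 hη hθa hθb hA₂1 hθc (by linarith) hR3 hp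
        hsd (fun j hj => ?_) h1.1 h1.2) h2
      exact (hgood j hj).1.trans (by gcongr)
    · exact zero_le_one
    · exact le_rfl

end Quenched

end Network

namespace Network

/-! ### Most packets of the Poisson network have nice routes -/

section NicePackets

/-- The packets with a nice route. -/
def NicePacket (δ lam c R : ℝ) : (n : ℕ) → (Fin n → Plane) → (s d : Fin n) → (m : ℕ) →
    (Fin (m + 1) → Fin n) → Prop :=
  fun _ x _ d m p => NiceRoute (4 / (3 * Real.pi)) δ lam c R x d m p

theorem measurable_card_ball {n : ℕ} (r : ℝ) (j : Fin n) :
    Measurable fun x : Fin n → Plane => (Finset.card {k | dist (x k) (x j) ≤ r} : ℝ) := by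
  have : (fun x : Fin n → Plane => (Finset.card {k | dist (x k) (x j) ≤ r} : ℝ)) =
      fun x => ∑ k, if dist (x k) (x j) ≤ r then (1 : ℝ) else 0 := by
    funext x; simp
  rw [this]
  exact Finset.measurable_sum _ fun k _ => Measurable.ite (measurableSet_le (by fun_prop)
    measurable_const) measurable_const measurable_const

theorem measurableSet_regularCount {n : ℕ} (δ lam c R : ℝ) (j : Fin n) :
    MeasurableSet {x : Fin n → Plane | RegularCount δ lam c R x j} :=
  measurableSet_le (((measurable_card_ball _ j).sub_const _).abs) measurable_const

theorem measurable_hopAverage {n m : ℕ} {g : (Fin n → Plane) → Fin n → Fin n → ℝ}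
    (hg : ∀ i j, Measurable fun x => g x i j) (p : Fin (m + 1) → Fin n) :
    Measurable fun x => hopAverage p (g x) :=
  (Finset.measurable_sum _ fun _ _ => hg _ _).div_const _

theorem measurable_progress {n : ℕ} (d i j : Fin n) :
    Measurable fun x : Fin n → Plane => progress x d i j := by
  unfold progress
  fun_prop

theorem measurableSet_nicePacket (δ lam c R : ℝ) (n : ℕ) (s d : Fin n) (m : ℕ)
    (p : Fin (m + 1) → Fin n) : MeasurableSet {x | NicePacket δ lam c R n x s d m p} := by
  classical
  refine measurableSet_setOfPred.2 ?_
  unfold NicePacket NiceRoute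
  refine Measurable.and (measurableSet_setOfPred.1 (measurableSet_le
    ((measurable_hopAverage (fun i j => measurable_progress d i j) p).sub_const _).abs
    measurable_const)) (Measurable.and measurable_const ?_)
  refine measurableSet_setOfPred.1 (measurableSet_le ?_ measurable_const)
  refine (measurable_of_countable (fun k : ℕ => (k : ℝ))).comp ?_
  exact Finset.measurable_sum _ fun k _ => Measurable.ite (measurableSet_regularCount _ _ _ _ _)
    measurable_const measurable_const

-- Every packet of a configuration outside `E` contributes at least 1 - δ unless its endpoints are
-- unsuitable. Inside `E` up to `n` packets are given away.
open scoped Classical in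
theorem le_packetSum {δ lam c R r η : ℝ} (hδ : 0 ≤ δ) (hδ1 : δ ≤ 1) {n : ℕ} {x : Fin n → Plane}
    {E : Prop}
    (h : ¬ E → ∀ s d, ‖x s‖ ≤ r → ‖x d‖ ≤ r → η < dist (x s) (x d) → 1 - δ ≤
      routeExpect R x s d (indicatorFunctional (NicePacket δ lam c R) n x s d)) :
    (1 - δ) * n + (-1) + (-1) * (∑ s : Fin n, destExpect s fun d =>
      if ‖x s‖ ≤ r ∧ ‖x d‖ ≤ r ∧ η < dist (x s) (x d) then 0 else 1) +
      (-1) * (if E then (n : ℝ) else 0) ≤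
      packetSum R (indicatorFunctional (NicePacket δ lam c R)) n x := by
  have hreg := regularFunctional_indicator (R := R) (measurableSet_nicePacket δ lam c R)
  have h0 : ∀ s d, 0 ≤ routeExpect R x s d (indicatorFunctional (NicePacket δ lam c R) n x s d) := by
    intro s d
    have h1 := routeExpect_mono (R := R) (x := x) (s := s) (d := d) (B := 1)
      (f := fun _ _ => 0 * 1) (g := indicatorFunctional (NicePacket δ lam c R) n x s d)
      (fun _ _ _ _ => by simp) (hreg.bound n x s d) fun m p _ _ => by
        unfold indicatorFunctional; split_ifs <;> simp
    rwa [routeExpect_const_mul, zero_mul] at h1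
  set P := ∑ s : Fin n, destExpect s fun d =>
      if ‖x s‖ ≤ r ∧ ‖x d‖ ≤ r ∧ η < dist (x s) (x d) then (0 : ℝ) else 1 with hP
  have hP0 : 0 ≤ P := Finset.sum_nonneg fun s _ => by
    have : (0 : ℝ) ≤ n - 1 := by
      have : (1 : ℝ) ≤ n := by exact_mod_cast s.pos
      linarith
    refine div_nonneg (Finset.sum_nonneg fun d _ => by split_ifs <;> simp) this
  by_cases hE : E
  · have h2 : 0 ≤ packetSum R (indicatorFunctional (NicePacket δ lam c R)) n x :=
      Finset.sum_nonneg fun s _ => by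
        have h3 := destExpect_mono (s := s) (f := fun _ => 0 * 1) fun d _ => by
          simpa using h0 s d
        rwa [destExpect_const_mul, zero_mul] at h3
    rw [if_pos hE]
    have : 0 ≤ δ * n := by positivity
    linarith
  · rw [if_neg hE]
    have h1 : ∀ s : Fin n, (1 - δ) * destExpect s (fun _ : Fin n => (1 : ℝ)) +
        (-1) * destExpect s (fun d =>
          if ‖x s‖ ≤ r ∧ ‖x d‖ ≤ r ∧ η < dist (x s) (x d) then (0 : ℝ) else 1) ≤
        destExpect s fun d =>
          routeExpect R x s d (indicatorFunctional (NicePacket δ lam c R) n x s d) := by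
      intro s
      rw [← destExpect_const_mul, ← destExpect_const_mul, ← destExpect_add]
      refine destExpect_mono fun d _ => ?_
      split_ifs with hsd
      · simpa using h hE s d hsd.1 hsd.2.1 hsd.2.2
      · have := h0 s d
        linarith
    have h2 : (n : ℝ) - 1 ≤ ∑ s : Fin n, destExpect s (fun _ : Fin n => (1 : ℝ)) := by
      rcases lt_or_ge n 2 with hn | hn
      · have h3 : 0 ≤ ∑ s : Fin n, destExpect s (fun _ : Fin n => (1 : ℝ)) :=
          Finset.sum_nonneg fun s _ => by
            have h4 := destExpect_mono (s := s) (f := fun _ => (0 : ℝ) * 1)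
              (g := fun _ => (1 : ℝ)) fun d _ => by simp
            rwa [destExpect_const_mul, zero_mul] at h4
        have : (n : ℝ) ≤ 1 := by exact_mod_cast Nat.lt_succ_iff.1 hn
        linarith
      · simp [destExpect_const hn]
    have h3 := Finset.sum_le_sum fun s (_ : s ∈ Finset.univ) => h1 s
    rw [Finset.sum_add_distrib, ← Finset.mul_sum, ← Finset.mul_sum] at h3
    have h4 : (1 - δ) * ((n : ℝ) - 1) ≤
        (1 - δ) * ∑ s : Fin n, destExpect s (fun _ : Fin n => (1 : ℝ)) := by
      have : 0 ≤ 1 - δ := by linarith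
      gcongr
    unfold packetSum
    linarith

-- Averages `le_packetSum`. The exceptional event must be weighted by the number of packets it
-- spoils, and the parameter `K` trades its probability against the tail of the Poisson count.
open scoped Classical in
theorem le_typicalExpect_nicePacket {ρ δ lam c R r η K : ℝ} (hρ : 0 < ρ)
    (hlam : 2 ≤ lam * volume.real (area ρ)) (hδ : 0 ≤ δ) (hδ1 : δ ≤ 1) (hr : 0 ≤ r) (hrρ : r ≤ ρ)
    (hη : 0 ≤ η) (hK : 0 ≤ K) {E : (n : ℕ) → (Fin n → Plane) → Prop}
    (hE : ∀ n, MeasurableSet {x | E n x})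
    (h : ∀ n x, ¬ E n x → ∀ s d, ‖x s‖ ≤ r → ‖x d‖ ≤ r → η < dist (x s) (x d) → 1 - δ ≤
      routeExpect R x s d (indicatorFunctional (NicePacket δ lam c R) n x s d)) :
    1 - δ - 1 / (lam * volume.real (area ρ)) - (2 * (1 - r ^ 2 / ρ ^ 2) + η ^ 2 / ρ ^ 2) -
      (K * networkExpect ρ lam (fun n x => if E n x then 1 else 0) + Real.exp (4 - K)) ≤
    typicalExpect ρ lam R (indicatorFunctional (NicePacket δ lam c R)) := by
  set V := lam * volume.real (area ρ) with hV
  have hV0 : 0 < V := by linarith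
  have hlam0 : 0 ≤ lam := by
    by_contra h0
    have : lam * volume.real (area ρ) ≤ 0 :=
      mul_nonpos_of_nonpos_of_nonneg (not_le.1 h0).le measureReal_nonneg
    linarith
  have hEa : Admissible fun n x => if E n x then (n : ℝ) else 0 :=
    Admissible.of_abs_le (B := 1) (fun n => Measurable.ite (hE n) measurable_const
      measurable_const) zero_le_one fun n x => by split_ifs <;> simp
  have hca : Admissible fun (_ : ℕ) _ => (-1 : ℝ) :=
    Admissible.of_abs_le_const (fun n => measurable_const) zero_le_one fun n x => by simp
  have hn := admissible_card.const_mul (1 - δ)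
  have hp := (admissible_pairs r η).const_mul (-1)
  have h1 := networkExpect_mono (lam := lam) hρ (((hn.add hca).add hp).add (hEa.const_mul (-1)))
    ((regularFunctional_indicator (R := R) (measurableSet_nicePacket δ lam c R)).admissible
      zero_le_one) fun n x => le_packetSum hδ hδ1 (h n x)
  rw [networkExpect_add hρ ((hn.add hca).add hp) (hEa.const_mul (-1)),
    networkExpect_add hρ (hn.add hca) hp, networkExpect_add hρ hn hca, networkExpect_const_mul,
    networkExpect_const_mul, networkExpect_const_mul, networkExpect_card hρ hlam0,
    networkExpect_const hρ] at h1
  have h2 := networkExpect_pairs_le (lam := lam) hρ hlam0 hr hrρ hη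
  have h3 := networkExpect_card_mul_indicator_le hρ hlam hE hK
  rw [typicalExpect_eq, le_div_iff₀ hV0]
  have e : 1 / V * V = 1 := by field_simp
  rw [← hV] at h1 h2 h3
  linarith

theorem tendsto_mul_sq_atTop {K₀ : ℝ} (hK₀ : 0 < K₀) {R : ℝ → ℝ}
    (hR : ∀ᶠ lam in atTop, K₀ * √(Real.log lam / lam) ≤ R lam) :
    Tendsto (fun lam => lam * R lam ^ 2) atTop atTop := by
  refine tendsto_atTop_mono' _ ?_ (Real.tendsto_log_atTop.const_mul_atTop (by positivity :
    0 < K₀ ^ 2))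
  filter_upwards [hR, eventually_ge_atTop 1] with lam h1 h2
  have h3 : (K₀ * √(Real.log lam / lam)) ^ 2 ≤ R lam ^ 2 := by gcongr
  rw [mul_pow, Real.sq_sqrt (div_nonneg (Real.log_nonneg h2) (by linarith))] at h3
  calc K₀ ^ 2 * Real.log lam = lam * (K₀ ^ 2 * (Real.log lam / lam)) := by field_simp
    _ ≤ _ := by gcongr

/-- The routes of most packets are nice. -/
theorem eventually_le_typicalExpect_nicePacket :
    ∃ K₀ : ℝ, 0 < K₀ ∧ ∀ (ρ c : ℝ) (R : ℝ → ℝ), 0 < ρ → 1 ≤ c →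
      (∀ᶠ lam in atTop, K₀ * √(Real.log lam / lam) ≤ R lam) → Tendsto R atTop (𝓝[>] 0) →
      ∀ δ > 0, δ ≤ 1 → ∀ᶠ lam in atTop, 1 - 5 * δ ≤
        typicalExpect ρ lam (R lam) (indicatorFunctional (NicePacket δ lam c (R lam))) := by
  classical
  obtain ⟨ε₀, hε₀, hε₀1, M₀, hM₀, hgrid₀⟩ := exists_grid (c := 1) le_rfl
    (by norm_num : (0 : ℝ) < 1 / 100)
  have hM₀' : (0 : ℝ) < M₀ := by exact_mod_cast hM₀
  -- Then K₀²ε₀² = 9M₀² ≥ 8M₀², so k = 1 is admissible in `tendsto_not_sparse` for the coarse grid.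
  -- Only the fixed coarse grid enters, which makes K₀ universal; the fine grid takes a large `k`
  -- instead.
  set K₀ := 3 * M₀ / ε₀ with hK₀def
  have hK₀ : 0 < K₀ := by positivity
  refine ⟨K₀, hK₀, fun ρ c R hρ hc hR hR0 δ hδ hδ1 => ?_⟩
  -- Pairs near the boundary or close to each other then make up a fraction 4δ/5 - (δ/5)² ≤ δ.
  set η := δ * ρ / 5 with hη
  have hη0 : 0 < η := by positivity
  have hηρ : η ≤ ρ := by nlinarith
  obtain ⟨ε, hε, hε1, M, hM, hroute⟩ := one_sub_le_routeExpect_niceRoute hM₀ hgrid₀ hc hη0 hηρ hδ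
  obtain ⟨k, hk⟩ := exists_nat_gt (8 * (M : ℝ) ^ 2 / (ε ^ 2 * K₀ ^ 2))
  obtain ⟨V, v, hroute⟩ := hroute k
  have hk' : 8 * (M : ℝ) ^ 2 ≤ k * ε ^ 2 * K₀ ^ 2 := by
    rw [div_lt_iff₀ (by positivity)] at hk
    linarith
  have hS₀ := tendsto_not_sparse hρ hε₀.le hε₀1 hK₀ hR hM₀ (k := 1) (by
    have : K₀ * ε₀ = 3 * M₀ := by rw [hK₀def]; field_simp
    have : K₀ ^ 2 * ε₀ ^ 2 = 9 * M₀ ^ 2 := by rw [← mul_pow, this]; ring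
    have : (0 : ℝ) < (M₀ : ℝ) ^ 2 := by positivity
    push_cast
    linarith) 0
  have hS := tendsto_not_sparse hρ hε.le hε1 hK₀ hR hM hk' V
  -- The Poisson tail exp(4 - K) becomes `δ`. The five losses of `δ` are the routes, the lone
  -- packet, the pairs, and the two terms of the exceptional event.
  set K := 4 - Real.log δ with hK
  have hK0 : 0 ≤ K := by have := Real.log_nonpos hδ.le hδ1; linarith
  have hKe : Real.exp (4 - K) = δ := by rw [hK, sub_sub_cancel, Real.exp_log hδ]
  have hP : Tendsto (fun lam => K * (networkExpect ρ lam (fun _ x =>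
      if ¬ Sparse ρ lam (R lam / M₀) ε₀ 1 0 x then 1 else 0) + networkExpect ρ lam (fun _ x =>
      if ¬ Sparse ρ lam (R lam / M) ε k V x then 1 else 0))) atTop (𝓝 0) := by
    simpa using (hS₀.add hS).const_mul K
  have hvol : 0 < volume.real (area ρ) := by
    rw [volume_real_area hρ.le]; have := Real.pi_pos; positivity
  have hVol : Tendsto (fun lam => lam * volume.real (area ρ)) atTop atTop :=
    tendsto_id.atTop_mul_const hvol
  filter_upwards [hR0.eventually hroute, hR0.eventually self_mem_nhdsWithin,
    (tendsto_mul_sq_atTop hK₀ hR).eventually_ge_atTop v, hP.eventually (gt_mem_nhds hδ),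
    hVol.eventually_ge_atTop 2, hVol.eventually_ge_atTop (5 / δ), eventually_ge_atTop 0]
    with lam hrt hRpos hv hPl hV2 hVδ hlam
  obtain ⟨E, hEdef⟩ : ∃ E : (n : ℕ) → (Fin n → Plane) → Prop, E = fun _ x =>
    ¬ Sparse ρ lam (R lam / M₀) ε₀ 1 0 x ∨ ¬ Sparse ρ lam (R lam / M) ε k V x := ⟨_, rfl⟩
  have hEm : ∀ n, MeasurableSet {x | E n x} := fun n => hEdef ▸
    (measurableSet_not_sparse ρ lam (R lam / M₀) ε₀ 1 0).union
      (measurableSet_not_sparse ρ lam (R lam / M) ε k V)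
  have hadm : ∀ (E : (n : ℕ) → (Fin n → Plane) → Prop) [∀ n x, Decidable (E n x)], (∀ n, MeasurableSet {x | E n x}) →
      Admissible fun n x => if E n x then (1 : ℝ) else 0 := fun E _ hE =>
    Admissible.of_abs_le_const (fun n => Measurable.ite (hE n) measurable_const
      measurable_const) zero_le_one fun n x => by split_ifs <;> simp
  have hEP : networkExpect ρ lam (fun n x => if E n x then 1 else 0) ≤
      networkExpect ρ lam (fun _ x => if ¬ Sparse ρ lam (R lam / M₀) ε₀ 1 0 x then 1 else 0) +
      networkExpect ρ lam (fun _ x => if ¬ Sparse ρ lam (R lam / M) ε k V x then 1 else 0) := by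
    have h1 := hadm (fun n x => ¬ Sparse ρ lam (R lam / M₀) ε₀ 1 0 x) fun n =>
      measurableSet_not_sparse (n := n) ρ lam (R lam / M₀) ε₀ 1 0
    have h2 := hadm (fun n x => ¬ Sparse ρ lam (R lam / M) ε k V x) fun n =>
      measurableSet_not_sparse (n := n) ρ lam (R lam / M) ε k V
    rw [← networkExpect_add hρ h1 h2]
    refine networkExpect_mono hρ (hadm _ hEm) (h1.add h2) fun n x => ?_
    by_cases ha : Sparse ρ lam (R lam / M₀) ε₀ 1 0 x <;>
      by_cases hb : Sparse ρ lam (R lam / M) ε k V x <;> simp [hEdef, ha, hb]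
  have key := le_typicalExpect_nicePacket (c := c) (R := R lam) hρ hV2 hδ.le hδ1
    (by linarith : 0 ≤ ρ - η) (by linarith) hη0.le hK0 hEm (fun n x hx s d hs hd hsd => by
      simp only [hEdef, not_or, not_not] at hx
      exact hrt lam n x s d hlam hv hx.1 hx.2 hs hd hsd.le)
  rw [hKe] at key
  have h1 : 1 / (lam * volume.real (area ρ)) ≤ δ := by
    rw [div_le_iff₀ (by linarith)]
    rw [div_le_iff₀ hδ] at hVδ
    linarith
  have h2 : 2 * (1 - (ρ - η) ^ 2 / ρ ^ 2) + η ^ 2 / ρ ^ 2 ≤ δ := by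
    have e : 2 * (1 - (ρ - η) ^ 2 / ρ ^ 2) + η ^ 2 / ρ ^ 2 = 4 * δ / 5 - (δ / 5) ^ 2 := by
      rw [hη]; field_simp; ring
    rw [e]
    nlinarith [sq_nonneg (δ / 5)]
  have h3 : K * networkExpect ρ lam (fun n x => if E n x then 1 else 0) ≤ δ :=
    (mul_le_mul_of_nonneg_left hEP hK0).trans hPl.le
  linarith

end NicePackets

end Network

namespace Network

/-! ### Success probabilities and deterministic bounds for the functionals -/

section Functionals

variable {n : ℕ} {x : Fin n → Plane} {R q c δ lam : ℝ} {s d i j : Fin n}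

theorem alohaExpect_successInd_nonneg (hq0 : 0 ≤ q) (hq1 : q ≤ 1) (RI : ℝ) :
    0 ≤ alohaExpect q (successInd RI x i j) := by
  rw [alohaExpect_successInd]
  have : 0 ≤ 1 - q := by linarith
  positivity

theorem alohaExpect_successInd_le (hq0 : 0 ≤ q) (hq1 : q ≤ 1) (RI : ℝ) :
    alohaExpect q (successInd RI x i j) ≤ q := by
  rw [alohaExpect_successInd]
  exact mul_le_of_le_one_right hq0 (pow_le_one₀ (by linarith) (by linarith))

theorem measurable_alohaExpect_successInd (q RI : ℝ) (i j : Fin n) :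
    Measurable fun x : Fin n → Plane => alohaExpect q (successInd RI x i j) := by
  classical
  simp only [alohaExpect_successInd]
  have h : Measurable fun x : Fin n → Plane => (interferers RI x i j).card := by
    have : (fun x : Fin n → Plane => (interferers RI x i j).card) =
        fun x => ∑ k, if k ≠ i ∧ dist (x k) (x j) ≤ RI then 1 else 0 := by
      funext x
      rw [interferers, Finset.card_filter]
    rw [this]
    refine Finset.measurable_sum _ fun k _ => Measurable.ite ?_ measurable_const measurable_const
    exact measurableSet_setOfPred.2 (measurable_const.and (measurableSet_setOfPred.1
      (measurableSet_le (by fun_prop) measurable_const)))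
  exact (measurable_of_countable fun k : ℕ => q * (1 - q) ^ k).comp h

/-- The sender lies in the disk around the receiver but is not an interferer. -/
theorem card_interferers_add_one (hij : dist (x i) (x j) ≤ R) :
    (interferers R x i j).card + 1 = Finset.card {k | dist (x k) (x j) ≤ R} := by
  classical
  have : Finset.univ.filter (fun k => dist (x k) (x j) ≤ R) =
      insert i (interferers R x i j) := by
    ext k
    simp only [interferers, Finset.mem_filter, Finset.mem_univ, true_and, Finset.mem_insert]
    by_cases hk : k = i
    · simp [hk, hij]
    · simp [hk]
  rw [this, Finset.card_insert_of_notMem (by simp [interferers])]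

/-- Replacing each factor 1 - q by e^(-q) costs q², since all factors are at most 1. Replacing N by
Λ in the exponent costs q|N - Λ|, since t ↦ e^(-t) is 1-Lipschitz for t ≥ 0. -/
theorem abs_one_sub_pow_sub_exp_le (hq0 : 0 ≤ q) (hq1 : q ≤ 1) (N : ℕ) (Λ : ℝ) (hΛ : 0 ≤ Λ) :
    |(1 - q) ^ N - Real.exp (-(q * Λ))| ≤ q ^ 2 * N + q * |N - Λ| := by
  have h1 : |(1 - q) ^ N - Real.exp (-q) ^ N| ≤ q ^ 2 * N := by
    have h2 : |Real.exp (-q) - (1 - q)| ≤ q ^ 2 := by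
      have := Real.abs_exp_sub_one_sub_id_le (x := -q) (by rwa [abs_neg, abs_of_nonneg hq0])
      rw [neg_sq] at this
      convert this using 2
      ring
    have h3 : ∀ k : ℕ, |(1 - q) ^ k - Real.exp (-q) ^ k| ≤ q ^ 2 * k := by
      intro k
      induction k with
      | zero => simp
      | succ k ih =>
        have e : (1 - q) ^ (k + 1) - Real.exp (-q) ^ (k + 1) =
            (1 - q) * ((1 - q) ^ k - Real.exp (-q) ^ k) -
              (Real.exp (-q) - (1 - q)) * Real.exp (-q) ^ k := by ring
        have h4 : |(1 - q) * ((1 - q) ^ k - Real.exp (-q) ^ k)| ≤ 1 * (q ^ 2 * k) := by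
          rw [abs_mul]
          exact mul_le_mul (by rw [abs_le]; constructor <;> linarith) ih (abs_nonneg _) zero_le_one
        have h5 : |(Real.exp (-q) - (1 - q)) * Real.exp (-q) ^ k| ≤ q ^ 2 * 1 := by
          rw [abs_mul, abs_of_nonneg (by positivity : 0 ≤ Real.exp (-q) ^ k)]
          exact mul_le_mul h2 (pow_le_one₀ (Real.exp_pos _).le (Real.exp_le_one_iff.2 (by linarith)))
            (by positivity) (by positivity)
        rw [e]
        push_cast
        linarith [abs_sub ((1 - q) * ((1 - q) ^ k - Real.exp (-q) ^ k))
          ((Real.exp (-q) - (1 - q)) * Real.exp (-q) ^ k)]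
    exact h3 N
  have h2 : |Real.exp (-q) ^ N - Real.exp (-(q * Λ))| ≤ q * |N - Λ| := by
    rw [← Real.exp_nat_mul]
    have key : ∀ a b : ℝ, a ≤ b → |Real.exp (-b) - Real.exp (-a)| ≤ |b - a| ∨ a < 0 := by
      intro a b hab
      rcases lt_or_ge a 0 with ha | ha
      · exact Or.inr ha
      left
      have h3 : Real.exp (-b) = Real.exp (-a) * Real.exp (-(b - a)) := by
        rw [← Real.exp_add]; congr 1; ring
      have h4 := Real.add_one_le_exp (-(b - a))
      have h5 : Real.exp (-a) ≤ 1 := Real.exp_le_one_iff.2 (by linarith)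
      have h6 : Real.exp (-(b - a)) ≤ 1 := Real.exp_le_one_iff.2 (by linarith)
      have h7 := Real.exp_pos (-a)
      rw [abs_of_nonneg (by linarith : 0 ≤ b - a), abs_sub_comm, abs_of_nonneg, h3]
      · nlinarith
      · rw [h3]; nlinarith
    have e : q * |N - Λ| = |q * N - q * Λ| := by rw [← mul_sub, abs_mul, abs_of_nonneg hq0]
    rw [e, show (N : ℝ) * -q = -(q * N) by ring]
    have hN0 : 0 ≤ q * N := by positivity
    have hΛ0 : 0 ≤ q * Λ := by positivity
    rcases le_total (q * Λ) (q * N) with h | h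
    · exact (key _ _ h).resolve_right (not_lt.2 hΛ0)
    · rw [abs_sub_comm, abs_sub_comm (q * N)]
      exact (key _ _ h).resolve_right (not_lt.2 hN0)
  exact (abs_sub_le _ _ _).trans (add_le_add h1 h2)

/-- The probability that nobody transmits in an interference disk with a regular number of nodes. -/
theorem abs_success_sub_le (hq0 : 0 ≤ q) (hq1 : q ≤ 1) (hc : 1 ≤ c) (hR : 0 ≤ R) (hlam : 0 ≤ lam)
    (hδ1 : δ ≤ 1) (hij : dist (x i) (x j) ≤ R) (hreg : RegularCount δ lam c R x j) :
    |alohaExpect q (successInd (c * R) x i j) -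
      q * Real.exp (-(lam * q * Real.pi * (c * R) ^ 2))| ≤
    q * (q ^ 2 * ((Real.pi * c ^ 2 + 1) * (lam * R ^ 2)) + q * (δ * (lam * R ^ 2) + 1)) := by
  have hcard := card_interferers_add_one (hij.trans (le_mul_of_one_le_left hR hc))
  rw [RegularCount, ← hcard] at hreg
  push_cast at hreg
  set N := (interferers (c * R) x i j).card
  set Λ := lam * (Real.pi * (c * R) ^ 2) with hΛ
  have hpi := Real.pi_pos
  have hΛ0 : 0 ≤ Λ := by positivity
  have hv : 0 ≤ lam * R ^ 2 := by positivity
  have hreg' := abs_le.1 hreg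
  have h1 := abs_one_sub_pow_sub_exp_le hq0 hq1 N Λ hΛ0
  have h2 : (N : ℝ) ≤ (Real.pi * c ^ 2 + 1) * (lam * R ^ 2) := by
    have : Λ = Real.pi * c ^ 2 * (lam * R ^ 2) := by rw [hΛ]; ring
    nlinarith
  have h3 : |(N : ℝ) - Λ| ≤ δ * (lam * R ^ 2) + 1 := by
    rw [abs_le]; constructor <;> linarith
  rw [alohaExpect_successInd, ← mul_sub, abs_mul, abs_of_nonneg hq0]
  have e : -(lam * q * Real.pi * (c * R) ^ 2) = -(q * Λ) := by rw [hΛ]; ring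
  rw [e]
  refine mul_le_mul_of_nonneg_left (h1.trans ?_) hq0
  gcongr

-- A large error `E` is tolerable on a fraction `δ` of the hops.
open scoped Classical in
theorem abs_hopAverage_le_of_irregular {m : ℕ} {p : Fin (m + 1) → Fin n} {g : Fin n → Fin n → ℝ}
    {P : Fin n → Prop} {e E : ℝ} (hE : 0 ≤ E) (hm : 0 < m)
    (h1 : ∀ k : Fin m, P (p k.succ) → |g (p k.castSucc) (p k.succ)| ≤ e)
    (h2 : ∀ k : Fin m, |g (p k.castSucc) (p k.succ)| ≤ e + E)
    (hP : ((∑ k : Fin m, if P (p k.succ) then 0 else 1 : ℕ) : ℝ) ≤ δ * m) :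
    |hopAverage p g| ≤ e + E * δ := by
  have hm' : (0 : ℝ) < m := by exact_mod_cast hm
  rw [hopAverage, abs_div, abs_of_pos hm', div_le_iff₀ hm']
  calc _ ≤ ∑ k : Fin m, (e + E * ((if P (p k.succ) then 0 else 1 : ℕ) : ℝ)) := by
        refine (Finset.abs_sum_le_sum_abs _ _).trans (Finset.sum_le_sum fun k _ => ?_)
        split_ifs with hk
        · simpa using h1 k hk
        · simpa using h2 k
    _ = e * m + E * ((∑ k : Fin m, if P (p k.succ) then 0 else 1 : ℕ) : ℝ) := by
        rw [Finset.sum_add_distrib, ← Finset.mul_sum]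
        push_cast
        simp [mul_comm]
    _ ≤ e * m + E * (δ * m) := by gcongr
    _ = _ := by ring

theorem NiceRoute.pos {μ : ℝ} {m : ℕ} {p : Fin (m + 1) → Fin n}
    (h : NiceRoute μ δ lam c R x d m p) : 0 < m := by
  rcases Nat.eq_zero_or_pos m with rfl | hm
  · have := h.2.1
    norm_num at this
  · exact hm

theorem regularFunctional_progress (hR : 0 ≤ R) : RegularFunctional R R
    fun _ x _ d _ p => hopAverage p fun i j => progress x d i j :=
  ⟨fun _ _ d _ p => measurable_hopAverage (fun i j => measurable_progress d i j) p,
    fun _ _ _ _ _ _ _ hp => abs_hopAverage_le hR fun k =>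
      abs_progress_le (dist_le_of_mem_relays (mem_relays_of_pathWeight_ne_zero hp k))⟩

/-- The progress telescopes, so h/ν and the average progress differ only by the final distance, at
most `R`, divided by the number of hops. -/
theorem dist_div_sub_hopAverage {m : ℕ} {p : Fin (m + 1) → Fin n} (hp : IsRoute R x s d m p) :
    dist (x s) (x d) / m - hopAverage p (fun i j => progress x d i j) =
      dist (x (p (Fin.last m))) (x d) / m := by
  rw [hopAverage, sum_progress, hp.1]
  ring

/-- One `R` bounds the average progress and the other the final distance per hop. Routes without
hops give 0, as division by zero does. -/
theorem regularFunctional_distPerHop (hR : 0 ≤ R) : RegularFunctional R (2 * R)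
    fun _ x s d m _ => dist (x s) (x d) / m := by
  refine ⟨fun _ _ _ _ _ => by fun_prop, fun n x s d m p hp h0 => ?_⟩
  have h1 := (regularFunctional_progress hR).bound n x s d m p hp h0
  have h2 := dist_div_sub_hopAverage hp
  rcases Nat.eq_zero_or_pos m with rfl | hm
  · simpa using hR
  have h3 : dist (x (p (Fin.last m))) (x d) / m ≤ R := by
    have : (1 : ℝ) ≤ m := by exact_mod_cast hm
    exact (div_le_self dist_nonneg this).trans hp.2.2
  have h4 : 0 ≤ dist (x (p (Fin.last m))) (x d) / m := by positivity
  rw [abs_le] at h1 ⊢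
  constructor <;> linarith

theorem regularFunctional_success (hq0 : 0 ≤ q) (hq1 : q ≤ 1) (RI : ℝ) : RegularFunctional R q
    fun _ x _ _ _ p => hopAverage p fun i j => alohaExpect q fun ω => successInd RI x i j ω := by
  refine ⟨fun _ _ _ _ p => measurable_hopAverage
    (fun i j => measurable_alohaExpect_successInd q RI i j) p,
    fun _ x _ _ _ p _ _ => abs_hopAverage_le hq0 fun k => ?_⟩
  exact (abs_of_nonneg (alohaExpect_successInd_nonneg hq0 hq1 RI)).trans_le
    (alohaExpect_successInd_le hq0 hq1 RI)

/-- The bound Rq has the order of the main term, so packets without a nice route contribute only a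
relative error of order `δ`. -/
theorem regularFunctional_throughput (hR : 0 ≤ R) (hq0 : 0 ≤ q) (hq1 : q ≤ 1) (RI : ℝ) :
    RegularFunctional R (R * q) fun _ x _ d _ p => hopAverage p fun i j =>
      alohaExpect q fun ω => progress x d i j * successInd RI x i j ω := by
  refine ⟨fun n _ d _ p => ?_, fun _ x _ d _ p _ hp => abs_hopAverage_le (by positivity)
    fun k => ?_⟩
  · simp only [alohaExpect_const_mul]
    exact measurable_hopAverage (fun i j => (measurable_progress d i j).mul
      (measurable_alohaExpect_successInd q RI i j)) p
  · rw [alohaExpect_const_mul, abs_mul]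
    refine mul_le_mul (abs_progress_le (dist_le_of_mem_relays
      (mem_relays_of_pathWeight_ne_zero hp k))) ?_ (abs_nonneg _) hR
    exact (abs_of_nonneg (alohaExpect_successInd_nonneg hq0 hq1 RI)).trans_le
      (alohaExpect_successInd_le hq0 hq1 RI)

end Functionals

end Network

namespace Network

/-! ### Quantitative estimates for the means over packets -/

section Estimates

variable {ρ lam R q c δ G : ℝ}

/-- Packets that are not nice have mass at most 5δ. They cost 5δB in the functional and again 5δB in
the constant `a`. -/
theorem abs_typicalExpect_sub_const_le {B e a : ℝ} {f : PacketFunctional} (hρ : 0 < ρ)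
    (hlam : 0 < lam) (he : 0 ≤ e) (hB : 0 ≤ B) (hf : RegularFunctional R B f) (ha : |a| ≤ B)
    (hT : 1 - 5 * δ ≤ typicalExpect ρ lam R (indicatorFunctional (NicePacket δ lam c R)))
    (h : ∀ n x s d m p, IsRoute R x s d m p → pathWeight R x d p ≠ 0 →
      NicePacket δ lam c R n x s d m p → |f n x s d m p - a| ≤ e) :
    |typicalExpect ρ lam R f - a| ≤ e + 10 * δ * B := by
  have hQ := measurableSet_nicePacket δ lam c R
  have h1 := abs_typicalExpect_sub_le hρ hlam he hB hf hQ h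
  have h2 := typicalExpect_indicator_le_one (R := R) hρ hlam hQ
  set T := typicalExpect ρ lam R (indicatorFunctional (NicePacket δ lam c R))
  have h3 : |a * T - a| ≤ B * (1 - T) := by
    rw [show a * T - a = -(a * (1 - T)) by ring, abs_neg, abs_mul,
      abs_of_nonneg (by linarith : 0 ≤ 1 - T)]
    gcongr
  have h4 : B * (1 - T) ≤ B * (5 * δ) := by gcongr; linarith
  have h5 : e * T ≤ e * 1 := by gcongr
  have h6 := abs_sub_le (typicalExpect ρ lam R f) (a * T) a
  linarith

theorem abs_meanProgress_sub_le (hρ : 0 < ρ) (hlam : 0 < lam) (hR : 0 ≤ R) (hδ : 0 ≤ δ)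
    (hT : 1 - 5 * δ ≤ typicalExpect ρ lam R (indicatorFunctional (NicePacket δ lam c R))) :
    |meanProgress ρ lam R - 4 / (3 * Real.pi) * R| ≤ 11 * δ * R := by
  obtain ⟨hμ3, hμ1⟩ := four_div_pi_bounds
  have h1 := abs_typicalExpect_sub_const_le (a := 4 / (3 * Real.pi) * R) hρ hlam
    (by positivity : 0 ≤ δ * R) hR (regularFunctional_progress hR)
    (by rw [abs_of_nonneg (by positivity)]; exact mul_le_of_le_one_left hR hμ1) hT
    fun n x s d m p _ _ hnice => hnice.1
  refine h1.trans (le_of_eq (by ring))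

theorem abs_meanDistancePerHop_sub_le (hρ : 0 < ρ) (hlam : 0 < lam) (hR : 0 ≤ R) (hδ : 0 ≤ δ)
    (hT : 1 - 5 * δ ≤ typicalExpect ρ lam R (indicatorFunctional (NicePacket δ lam c R))) :
    |meanDistancePerHop ρ lam R - 4 / (3 * Real.pi) * R| ≤ 22 * δ * R := by
  obtain ⟨hμ3, hμ1⟩ := four_div_pi_bounds
  have h1 := abs_typicalExpect_sub_const_le (a := 4 / (3 * Real.pi) * R) hρ hlam
    (by positivity : 0 ≤ 2 * δ * R) (by positivity) (regularFunctional_distPerHop hR)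
    (by
      rw [abs_of_nonneg (by positivity)]
      have := mul_le_of_le_one_left hR hμ1
      linarith) hT
    fun n x s d m p hp _ hnice => by
      have h2 := dist_div_sub_hopAverage hp
      have hm : (0 : ℝ) < m := by exact_mod_cast hnice.pos
      have h3 : dist (x (p (Fin.last m))) (x d) / m ≤ δ * R := by
        rw [div_le_iff₀ hm]
        calc dist (x (p (Fin.last m))) (x d) ≤ R * 1 := by simpa using hp.2.2
          _ ≤ R * (δ * m) := by have := hnice.2.1; gcongr
          _ = _ := by ring
      have h4 : 0 ≤ dist (x (p (Fin.last m))) (x d) / m := by positivity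
      have h5 := abs_le.1 hnice.1
      rw [abs_le]
      constructor <;> linarith
  refine h1.trans (le_of_eq (by ring))

/-- Each summand contains the bounded quantity qλR², or just `q`, together with a small factor `q`
or `δ`. -/
theorem interference_error_le (hlam : 0 ≤ lam) (hq0 : 0 ≤ q) (hδ : 0 ≤ δ)
    (hqδ : q ≤ δ) (hG : q * (lam * R ^ 2) ≤ G) :
    q ^ 2 * ((Real.pi * c ^ 2 + 1) * (lam * R ^ 2)) + q * (δ * (lam * R ^ 2) + 1) ≤
      δ * (1 + G * (Real.pi * c ^ 2 + 2)) := by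
  have hpi := Real.pi_pos
  have h1 : q * (q * (lam * R ^ 2)) ≤ δ * G := by
    have : 0 ≤ q * (lam * R ^ 2) := by positivity
    gcongr
  have h2 : δ * (q * (lam * R ^ 2)) ≤ δ * G := by gcongr
  have h3 : (Real.pi * c ^ 2 + 1) * (q * (q * (lam * R ^ 2))) ≤
      (Real.pi * c ^ 2 + 1) * (δ * G) := by gcongr
  linarith

theorem abs_success_sub_le_self {n : ℕ} {x : Fin n → Plane} {i j : Fin n} {S : ℝ} (hq0 : 0 ≤ q)
    (hq1 : q ≤ 1) (hS0 : 0 ≤ S) (hS1 : S ≤ 1) (RI : ℝ) :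
    |alohaExpect q (successInd RI x i j) - q * S| ≤ q := by
  have h1 := alohaExpect_successInd_nonneg (x := x) (i := i) (j := j) hq0 hq1 RI
  have h2 := alohaExpect_successInd_le (x := x) (i := i) (j := j) hq0 hq1 RI
  have h3 := mul_le_of_le_one_right hq0 hS1
  have h4 := mul_nonneg hq0 hS0
  rw [abs_le]
  constructor <;> linarith

theorem abs_successProb_sub_le (hρ : 0 < ρ) (hlam : 0 < lam) (hR : 0 ≤ R) (hc : 1 ≤ c)
    (hδ : 0 ≤ δ) (hδ1 : δ ≤ 1) (hq0 : 0 ≤ q) (hq1 : q ≤ 1) (hqδ : q ≤ δ) (hG : q * (lam * R ^ 2) ≤ G)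
    (hT : 1 - 5 * δ ≤ typicalExpect ρ lam R (indicatorFunctional (NicePacket δ lam c R))) :
    |successProb ρ lam R (c * R) q - q * Real.exp (-(lam * q * Real.pi * (c * R) ^ 2))| ≤
      (G * (Real.pi * c ^ 2 + 2) + 20) * δ * q := by
  classical
  set S := Real.exp (-(lam * q * Real.pi * (c * R) ^ 2)) with hS
  have hpi := Real.pi_pos
  have hS0 : 0 ≤ S := (Real.exp_pos _).le
  have hS1 : S ≤ 1 := Real.exp_le_one_iff.2 (neg_nonpos.2 (by positivity))
  have hG0 : 0 ≤ G := le_trans (by positivity) hG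
  have herr := interference_error_le (c := c) hlam.le hq0 hδ hqδ hG
  set K := δ * (1 + G * (Real.pi * c ^ 2 + 2)) with hK
  have hK0 : 0 ≤ K := by positivity
  have h1 := abs_typicalExpect_sub_const_le (a := q * S) hρ hlam
    (by positivity : 0 ≤ q * K + q * δ) hq0 (regularFunctional_success hq0 hq1 (c * R))
    (by rw [abs_of_nonneg (by positivity)]; exact mul_le_of_le_one_right hq0 hS1) hT
    fun n x s d m p hp h0 hnice => by
      have hm : (0 : ℝ) < m := by exact_mod_cast hnice.pos
      have e : hopAverage p (fun i j => alohaExpect q fun ω => successInd (c * R) x i j ω) - q * S =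
          hopAverage p fun i j => alohaExpect q (successInd (c * R) x i j) - q * S := by
        simp only [hopAverage, Finset.sum_sub_distrib, Finset.sum_const, Finset.card_univ,
          Fintype.card_fin, nsmul_eq_mul]
        field_simp
      rw [e]
      refine abs_hopAverage_le_of_irregular (P := RegularCount δ lam c R x) hq0 hnice.pos
        (fun k hk => ?_) (fun k => ?_) hnice.2.2
      · have hij := dist_le_of_mem_relays (mem_relays_of_pathWeight_ne_zero h0 k)
        rw [dist_comm] at hij
        exact (abs_success_sub_le hq0 hq1 hc hR hlam.le hδ1 hij hk).trans
          (mul_le_mul_of_nonneg_left herr hq0)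
      · refine (abs_success_sub_le_self hq0 hq1 hS0 hS1 _).trans ?_
        have : 0 ≤ q * K := by positivity
        linarith
  refine h1.trans ?_
  have : 0 ≤ δ * q := by positivity
  rw [hK]
  nlinarith

theorem abs_throughput_sub_le (hρ : 0 < ρ) (hlam : 0 < lam) (hR : 0 ≤ R) (hc : 1 ≤ c)
    (hδ : 0 ≤ δ) (hδ1 : δ ≤ 1) (hq0 : 0 ≤ q) (hq1 : q ≤ 1) (hqδ : q ≤ δ) (hG : q * (lam * R ^ 2) ≤ G)
    (hT : 1 - 5 * δ ≤ typicalExpect ρ lam R (indicatorFunctional (NicePacket δ lam c R))) :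
    |spatialThroughput ρ lam R (c * R) q - lam * volume.real (area ρ) *
      (4 / (3 * Real.pi) * R * (q * Real.exp (-(lam * q * Real.pi * (c * R) ^ 2))))| ≤
      lam * volume.real (area ρ) * ((G * (Real.pi * c ^ 2 + 2) + 20) * δ * (R * q)) := by
  classical
  obtain ⟨hμ3, hμ1⟩ := four_div_pi_bounds
  set μ := 4 / (3 * Real.pi) with hμ
  set S := Real.exp (-(lam * q * Real.pi * (c * R) ^ 2)) with hS
  have hpi := Real.pi_pos
  have hS0 : 0 ≤ S := (Real.exp_pos _).le
  have hS1 : S ≤ 1 := Real.exp_le_one_iff.2 (neg_nonpos.2 (by positivity))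
  have hG0 : 0 ≤ G := le_trans (by positivity) hG
  have herr := interference_error_le (c := c) hlam.le hq0 hδ hqδ hG
  set K := δ * (1 + G * (Real.pi * c ^ 2 + 2)) with hK
  have hK0 : 0 ≤ K := by positivity
  have hqS : 0 ≤ q * S := by positivity
  have hqS1 : q * S ≤ q := mul_le_of_le_one_right hq0 hS1
  have hμR : 0 ≤ μ * R := by positivity
  have hμR1 : μ * R ≤ R := mul_le_of_le_one_left hR hμ1
  have h1 := abs_typicalExpect_sub_const_le (a := μ * R * (q * S)) hρ hlam
    (by positivity : 0 ≤ R * (q * K) + R * q * δ + q * (δ * R)) (by positivity)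
    (regularFunctional_throughput hR hq0 hq1 (c * R))
    (by rw [abs_of_nonneg (by positivity)]; gcongr) hT
    fun n x s d m p hp h0 hnice => by
      -- The decoupling of progress and success: given the nodes, the success probability of a hop
      -- is compared with the constant qS, and the remaining factor is the average progress. No
      -- independence of the two is used.
      have e : hopAverage p (fun i j => alohaExpect q fun ω =>
            progress x d i j * successInd (c * R) x i j ω) - μ * R * (q * S) =
          hopAverage p (fun i j => progress x d i j *
            (alohaExpect q (successInd (c * R) x i j) - q * S)) +
          q * S * (hopAverage p (fun i j => progress x d i j) - μ * R) := by
        simp only [alohaExpect_const_mul, hopAverage, mul_sub, Finset.sum_sub_distrib,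
          ← Finset.sum_mul]
        ring
      have hprog : ∀ k : Fin m, |progress x d (p k.castSucc) (p k.succ)| ≤ R := fun k =>
        abs_progress_le (dist_le_of_mem_relays (mem_relays_of_pathWeight_ne_zero h0 k))
      have h2 : |hopAverage p (fun i j => progress x d i j *
            (alohaExpect q (successInd (c * R) x i j) - q * S))| ≤
          R * (q * K) + R * q * δ := by
        refine abs_hopAverage_le_of_irregular (P := RegularCount δ lam c R x) (by positivity)
          hnice.pos (fun k hk => ?_) (fun k => ?_) hnice.2.2
        · have hij := dist_le_of_mem_relays (mem_relays_of_pathWeight_ne_zero h0 k)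
          rw [dist_comm] at hij
          rw [abs_mul]
          exact mul_le_mul (hprog k)
            ((abs_success_sub_le hq0 hq1 hc hR hlam.le hδ1 hij hk).trans
              (mul_le_mul_of_nonneg_left herr hq0)) (abs_nonneg _) hR
        · rw [abs_mul]
          have h3 := mul_le_mul (hprog k) (abs_success_sub_le_self (x := x) (i := p k.castSucc)
            (j := p k.succ) hq0 hq1 hS0 hS1 (c * R)) (abs_nonneg _) hR
          have : 0 ≤ R * (q * K) := by positivity
          linarith
      have h4 : |q * S * (hopAverage p (fun i j => progress x d i j) - μ * R)| ≤ q * (δ * R) := by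
        rw [abs_mul, abs_of_nonneg hqS]
        exact mul_le_mul hqS1 hnice.1 (abs_nonneg _) hq0
      rw [e]
      exact (abs_add_le _ _).trans (add_le_add h2 h4)
  have hV : 0 < lam * volume.real (area ρ) := by
    rw [volume_real_area hρ.le]; positivity
  have e : spatialThroughput ρ lam R (c * R) q = lam * volume.real (area ρ) *
      typicalExpect ρ lam R (fun _ x _ d _ p => hopAverage p fun i j =>
        alohaExpect q fun ω => progress x d i j * successInd (c * R) x i j ω) := by
    rw [typicalExpect, mul_div_cancel₀ _ hV.ne']
    rfl
  rw [e, ← mul_sub, abs_mul, abs_of_pos hV]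
  refine mul_le_mul_of_nonneg_left (h1.trans ?_) hV.le
  have : 0 ≤ δ * (R * q) := by positivity
  rw [hK]
  nlinarith

end Estimates

end Network

namespace Network

/-! ### Asymptotic equivalents -/

section Asymptotic

/-- The estimates have errors relative to a bare scale `w` such as `R` or `q`. It suffices that `w`
is dominated by the main term. -/
theorem isEquivalent_of_abs_sub_le {u v w : ℝ → ℝ} {K L : ℝ} (hK : 0 < K) (hL : 0 < L)
    (hw : ∀ᶠ t in atTop, w t ≤ L * |v t|)
    (h : ∀ δ > 0, δ ≤ 1 → ∀ᶠ t in atTop, |u t - v t| ≤ K * δ * w t) : u ~[atTop] v := by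
  refine isLittleO_iff.2 fun ε hε => ?_
  set δ := min 1 (ε / (K * L)) with hδ
  have hδ0 : 0 < δ := lt_min one_pos (by positivity)
  have hδε : K * L * δ ≤ ε := by
    have : δ ≤ ε / (K * L) := min_le_right _ _
    rw [le_div_iff₀ (by positivity)] at this
    linarith
  filter_upwards [hw, h δ hδ0 (min_le_left _ _)] with t h1 h2
  rw [Pi.sub_apply, Real.norm_eq_abs, Real.norm_eq_abs]
  calc _ ≤ K * δ * w t := h2
    _ ≤ K * δ * (L * |v t|) := by gcongr
    _ = K * L * δ * |v t| := by ring
    _ ≤ _ := by gcongr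

variable {ρ c G : ℝ} {R q : ℝ → ℝ}

theorem isEquivalent_meanProgress (hρ : 0 < ρ) (hR : ∀ᶠ lam in atTop, 0 < R lam)
    (hT : ∀ δ > 0, δ ≤ 1 → ∀ᶠ lam in atTop, 1 - 5 * δ ≤
      typicalExpect ρ lam (R lam) (indicatorFunctional (NicePacket δ lam c (R lam)))) :
    (fun lam => meanProgress ρ lam (R lam)) ~[atTop] fun lam => 4 / (3 * Real.pi) * R lam := by
  obtain ⟨hμ3, hμ1⟩ := four_div_pi_bounds
  refine isEquivalent_of_abs_sub_le (K := 11) (L := 3) (w := R) (by norm_num) (by norm_num) ?_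
    fun δ hδ hδ1 => ?_
  · filter_upwards [hR] with lam h1
    rw [abs_of_nonneg (by positivity)]
    nlinarith
  · filter_upwards [hR, hT δ hδ hδ1, eventually_gt_atTop 0] with lam h1 h2 h3
    exact abs_meanProgress_sub_le hρ h3 h1.le hδ.le h2

theorem isEquivalent_meanDistancePerHop (hρ : 0 < ρ) (hR : ∀ᶠ lam in atTop, 0 < R lam)
    (hT : ∀ δ > 0, δ ≤ 1 → ∀ᶠ lam in atTop, 1 - 5 * δ ≤
      typicalExpect ρ lam (R lam) (indicatorFunctional (NicePacket δ lam c (R lam)))) :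
    (fun lam => meanDistancePerHop ρ lam (R lam)) ~[atTop]
      fun lam => 4 / (3 * Real.pi) * R lam := by
  obtain ⟨hμ3, hμ1⟩ := four_div_pi_bounds
  refine isEquivalent_of_abs_sub_le (K := 22) (L := 3) (w := R) (by norm_num) (by norm_num) ?_
    fun δ hδ hδ1 => ?_
  · filter_upwards [hR] with lam h1
    rw [abs_of_nonneg (by positivity)]
    nlinarith
  · filter_upwards [hR, hT δ hδ hδ1, eventually_gt_atTop 0] with lam h1 h2 h3
    exact abs_meanDistancePerHop_sub_le hρ h3 h1.le hδ.le h2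

/-- The mean number of transmitters in an interference disk is bounded, so the exponential factor
stays away from 0 and errors of order δq remain relatively small. -/
theorem exp_interference_bounds {lam q R : ℝ} (hlam : 0 ≤ lam) (hq : 0 ≤ q)
    (hG : q * (lam * R ^ 2) ≤ G) :
    Real.exp (-(Real.pi * c ^ 2 * G)) ≤ Real.exp (-(lam * q * Real.pi * (c * R) ^ 2)) ∧
      Real.exp (-(lam * q * Real.pi * (c * R) ^ 2)) ≤ 1 := by
  have hpi := Real.pi_pos
  refine ⟨Real.exp_le_exp.2 (neg_le_neg ?_), Real.exp_le_one_iff.2 (neg_nonpos.2 (by positivity))⟩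
  calc lam * q * Real.pi * (c * R) ^ 2 = Real.pi * c ^ 2 * (q * (lam * R ^ 2)) := by ring
    _ ≤ _ := by gcongr

theorem isEquivalent_successProb (hρ : 0 < ρ) (hc : 1 ≤ c) (hG0 : 0 ≤ G)
    (hR : ∀ᶠ lam in atTop, 0 < R lam) (hq : ∀ᶠ lam in atTop, 0 ≤ q lam ∧ q lam ≤ 1)
    (hq0 : Tendsto q atTop (𝓝 0)) (hG : ∀ᶠ lam in atTop, q lam * (lam * R lam ^ 2) ≤ G)
    (hT : ∀ δ > 0, δ ≤ 1 → ∀ᶠ lam in atTop, 1 - 5 * δ ≤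
      typicalExpect ρ lam (R lam) (indicatorFunctional (NicePacket δ lam c (R lam)))) :
    (fun lam => successProb ρ lam (R lam) (c * R lam) (q lam)) ~[atTop]
      fun lam => q lam * Real.exp (-(lam * q lam * Real.pi * (c * R lam) ^ 2)) := by
  have hpi := Real.pi_pos
  refine isEquivalent_of_abs_sub_le (K := G * (Real.pi * c ^ 2 + 2) + 20)
    (L := Real.exp (Real.pi * c ^ 2 * G)) (w := q) (by positivity) (by positivity) ?_
    fun δ hδ hδ1 => ?_
  · filter_upwards [hq, hG, eventually_ge_atTop 0] with lam h1 h2 h3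
    rw [abs_of_nonneg (mul_nonneg h1.1 (Real.exp_pos _).le)]
    calc q lam = Real.exp (Real.pi * c ^ 2 * G) * (q lam * Real.exp (-(Real.pi * c ^ 2 * G))) := by
          rw [Real.exp_neg]; field_simp
      _ ≤ _ := by
          have := (exp_interference_bounds (c := c) h3 h1.1 h2).1
          have := h1.1
          gcongr
  · filter_upwards [hR, hT δ hδ hδ1, eventually_gt_atTop 0, hq, hG, hq0.eventually (ge_mem_nhds hδ)]
      with lam h1 h2 h3 h4 h5 h6
    exact abs_successProb_sub_le hρ h3 h1.le hc hδ.le hδ1 h4.1 h4.2 h6 h5 h2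

theorem isEquivalent_spatialThroughput (hρ : 0 < ρ) (hc : 1 ≤ c) (hG0 : 0 ≤ G)
    (hR : ∀ᶠ lam in atTop, 0 < R lam) (hq : ∀ᶠ lam in atTop, 0 ≤ q lam ∧ q lam ≤ 1)
    (hq0 : Tendsto q atTop (𝓝 0)) (hG : ∀ᶠ lam in atTop, q lam * (lam * R lam ^ 2) ≤ G)
    (hT : ∀ δ > 0, δ ≤ 1 → ∀ᶠ lam in atTop, 1 - 5 * δ ≤
      typicalExpect ρ lam (R lam) (indicatorFunctional (NicePacket δ lam c (R lam)))) :
    (fun lam => spatialThroughput ρ lam (R lam) (c * R lam) (q lam)) ~[atTop]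
      fun lam => lam * volume.real (area ρ) * (4 / (3 * Real.pi) * R lam *
        (q lam * Real.exp (-(lam * q lam * Real.pi * (c * R lam) ^ 2)))) := by
  have hpi := Real.pi_pos
  obtain ⟨hμ3, hμ1⟩ := four_div_pi_bounds
  refine isEquivalent_of_abs_sub_le (K := G * (Real.pi * c ^ 2 + 2) + 20)
    (L := 3 * Real.exp (Real.pi * c ^ 2 * G))
    (w := fun lam => lam * volume.real (area ρ) * (R lam * q lam)) (by positivity)
    (by positivity) ?_ fun δ hδ hδ1 => ?_
  · filter_upwards [hq, hG, eventually_ge_atTop 0, hR] with lam h1 h2 h3 h4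
    have hA : 0 ≤ volume.real (area ρ) := measureReal_nonneg
    have h5 := h1.1
    rw [abs_of_nonneg (by positivity)]
    calc lam * volume.real (area ρ) * (R lam * q lam) =
          3 * Real.exp (Real.pi * c ^ 2 * G) * (lam * volume.real (area ρ) *
            (1 / 3 * R lam * (q lam * Real.exp (-(Real.pi * c ^ 2 * G))))) := by
          rw [Real.exp_neg]; field_simp
      _ ≤ _ := by
          have := (exp_interference_bounds (c := c) h3 h1.1 h2).1
          gcongr
  · filter_upwards [hR, hT δ hδ hδ1, eventually_gt_atTop 0, hq, hG, hq0.eventually (ge_mem_nhds hδ)]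
      with lam h1 h2 h3 h4 h5 h6
    refine (abs_throughput_sub_le hρ h3 h1.le hc hδ.le hδ1 h4.1 h4.2 h6 h5 h2).trans
      (le_of_eq (by ring))

/-- The throughput is of the order of `lam * q * R`. -/
theorem isTheta_spatialThroughput (hρ : 0 < ρ) (hc : 1 ≤ c) (hG0 : 0 ≤ G)
    (hR : ∀ᶠ lam in atTop, 0 < R lam) (hq : ∀ᶠ lam in atTop, 0 ≤ q lam ∧ q lam ≤ 1)
    (hq0 : Tendsto q atTop (𝓝 0)) (hG : ∀ᶠ lam in atTop, q lam * (lam * R lam ^ 2) ≤ G)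
    (hT : ∀ δ > 0, δ ≤ 1 → ∀ᶠ lam in atTop, 1 - 5 * δ ≤
      typicalExpect ρ lam (R lam) (indicatorFunctional (NicePacket δ lam c (R lam)))) :
    (fun lam => spatialThroughput ρ lam (R lam) (c * R lam) (q lam)) =Θ[atTop]
      fun lam => lam * q lam * R lam := by
  refine (isEquivalent_spatialThroughput hρ hc hG0 hR hq hq0 hG hT).isTheta.trans ?_
  have hA : 0 < volume.real (area ρ) := by
    rw [volume_real_area hρ.le]; have := Real.pi_pos; positivity
  have hpi := Real.pi_pos
  have hS : (fun lam => Real.exp (-(lam * q lam * Real.pi * (c * R lam) ^ 2))) =Θ[atTop]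
      fun _ => (1 : ℝ) := by
    refine ⟨IsBigO.of_bound 1 ?_, IsBigO.of_bound (Real.exp (Real.pi * c ^ 2 * G)) ?_⟩
    · filter_upwards [hq, hG, eventually_ge_atTop 0] with lam h1 h2 h3
      have := (exp_interference_bounds (c := c) h3 h1.1 h2).2
      simpa using this
    · filter_upwards [hq, hG, eventually_ge_atTop 0] with lam h1 h2 h3
      have h4 := (exp_interference_bounds (c := c) h3 h1.1 h2).1
      rw [Real.norm_of_nonneg (Real.exp_pos _).le, norm_one]
      calc (1 : ℝ) = Real.exp (Real.pi * c ^ 2 * G) * Real.exp (-(Real.pi * c ^ 2 * G)) := by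
            rw [← Real.exp_add, add_neg_cancel, Real.exp_zero]
        _ ≤ _ := by gcongr
  have h1 : (fun lam => lam * q lam * R lam *
      Real.exp (-(lam * q lam * Real.pi * (c * R lam) ^ 2))) =Θ[atTop]
      fun lam => lam * q lam * R lam * 1 :=
    (isTheta_refl _ _).mul hS
  have h2 := (isTheta_const_mul_left (c := volume.real (area ρ) * (4 / (3 * Real.pi)))
    (by positivity)).2 h1
  simp only [mul_one] at h2
  refine (EventuallyEq.of_eq ?_).trans_isTheta h2
  funext lam
  ring

end Asymptotic

/-! ### Scaling of the range and the transmission probability -/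

section Scaling

theorem tendsto_sqrt_log_div : Tendsto (fun lam : ℝ => √(Real.log lam / lam)) atTop (𝓝 0) := by
  have h : Tendsto (fun lam : ℝ => Real.log lam / lam) atTop (𝓝 0) :=
    Real.isLittleO_log_id_atTop.tendsto_div_nhds_zero
  have h' := (Real.continuous_sqrt.tendsto 0).comp h
  rwa [Real.sqrt_zero] at h'

theorem sqrt_log_div_pos {lam : ℝ} (h : 1 < lam) : 0 < √(Real.log lam / lam) :=
  Real.sqrt_pos.2 (div_pos (Real.log_pos h) (by linarith))

theorem mul_sqrt_log_div {lam : ℝ} (h : 1 < lam) :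
    lam * (1 / Real.log lam) * √(Real.log lam / lam) = √(lam / Real.log lam) := by
  have h1 := Real.log_pos h
  have h2 : 0 < lam := by linarith
  rw [Real.sqrt_div h1.le, Real.sqrt_div h2.le]
  have h3 := Real.sqrt_pos.2 h1
  have h4 := Real.sqrt_pos.2 h2
  have h5 := Real.sq_sqrt h1.le
  have h6 := Real.sq_sqrt h2.le
  field_simp
  rw [h5, h6, mul_comm]

theorem one_div_sqrt_log_div {lam : ℝ} : 1 / √(Real.log lam / lam) = √(lam / Real.log lam) := by
  rw [one_div, ← Real.sqrt_inv, inv_div]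

variable {R q : ℝ → ℝ}

/-- The bounds multiply to λ · (log λ/λ) / log λ = 1. This is the only place where the upper bounds
on range and transmission probability act jointly. -/
theorem exists_mul_sq_le (hR : R =O[atTop] fun lam => √(Real.log lam / lam))
    (hq : q =O[atTop] fun lam => 1 / Real.log lam) :
    ∃ G, 0 ≤ G ∧ ∀ᶠ lam in atTop, q lam * (lam * R lam ^ 2) ≤ G := by
  have h1 : (fun lam => q lam * (lam * R lam ^ 2)) =O[atTop] fun _ => (1 : ℝ) := by
    have h2 := hq.mul ((isBigO_refl (fun lam : ℝ => lam) atTop).mul (hR.pow 2))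
    refine h2.trans_eventuallyEq ?_
    filter_upwards [eventually_gt_atTop 1] with lam h3
    have h4 := Real.log_pos h3
    rw [Real.sq_sqrt (by positivity)]
    field_simp
  obtain ⟨G, hG, h2⟩ := h1.exists_nonneg
  refine ⟨G, hG, ?_⟩
  filter_upwards [h2.bound] with lam h3
  have := (le_abs_self _).trans h3
  simpa using this

end Scaling

end Network

/-! ### The main theorem -/

theorem mainTheorem1 :
    ∃ K₀ : ℝ, 0 < K₀ ∧ ∀ (ρ l : ℝ) (R RI q : ℝ → ℝ), 0 < ρ → 0 ≤ l →
      (∀ᶠ lam in atTop, K₀ * √(Real.log lam / lam) ≤ R lam) →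
      R =O[atTop] (fun lam => √(Real.log lam / lam)) →
      (∀ lam, RI lam = √(1 + l) * R lam) →
      (∀ᶠ lam in atTop, 0 ≤ q lam ∧ q lam ≤ 1) →
      q =O[atTop] (fun lam => 1 / Real.log lam) →
      -- average progress per hop
      (fun lam => Network.meanProgress ρ lam (R lam)) ~[atTop]
        (fun lam => 4 * R lam / (3 * Real.pi)) ∧
      -- spatial throughput
      (fun lam => Network.spatialThroughput ρ lam (R lam) (RI lam) (q lam)) ~[atTop]
        (fun lam => lam * volume.real (Network.area ρ) *
          Network.successProb ρ lam (R lam) (RI lam) (q lam) *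
          Network.meanDistancePerHop ρ lam (R lam)) ∧
      (fun lam => Network.spatialThroughput ρ lam (R lam) (RI lam) (q lam)) ~[atTop]
        (fun lam => 4 * volume.real (Network.area ρ) / (3 * Real.pi) * (lam * q lam * R lam) *
          Real.exp (-(lam * q lam * Real.pi * RI lam ^ 2)) *
          (1 - Real.exp (-(lam * (1 - q lam) * Real.pi * RI lam ^ 2)))) ∧
      -- scaling law
      (fun lam => Network.spatialThroughput ρ lam (R lam) (RI lam) (q lam)) =O[atTop]
        (fun lam => √(lam / Real.log lam)) ∧
      (q =Θ[atTop] (fun lam => 1 / Real.log lam) →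
        (fun lam => Network.spatialThroughput ρ lam (R lam) (RI lam) (q lam)) =Θ[atTop]
          (fun lam => √(lam / Real.log lam))) ∧
      -- asymptotic multiplexing gain
      ((∀ᶠ lam in atTop, q lam = 1 / (lam * Real.pi * RI lam ^ 2)) →
        (fun lam => lam * q lam * R lam) =Θ[atTop] (fun lam => √(lam / Real.log lam)) ∧
        Network.IsAMG (fun lam => Network.spatialThroughput ρ lam (R lam) (RI lam) (q lam))
          (fun lam => lam * q lam * R lam)
          (4 * volume.real (Network.area ρ) * Real.exp (-1) / (3 * Real.pi))) := by
  obtain ⟨K₀, hK₀, hnice⟩ := Network.eventually_le_typicalExpect_nicePacket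
  refine ⟨K₀, hK₀, fun ρ l R RI q hρ hl hRlow hRO hRI hq hqO => ?_⟩
  obtain rfl : RI = fun lam => √(1 + l) * R lam := funext hRI
  set c := √(1 + l) with hcdef
  have hc : 1 ≤ c := Real.one_le_sqrt.2 (by linarith)
  have hpi := Real.pi_pos
  have hA : 0 < volume.real (Network.area ρ) := by
    rw [Network.volume_real_area hρ.le]; positivity
  have hRpos : ∀ᶠ lam in atTop, 0 < R lam := by
    filter_upwards [hRlow, eventually_gt_atTop 1] with lam h1 h2
    have := Network.sqrt_log_div_pos h2
    exact (by positivity : 0 < K₀ * √(Real.log lam / lam)).trans_le h1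
  have hR0 : Tendsto R atTop (𝓝[>] 0) := tendsto_nhdsWithin_iff.2
    ⟨hRO.trans_tendsto Network.tendsto_sqrt_log_div, hRpos⟩
  have hq0 : Tendsto q atTop (𝓝 0) := hqO.trans_tendsto <| by
    simp only [one_div]
    exact Real.tendsto_log_atTop.inv_tendsto_atTop
  -- The lower bound with K₀, needed above for sparsity, also makes the order of `R` two-sided,
  -- which the Θ-statements require.
  have hRΘ : R =Θ[atTop] fun lam => √(Real.log lam / lam) := by
    refine ⟨hRO, IsBigO.of_bound K₀⁻¹ ?_⟩
    filter_upwards [hRlow, hRpos] with lam h1 h2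
    rw [Real.norm_of_nonneg (Real.sqrt_nonneg _), Real.norm_of_nonneg h2.le, inv_mul_eq_div,
      le_div_iff₀ hK₀, mul_comm]
    exact h1
  obtain ⟨G, hG0, hG⟩ := Network.exists_mul_sq_le hRO hqO
  have hT := hnice ρ c R hρ hc hRlow hR0
  have hC := Network.isEquivalent_spatialThroughput hρ hc hG0 hRpos hq hq0 hG hT
  have hCΘ := Network.isTheta_spatialThroughput hρ hc hG0 hRpos hq hq0 hG hT
  have hscale : (fun lam => lam * (1 / Real.log lam) * √(Real.log lam / lam)) =ᶠ[atTop]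
      fun lam => √(lam / Real.log lam) := by
    filter_upwards [eventually_gt_atTop 1] with lam h1
    exact Network.mul_sqrt_log_div h1
  refine ⟨?_, ?_, ?_, ?_, fun hqΘ => ?_, fun hq1 => ⟨?_, hCΘ, ?_⟩⟩
  · refine (Network.isEquivalent_meanProgress hρ hRpos hT).congr_right (.of_eq ?_)
    funext lam
    ring
  · refine hC.trans (IsEquivalent.symm ?_)
    refine (((IsEquivalent.refl (u := fun lam => lam * volume.real (Network.area ρ))).mul
      (Network.isEquivalent_successProb hρ hc hG0 hRpos hq hq0 hG hT)).mul
      (Network.isEquivalent_meanDistancePerHop hρ hRpos hT)).congr_right (.of_eq ?_)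
    funext lam
    simp only [Pi.mul_apply]
    ring
  -- The extra factor in the stated formula tends to 1, because λR² tends to infinity and q to 0, so
  -- it does not affect the equivalence.
  · have h1 : Tendsto (fun lam => 1 - Real.exp (-(lam * (1 - q lam) * Real.pi * (c * R lam) ^ 2)))
        atTop (𝓝 1) := by
      have h2 : Tendsto (fun lam => lam * (1 - q lam) * Real.pi * (c * R lam) ^ 2) atTop atTop := by
        have h3 : Tendsto (fun lam => Real.pi * c ^ 2 * (1 - q lam)) atTop
            (𝓝 (Real.pi * c ^ 2 * (1 - 0))) := (hq0.const_sub 1).const_mul _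
        refine ((Network.tendsto_mul_sq_atTop hK₀ hRlow).atTop_mul_pos
          (by positivity : 0 < Real.pi * c ^ 2 * (1 - 0)) h3).congr fun lam => ?_
        ring
      simpa using (Real.tendsto_exp_neg_atTop_nhds_zero.comp h2).const_sub 1
    have h2 : (fun _ => (1 : ℝ)) ~[atTop] fun lam =>
        1 - Real.exp (-(lam * (1 - q lam) * Real.pi * (c * R lam) ^ 2)) :=
      ((isEquivalent_const_iff_tendsto one_ne_zero).2 h1).symm
    refine ((hC.mul h2).congr_left (.of_eq ?_)).congr_right (.of_eq ?_)
    · funext lam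
      simp
    · funext lam
      simp only [Pi.mul_apply]
      ring
  · refine hCΘ.isBigO.trans ((((isBigO_refl (fun lam : ℝ => lam) atTop).mul hqO).mul
      hRO).trans_eventuallyEq hscale)
  · refine hCΘ.trans ((((isTheta_refl (fun lam : ℝ => lam) atTop).mul hqΘ).mul
      hRΘ).trans_eventuallyEq hscale)
  -- With this transmission probability λqR = 1/(πc²R), so its order is that of 1/R.
  · have h1 : (fun lam => lam * q lam * R lam) =ᶠ[atTop]
        fun lam => 1 / (Real.pi * c ^ 2) * (R lam)⁻¹ := by
      filter_upwards [hq1, hRpos, eventually_gt_atTop 0] with lam h1 h2 h3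
      rw [h1]
      field_simp
    refine h1.trans_isTheta ((isTheta_const_mul_left (by positivity)).2
      (hRΘ.inv.trans_eventuallyEq (.of_eq ?_)))
    funext lam
    rw [← Network.one_div_sqrt_log_div, one_div]
  · have hpos : ∀ᶠ lam in atTop, 0 < lam * q lam * R lam := by
      filter_upwards [hq1, hRpos, eventually_gt_atTop 0] with lam h1 h2 h3
      rw [h1]
      positivity
    set χ := 4 * volume.real (Network.area ρ) * Real.exp (-1) / (3 * Real.pi) with hχ
    have hχ0 : 0 < χ := by positivity
    have h1 : (fun lam => Network.spatialThroughput ρ lam (R lam) (c * R lam) (q lam)) ~[atTop]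
        fun lam => χ * (lam * q lam * R lam) := by
      refine hC.congr_right ?_
      filter_upwards [hq1, hRpos, eventually_gt_atTop 0] with lam h1 h2 h3
      -- One expected transmitter per interference disk, which produces the factor e⁻¹ in the gain.
      have h4 : lam * q lam * Real.pi * (c * R lam) ^ 2 = 1 := by
        rw [h1]
        field_simp
      rw [h4, hχ]
      ring
    have h2 := (isEquivalent_iff_tendsto_one (hpos.mono fun lam h => by positivity)).1 h1
    have h3 := h2.const_mul χ
    rw [mul_one] at h3
    refine h3.congr' ?_
    filter_upwards [hpos] with lam h4
    simp only [Pi.div_apply]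
    field_simp
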